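/- Let $n\ge 1$, $\alpha,\beta\in\mathbb{R}$, and let $\Gamma\subset\mathrm{Sp}_n(\mathbb{R})$ be a subgroup commensurable with $\mathrm{Sp}_n(\mathbb{Z})$, acting on the Siegel upper half-space $\mathbb{H}_n$ of complex symmetric matrices $Z=X+iY$ with $Y>0$ by $\gamma Z=(AZ+B)(CZ+D)^{-1}$ for $\gamma=\begin{pmatrix}A&B\\C&D\end{pmatrix}$. For every $\gamma\in\mathrm{Sp}_n(\mathbb{R})$ fix a continuous branch $\ell_\gamma$ of $\log\det(CZ+D)$ on $\mathbb{H}_n$ and put $\det(CZ+D)^s=e^{s\ell_\gamma(Z)}$, $\det(C\overline{Z}+D)^s=e^{s\overline{\ell_\gamma(Z)}}$ for real $s$. (If $\alpha-\beta\in\mathbb{Z}$, then $\det(CZ+D)^{\alpha}\det(C\overline{Z}+D)^{\beta}$ and $\det(CZ+D)^{\alpha-\beta}$ do not depend on the choice.) Let $\mathcal{V}_{\alpha,\beta}^n(\Gamma)$ be the space of real-analytic $\varphi:\mathbb{H}_n\to\mathbb{C}$ such that (a) $\varphi(\gamma Z)=\det(CZ+D)^{\alpha}\det(C\overline{Z}+D)^{\beta}\varphi(Z)$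 for all $\gamma\in\Gamma$; (b) for all real symmetric $Y_0>0$ and all $\gamma\in\mathrm{Sp}_n(\mathbb{Z})$ there are $N\in\mathbb{N}$ and $M>0$ with $|\det(CZ+D)^{-\alpha}\det(C\overline{Z}+D)^{-\beta}\varphi(\gamma Z)|\le M\,\mathrm{tr}(Y)^N$ whenever $Y\ge Y_0$. Let $\mathcal{H}_{\alpha,\beta}^n(\Gamma)$ be the space of those $\varphi\in\mathcal{V}_{\alpha,\beta}^n(\Gamma)$ with $\int_{\Gamma\backslash\mathbb{H}_n}\det(Y)^{\alpha+\beta}|\varphi(Z)|^2\,d\mu_n(Z)<\infty$, where $d\mu_n=\det(Y)^{-(n+1)}\prod_{j\le k}dx_{j,k}\,dy_{j,k}$. Let $\partial/\partial Z=\frac12(\partial/\partial X-i\,\partial/\partial Y)$ and $\partial/\partial\overline{Z}=\frac12(\partial/\partial X+i\,\partial/\partial Y)$, where $(\partial/\partial X)_{j,k}=\frac{1+\delta_{j,k}}{2}\,\partial/\partial x_{j,k}$ and $(\partial/\partial Y)_{j,k}=\frac{1+\delta_{j,k}}{2}\,\partial/\partial y_{j,k}$. Put $$K_\alpha=(Z-\overline{Z})\frac{\partial}{\partial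 Z}+\alpha\mathbf{1}_n,\qquad \Lambda_\beta=(Z-\overline{Z})\frac{\partial}{\partial\overline{Z}}-\beta\mathbf{1}_n,$$ $$\Delta_{\alpha,\beta}=-\mathrm{tr}\Big(\Lambda_{\beta-(n+1)/2}K_\alpha+\alpha\big(\beta-\tfrac{n+1}{2}\big)\mathbf{1}_n\Big).$$ Let $0\ne\varphi\in\mathcal{H}_{\alpha,\beta}^n(\Gamma)$ be an eigenform of $\Delta_{\alpha,\beta}$ with eigenvalue $\lambda\in\mathbb{C}$, i.e. $(\Delta_{\alpha,\beta}+\lambda)\varphi=0$. Then the following hold. 1. $\lambda\in\mathbb{R}$ and $\lambda\ge n\beta\big(\alpha-\frac{n+1}{2}\big)$. 2. $\lambda=n\beta\big(\alpha-\frac{n+1}{2}\big)$ if and only if $\Lambda_\beta\varphi=0$, and also if and only if $\varphi(Z)=\det(Y)^{-\beta}f(Z)$ for a holomorphic $f:\mathbb{H}_n\to\mathbb{C}$ with $f(\gamma Z)=\det(CZ+D)^{\alpha-\beta}f(Z)$ for all $\gamma\in\Gamma$. 3. Suppose that $\beta<0$ and that $\varphi$ satisfies (b) with $N=0$ for all $Y_0$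 and $\gamma$, or that $\beta<0$ and $\alpha-\beta\ge n$. Then every $f$ as in 2 is a Siegel cusp form of weight $\alpha-\beta$ and degree $n$ for $\Gamma$: for all $Y_0>0$ and $\gamma\in\mathrm{Sp}_n(\mathbb{Z})$, the quantity $\det(CZ+D)^{-(\alpha-\beta)}f(\gamma Z)$ is bounded in the region $Y\ge Y_0$, and tends to $0$ there as $\det Y\to\infty$. -/

import Mathlib

open Matrix MeasureTheory
open scoped ComplexConjugate

noncomputable section

namespace SiegelMaass

variable {n : ℕ}

/-! ### The Siegel upper half-space and the symplectic action -/

/-- Complex symmetric `n × n` matrices through their independent entries `z_{j,k}`, indexed by the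
unordered pairs `{j, k}`. As a measure space this carries the Lebesgue measure
`∏_{j ≤ k} dx_{j,k} dy_{j,k}`. -/
abbrev SymC (n : ℕ) : Type := Sym2 (Fin n) → ℂ

/-- The symmetric matrix `Z` with entries `z_{j,k}`. -/
def toMat (z : SymC n) : Matrix (Fin n) (Fin n) ℂ := Matrix.of fun j k => z s(j, k)

/-- The upper triangular entries of a matrix. -/
def ofMat (M : Matrix (Fin n) (Fin n) ℂ) : SymC n := fun p => M p.inf p.sup

theorem ofMat_toMat (z : SymC n) : ofMat (toMat z) = z := by
  funext p
  induction p with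
  | _ a b =>
    rcases le_total a b with h | h
    · simp [ofMat, toMat, h]
    · simp [ofMat, toMat, h, Sym2.eq_swap]

theorem toMat_ofMat (M : Matrix (Fin n) (Fin n) ℂ) (hM : Mᵀ = M) : toMat (ofMat M) = M := by
  ext a b
  rcases le_total a b with h | h
  · simp [ofMat, toMat, h]
  · simpa [ofMat, toMat, h] using congrFun (congrFun hM a) b

/-- `Y = Im Z`. -/
def imMat (z : SymC n) : Matrix (Fin n) (Fin n) ℝ := Matrix.of fun j k => (z s(j, k)).im

/-- The Siegel upper half-space `ℍ_n` of degree `n`. -/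
def upperHalfSpace (n : ℕ) : Set (SymC n) := {z | (imMat z).PosDef}

/-- The symplectic group `Sp_n(ℝ)`. -/
abbrev SpR (n : ℕ) : Type := Matrix.symplecticGroup (Fin n) ℝ

/-- `Sp_n(ℤ)` as a subgroup of `Sp_n(ℝ)`: the image under the entrywise inclusion `ℤ → ℝ`. -/
def SpZ (n : ℕ) : Subgroup (SpR n) where
  carrier := {γ | ∃ M ∈ Matrix.symplecticGroup (Fin n) ℤ, M.map (Int.castRingHom ℝ) = γ.1}
  one_mem' := ⟨1, one_mem _, by simp⟩
  mul_mem' := by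
    rintro a b ⟨M, hM, ha⟩ ⟨N, hN, hb⟩
    exact ⟨M * N, mul_mem hM hN, by rw [Matrix.map_mul, ha, hb]; rfl⟩
  inv_mem' := by
    rintro a ⟨M, hM, ha⟩
    refine ⟨((⟨M, hM⟩ : Matrix.symplecticGroup (Fin n) ℤ)⁻¹).1, Subtype.property _, ?_⟩
    rw [SymplecticGroup.coe_inv, SymplecticGroup.coe_inv, Matrix.map_mul, Matrix.map_mul, ← ha,
      ← Matrix.map_J (Fin n) (Int.castRingHom ℝ), Matrix.transpose_map]
    congr 2
    ext i j
    simp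

/-- `A Z + B` for `γ = (A, B; C, D)`. -/
def num (γ : SpR n) (z : SymC n) : Matrix (Fin n) (Fin n) ℂ :=
  γ.1.toBlocks₁₁.map Complex.ofReal * toMat z + γ.1.toBlocks₁₂.map Complex.ofReal

/-- `C Z + D` for `γ = (A, B; C, D)`. -/
def denom (γ : SpR n) (z : SymC n) : Matrix (Fin n) (Fin n) ℂ :=
  γ.1.toBlocks₂₁.map Complex.ofReal * toMat z + γ.1.toBlocks₂₂.map Complex.ofReal

/-- The symplectic action `γ Z = (A Z + B) (C Z + D)⁻¹`. -/
def act (γ : SpR n) (z : SymC n) : SymC n := ofMat (num γ z * (denom γ z)⁻¹)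

/-- `ℍ_n` is convex. -/
theorem convex_upperHalfSpace (n : ℕ) : Convex ℝ (upperHalfSpace n) := by
  rw [convex_iff_forall_pos]
  intro z hz w hw a b ha hb _
  have h : imMat (a • z + b • w) = a • imMat z + b • imMat w := by
    ext j k
    simp [imMat]
  change (imMat (a • z + b • w)).PosDef
  rw [h]
  exact (Matrix.PosDef.smul hz ha).add (Matrix.PosDef.smul hw hb)

/-- `det (C Z + D)` has no zero on `ℍ_n`. -/
theorem det_denom_ne_zero (γ : SpR n) {z : SymC n} (hz : z ∈ upperHalfSpace n) :
    (denom γ z).det ≠ 0 := by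
  intro h0
  obtain ⟨v, hv, hv0⟩ := Matrix.exists_mulVec_eq_zero_iff.mpr h0
  obtain ⟨γ, hγ⟩ := γ
  obtain ⟨A, B, C, D, rfl⟩ : ∃ A B C D, γ = fromBlocks A B C D :=
    ⟨_, _, _, _, (fromBlocks_toBlocks γ).symm⟩
  obtain ⟨h1, h2, h3⟩ := SymplecticGroup.fromBlocks_mem_iff.mp hγ
  set Z := toMat z
  set Zb := (toMat z).map conj
  have key : (num ⟨_, hγ⟩ z)ᵀ * (denom ⟨_, hγ⟩ z).map conj
      - (denom ⟨_, hγ⟩ z)ᵀ * (num ⟨_, hγ⟩ z).map conj = Z - Zb := by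
    have hZ : Zᵀ = Z := by ext j k; simp [Z, toMat, Sym2.eq_swap]
    have e (M : Matrix (Fin n) (Fin n) ℝ) :
        (M.map Complex.ofReal).map conj = M.map Complex.ofReal := by
      ext j k; simp
    have m (M N : Matrix (Fin n) (Fin n) ℝ) :
        M.map Complex.ofReal * N.map Complex.ofReal = (M * N).map Complex.ofReal :=
      (Matrix.map_mul (f := Complex.ofRealHom)).symm
    have h1' := congrArg (fun M => M.map Complex.ofReal) h1
    have h2' := congrArg (fun M => M.map Complex.ofReal) h2
    have h3' := congrArg (fun M => M.map Complex.ofReal) h3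
    have h4' := congrArg (fun M => M.map Complex.ofReal) (congrArg Matrix.transpose h3)
    simp only [Matrix.transpose_sub, Matrix.transpose_mul, Matrix.transpose_transpose,
      Matrix.map_sub _ Complex.ofReal_sub, ← m, Matrix.transpose_one,
      Matrix.map_one _ Complex.ofReal_zero Complex.ofReal_one] at h1' h2' h3' h4'
    simp only [num, denom, toBlocks_fromBlocks₁₁, toBlocks_fromBlocks₁₂, toBlocks_fromBlocks₂₁,
      toBlocks_fromBlocks₂₂, Matrix.map_add _ (map_add conj), Matrix.map_mul, e,
      Matrix.transpose_add, Matrix.transpose_mul]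
    rw [show (toMat z)ᵀ = Z from hZ]
    change (Z * _ + _) * (_ * Zb + _) - (Z * _ + _) * (_ * Zb + _) = _
    simp only [Matrix.transpose_map] at h1' h2' h3' h4' ⊢
    generalize A.map Complex.ofReal = A' at *
    generalize B.map Complex.ofReal = B' at *
    generalize C.map Complex.ofReal = C' at *
    generalize D.map Complex.ofReal = D' at *
    have : (Z * A'ᵀ + B'ᵀ) * (C' * Zb + D') - (Z * C'ᵀ + D'ᵀ) * (A' * Zb + B')
        = Z * (A'ᵀ * C' - C'ᵀ * A') * Zb + Z * (A'ᵀ * D' - C'ᵀ * B') - (D'ᵀ * A' - B'ᵀ * C') * Zb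
          + (B'ᵀ * D' - D'ᵀ * B') := by noncomm_ring
    rw [this, h1', h2', h3', h4']
    simp
  have hvb : (denom ⟨_, hγ⟩ z).map conj *ᵥ (star v) = 0 := by
    have := congrArg star hv0
    ext j
    have := congrFun this j
    simpa [Matrix.mulVec, dotProduct] using this
  have hvt : v ᵥ* (denom ⟨_, hγ⟩ z)ᵀ = 0 := by rw [Matrix.vecMul_transpose, hv0]
  have h5 : v ⬝ᵥ ((Z - Zb) *ᵥ star v) = 0 := by
    rw [← key, Matrix.sub_mulVec, ← Matrix.mulVec_mulVec, hvb, Matrix.mulVec_zero,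
      ← Matrix.mulVec_mulVec, zero_sub, dotProduct_neg, Matrix.dotProduct_mulVec, hvt,
      zero_dotProduct, neg_zero]
  have h6 (j k : Fin n) : (Z - Zb) j k = 2 * Complex.I * (imMat z j k : ℝ) := by
    simp only [Z, Zb, toMat, imMat, Matrix.sub_apply, Matrix.map_apply, Matrix.of_apply]
    rw [Complex.sub_conj]; push_cast; ring
  have h7 : (imMat z) *ᵥ (fun i => (v i).re) ⬝ᵥ (fun i => (v i).re)
      + (imMat z) *ᵥ (fun i => (v i).im) ⬝ᵥ (fun i => (v i).im) = 0 := by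
    have h8 := congrArg Complex.im h5
    simp only [dotProduct, Matrix.mulVec, h6, Pi.star_apply, Complex.im_sum, Finset.mul_sum,
      Complex.zero_im] at h8
    have hs (j k : Fin n) : imMat z j k = imMat z k j := by simp [imMat, Sym2.eq_swap]
    simp only [dotProduct, Matrix.mulVec, Finset.sum_mul]
    rw [← Finset.sum_add_distrib]
    have : ∀ j k : Fin n, (v j * (2 * Complex.I * ((imMat z j k : ℝ) : ℂ) * star (v k))).im
        = 2 * (imMat z j k * (v k).re * (v j).re + imMat z j k * (v k).im * (v j).im) := by
      intro j k
      simp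
      ring
    simp only [this, ← Finset.mul_sum] at h8
    simpa [Finset.sum_add_distrib] using h8
  have pos (x : Fin n → ℝ) : 0 ≤ (imMat z) *ᵥ x ⬝ᵥ x := by
    have := (Matrix.PosDef.posSemidef hz).dotProduct_mulVec_nonneg x
    rw [dotProduct_comm]; simpa using this
  have pos' (x : Fin n → ℝ) (hx : (imMat z) *ᵥ x ⬝ᵥ x = 0) : x = 0 := by
    by_contra hne
    have := Matrix.PosDef.dotProduct_mulVec_pos hz hne
    rw [dotProduct_comm] at hx
    simp [hx] at this
  have a1 := pos' _ (le_antisymm (by linarith [pos fun i => (v i).im]) (pos fun i => (v i).re))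
  have a2 := pos' _ (le_antisymm (by linarith [pos fun i => (v i).re]) (pos fun i => (v i).im))
  apply hv
  ext i
  exact Complex.ext (congrFun a1 i) (congrFun a2 i)

/-! ### Real powers of the automorphy factor -/

/-- A choice, for every `γ = (A, B; C, D)`, of a continuous branch on `ℍ_n` of
`Z ↦ log det (C Z + D)`. It fixes the meaning of the real powers of `det (C Z + D)`. -/
structure LogBranch (n : ℕ) where
  log : SpR n → SymC n → ℂ
  continuousOn_log : ∀ γ, ContinuousOn (log γ) (upperHalfSpace n)
  exp_log : ∀ γ, ∀ z ∈ upperHalfSpace n, Complex.exp (log γ z) = (denom γ z).det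

/-- Continuous branches of `log det (C Z + D)` exist, since `ℍ_n` is convex and `det (C Z + D)` has
no zero on it. -/
theorem LogBranch.nonempty (n : ℕ) : Nonempty (LogBranch n) := by
  have hex (γ : SpR n) : ∃ F : SymC n → ℂ, ContinuousOn F (upperHalfSpace n) ∧
      ∀ z ∈ upperHalfSpace n, Complex.exp (F z) = (denom γ z).det := by
    rcases (upperHalfSpace n).eq_empty_or_nonempty with h | ⟨z₀, hz₀⟩
    · exact ⟨0, by simp [h]⟩
    have hc : Continuous fun z => (denom γ z).det := by
      unfold denom toMat
      fun_prop
    have hmem (t : unitInterval) (a : upperHalfSpace n) :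
        z₀ + (t : ℝ) • ((a : SymC n) - z₀) ∈ upperHalfSpace n :=
      (convex_upperHalfSpace n).add_smul_sub_mem hz₀ a.2 t.2
    let H : C(unitInterval × upperHalfSpace n, {w : ℂ // w ≠ 0}) :=
      ⟨fun p => ⟨(denom γ (z₀ + (p.1 : ℝ) • ((p.2 : SymC n) - z₀))).det,
        det_denom_ne_zero γ (hmem p.1 p.2)⟩,
        Continuous.subtype_mk (hc.comp (by fun_prop)) _⟩
    let f : C(upperHalfSpace n, ℂ) := .const _ (Complex.log (denom γ z₀).det)
    have H0 : ∀ a, H (0, a) = ⟨Complex.exp (f a), Complex.exp_ne_zero _⟩ := by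
      intro a
      apply Subtype.ext
      simp [H, f, Complex.exp_log (det_denom_ne_zero γ hz₀)]
    have hl := Complex.isCoveringMap_exp.liftHomotopy_lifts H f H0
    set G := Complex.isCoveringMap_exp.liftHomotopy H f H0
    classical
    refine ⟨fun z => if hz : z ∈ upperHalfSpace n then G (1, ⟨z, hz⟩) else 0, ?_, ?_⟩
    · rw [continuousOn_iff_continuous_domRestrict]
      have : Continuous fun a : upperHalfSpace n => G (1, a) := by fun_prop
      convert this using 1
      ext a
      simp
    · intro z hz
      have := congrArg Subtype.val (congrFun hl (1, ⟨z, hz⟩))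
      simpa [hz, H] using this
  choose F hF hF' using hex
  exact ⟨⟨F, hF, hF'⟩⟩

/-- `det (C Z + D) ^ s`. -/
def LogBranch.detPow (L : LogBranch n) (γ : SpR n) (s : ℝ) (z : SymC n) : ℂ :=
  Complex.exp (s * L.log γ z)

/-- `det (C Z̄ + D) ^ s`, the complex conjugate of `det (C Z + D) ^ s`. -/
def LogBranch.detConjPow (L : LogBranch n) (γ : SpR n) (s : ℝ) (z : SymC n) : ℂ :=
  Complex.exp (s * conj (L.log γ z))

/-- For an integer exponent the power does not depend on the branch. -/
theorem LogBranch.detPow_intCast (L : LogBranch n) (γ : SpR n) (k : ℤ) {z : SymC n}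
    (hz : z ∈ upperHalfSpace n) : L.detPow γ k z = (denom γ z).det ^ k := by
  rw [← L.exp_log γ z hz, LogBranch.detPow, ← Complex.exp_int_mul]
  simp

/-- If `α - β` is an integer, then `det (C Z + D) ^ α * det (C Z̄ + D) ^ β` does not depend on the
branch: it is `|det (C Z + D)| ^ (2 β) * det (C Z + D) ^ (α - β)`. -/
theorem LogBranch.detPow_mul_detConjPow (L : LogBranch n) (γ : SpR n) (β : ℝ) (k : ℤ) {z : SymC n}
    (hz : z ∈ upperHalfSpace n) :
    L.detPow γ (β + k) z * L.detConjPow γ β z =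
      ((‖(denom γ z).det‖ ^ (2 * β) : ℝ) : ℂ) * (denom γ z).det ^ k := by
  rw [← L.exp_log γ z hz, LogBranch.detPow, LogBranch.detConjPow, ← Complex.exp_int_mul,
    Complex.norm_exp, ← Real.exp_mul, Complex.ofReal_exp, ← Complex.exp_add, ← Complex.exp_add]
  congr 1
  have h : (((L.log γ z).re : ℝ) : ℂ) = (L.log γ z + conj (L.log γ z)) / 2 := by
    rw [Complex.add_conj]; push_cast; ring
  push_cast
  rw [h]
  ring

/-! ### The operators of Maass -/

/-- The entry `(j, k)` of `∂/∂X`, namely `(1 + δ_{j,k}) / 2 * ∂/∂x_{j,k}`. -/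
def dX (j k : Fin n) (g : SymC n → ℂ) (z : SymC n) : ℂ :=
  ((1 + if j = k then 1 else 0) / 2) * fderiv ℝ g z (Pi.single s(j, k) 1)

/-- The entry `(j, k)` of `∂/∂Y`, namely `(1 + δ_{j,k}) / 2 * ∂/∂y_{j,k}`. -/
def dY (j k : Fin n) (g : SymC n → ℂ) (z : SymC n) : ℂ :=
  ((1 + if j = k then 1 else 0) / 2) * fderiv ℝ g z (Pi.single s(j, k) Complex.I)

/-- The entry `(j, k)` of `∂/∂Z = (∂/∂X - i ∂/∂Y) / 2`. -/
def dZ (j k : Fin n) (g : SymC n → ℂ) (z : SymC n) : ℂ :=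
  1 / 2 * (dX j k g z - Complex.I * dY j k g z)

/-- The entry `(j, k)` of `∂/∂Z̄ = (∂/∂X + i ∂/∂Y) / 2`. -/
def dZbar (j k : Fin n) (g : SymC n → ℂ) (z : SymC n) : ℂ :=
  1 / 2 * (dX j k g z + Complex.I * dY j k g z)

/-- `Z - Z̄`. -/
def subConj (z : SymC n) : Matrix (Fin n) (Fin n) ℂ := toMat z - (toMat z).map conj

/-- `K_a = (Z - Z̄) ∂/∂Z + a 1_n`, acting on matrix valued functions by matrix multiplication. -/
def opK (a : ℝ) (Φ : SymC n → Matrix (Fin n) (Fin n) ℂ) (z : SymC n) :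
    Matrix (Fin n) (Fin n) ℂ :=
  subConj z * (Matrix.of fun j k => ∑ m, dZ j m (fun w => Φ w m k) z) + (a : ℂ) • Φ z

/-- `Λ_b = (Z - Z̄) ∂/∂Z̄ - b 1_n`, acting on matrix valued functions by matrix multiplication. -/
def opLambda (b : ℝ) (Φ : SymC n → Matrix (Fin n) (Fin n) ℂ) (z : SymC n) :
    Matrix (Fin n) (Fin n) ℂ :=
  subConj z * (Matrix.of fun j k => ∑ m, dZbar j m (fun w => Φ w m k) z) - (b : ℂ) • Φ z

/-- A scalar function as the matrix valued function `φ 1_n`. A matrix of scalar operators acts on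
`φ` as it acts on `φ 1_n`. -/
def scalarMat (φ : SymC n → ℂ) (z : SymC n) : Matrix (Fin n) (Fin n) ℂ := φ z • 1

/-- `Ω_{α,β} = Λ_{β-(n+1)/2} K_α + α (β - (n+1)/2) 1_n`. -/
def opOmega (α β : ℝ) (φ : SymC n → ℂ) (z : SymC n) : Matrix (Fin n) (Fin n) ℂ :=
  opLambda (β - (n + 1) / 2) (opK α (scalarMat φ)) z +
    ((α * (β - (n + 1) / 2) : ℝ) : ℂ) • scalarMat φ z

/-- The Siegel–Maass Laplacian `Δ_{α,β} = - tr Ω_{α,β}` of weight `(α, β)`. -/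
def laplacian (α β : ℝ) (φ : SymC n → ℂ) (z : SymC n) : ℂ := -(opOmega α β φ z).trace

/-! ### Automorphic forms of weight `(α, β)` -/

/-- The condition that
`|det (C Z + D) ^ (-α) det (C Z̄ + D) ^ (-β) φ (γ Z)| ≤ M tr (Y) ^ N` for some `M > 0`
in the region `Y ≥ Y₀`. -/
def GrowthBound (L : LogBranch n) (α β : ℝ) (φ : SymC n → ℂ) (γ : SpR n)
    (Y₀ : Matrix (Fin n) (Fin n) ℝ) (N : ℕ) : Prop :=
  ∃ M : ℝ, 0 < M ∧ ∀ z ∈ upperHalfSpace n, (imMat z - Y₀).PosSemidef →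
    ‖L.detPow γ (-α) z * L.detConjPow γ (-β) z * φ (act γ z)‖ ≤ M * (imMat z).trace ^ N

/-- The space `V_{α,β}^n(Γ)`. The growth condition does not change when `γ` is multiplied from the
left by an element of `Γ`, so asking it for all `γ ∈ Sp_n(ℤ)` is the same as asking it for a
(finite) set of representatives of the cosets of `Γ ∩ Sp_n(ℤ)`. -/
structure MemV (L : LogBranch n) (Γ : Subgroup (SpR n)) (α β : ℝ) (φ : SymC n → ℂ) : Prop where
  analytic : AnalyticOnNhd ℝ φ (upperHalfSpace n)
  transform : ∀ γ ∈ Γ, ∀ z ∈ upperHalfSpace n,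
    φ (act γ z) = L.detPow γ α z * L.detConjPow γ β z * φ z
  growth : ∀ Y₀ : Matrix (Fin n) (Fin n) ℝ, Y₀.PosDef → ∀ γ ∈ SpZ n,
    ∃ N : ℕ, GrowthBound L α β φ γ Y₀ N

/-- The invariant volume `dμ_n = det (Y) ^ (-(n+1)) ∏_{j ≤ k} dx_{j,k} dy_{j,k}` on `ℍ_n`. -/
def siegelMeasure (n : ℕ) : Measure (SymC n) :=
  (volume.restrict (upperHalfSpace n)).withDensity
    fun z => ENNReal.ofReal (((imMat z).det ^ (n + 1))⁻¹)

/-- `F` is a (measurable) fundamental domain for the action of `Γ` on `ℍ_n`: its translates cover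
`ℍ_n`, and it meets `γ F` in a null set for every `γ ∈ Γ` that does not act as the identity. -/
structure IsFundDomain (Γ : Subgroup (SpR n)) (F : Set (SymC n)) : Prop where
  measurableSet : MeasurableSet F
  subset : F ⊆ upperHalfSpace n
  covers : ∀ z ∈ upperHalfSpace n, ∃ γ ∈ Γ, act γ z ∈ F
  disjoint : ∀ γ ∈ Γ, (∃ z ∈ upperHalfSpace n, act γ z ≠ z) →
    siegelMeasure n (F ∩ act γ '' F) = 0

/-- `∫ det (Y) ^ (α + β) |φ(Z)| ^ 2 dμ_n(Z)` over a set `F`; for a fundamental domain `F` of `Γ`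
this is `‖φ‖ ^ 2`, the integral over `Γ \ ℍ_n`. -/
def normSqOver (α β : ℝ) (φ : SymC n → ℂ) (F : Set (SymC n)) : ENNReal :=
  ∫⁻ z in F, ENNReal.ofReal ((imMat z).det ^ (α + β) * ‖φ z‖ ^ 2) ∂(siegelMeasure n)

/-- The space `H_{α,β}^n(Γ)` of automorphic forms of weight `(α, β)` and degree `n` for `Γ`: the
elements of `V_{α,β}^n(Γ)` with `‖φ‖ < ∞`. -/
structure MemH (L : LogBranch n) (Γ : Subgroup (SpR n)) (α β : ℝ) (φ : SymC n → ℂ) : Prop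
    extends MemV L Γ α β φ where
  norm_lt_top : ∃ F, IsFundDomain Γ F ∧ normSqOver α β φ F < ⊤

/-- `φ` is an eigenform of `Δ_{α,β}` with eigenvalue `l`, that is `φ ≠ 0` and
`(Δ_{α,β} + l) φ = 0` on `ℍ_n`. -/
def IsEigenform (α β : ℝ) (φ : SymC n → ℂ) (l : ℂ) : Prop :=
  (∃ z ∈ upperHalfSpace n, φ z ≠ 0) ∧
    ∀ z ∈ upperHalfSpace n, laplacian α β φ z + l * φ z = 0

/-! ### Siegel modular forms and cusp forms -/

/-- `f` is holomorphic on `ℍ_n` with automorphy factor `det (C Z + D) ^ k` for `Γ`. -/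
structure IsHolomorphicAutomorphic (L : LogBranch n) (Γ : Subgroup (SpR n)) (k : ℝ)
    (f : SymC n → ℂ) : Prop where
  holomorphic : DifferentiableOn ℂ f (upperHalfSpace n)
  transform : ∀ γ ∈ Γ, ∀ z ∈ upperHalfSpace n, f (act γ z) = L.detPow γ k z * f z

/-- Siegel modular forms of weight `k` and degree `n` for `Γ`. As above, a condition on all
`γ ∈ Sp_n(ℤ)` is the same as one on coset representatives. -/
structure IsSiegelModularForm (L : LogBranch n) (Γ : Subgroup (SpR n)) (k : ℝ)
    (f : SymC n → ℂ) : Prop extends IsHolomorphicAutomorphic L Γ k f where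
  bounded : ∀ Y₀ : Matrix (Fin n) (Fin n) ℝ, Y₀.PosDef → ∀ γ ∈ SpZ n,
    ∃ M : ℝ, ∀ z ∈ upperHalfSpace n, (imMat z - Y₀).PosSemidef →
      ‖L.detPow γ (-k) z * f (act γ z)‖ ≤ M

/-- Siegel cusp forms: `det (C Z + D) ^ (-k) f (γ Z)` becomes arbitrarily small in every region
`Y ≥ Y₀ > 0`, that is, it tends to `0` as `det Y → ∞` in this region. -/
structure IsSiegelCuspForm (L : LogBranch n) (Γ : Subgroup (SpR n)) (k : ℝ)
    (f : SymC n → ℂ) : Prop extends IsSiegelModularForm L Γ k f where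
  cuspidal : ∀ Y₀ : Matrix (Fin n) (Fin n) ℝ, Y₀.PosDef → ∀ γ ∈ SpZ n, ∀ ε > (0 : ℝ),
    ∃ R : ℝ, ∀ z ∈ upperHalfSpace n, (imMat z - Y₀).PosSemidef → R ≤ (imMat z).det →
      ‖L.detPow γ (-k) z * f (act γ z)‖ < ε

end SiegelMaass

end

/-! Put f = det(Y)^β φ, k = α - β and μ = λ - nβ(α - (n+1)/2). Then f transforms with the
holomorphic factor of weight k (`lift_transform`), Λ_β φ is det(Y)^(-β) (Z - Z̄) ∂f/∂Z̄
(`opLambda_scalarMat`), and the eigenvalue equation says that the ∂/∂Z-divergence of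
det(Y)^(α-n-1-β) (Z - Z̄)(∂f/∂Z̄)(Z - Z̄) is μ det(Y)^(α-n-1) φ (`sum_dZ_detY_mul_fluxMat_of_eigen`,
`fluxMat_eq`). Formally, pairing with the conjugate of f and integrating by parts over Γ\ℍ_n gives μ
∫ det(Y)^k |f|² dμ_n = ∫ det(Y)^k |∂f/∂Z̄|² dμ_n, with the invariant norm 4 tr(Y V Y V*) on the
right. The integral on the left is ‖φ‖² > 0. So μ is real and nonnegative, and it vanishes exactly
when f is holomorphic, which gives 1 and 2.

The integration by parts on the noncompact quotient is justified without reduction theory. For each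
w the identity is tested against χ = η(z,w)², where η is a smooth invariant function of two points,
compactly supported in z (`cutoff`, `integral_energyIdentity`). These identities are then integrated
over w in a fundamental domain. Every integrand is invariant under the diagonal action, so the
fundamental domain can be moved from w to z (`integral_unfold_swap`), and w then runs over all of
ℍ_n. The total integral of χ in w is a positive constant. The total integral of the cross term with
∂χ is zero, because the geodesic symmetry at z reverses gradients at z (`crossTerm_symmetry`).
Absolute convergence follows from a Caccioppoli estimate, which derives finite energy from finite
norm (`energy_balance`, `energy_balance_lift`).

For 3, |det(CZ+D)^(-k) f(γZ)| is det(Y)^β times the quantity bounded in condition (b)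
(`norm_detPow_mul_eq`). With N = 0 and β < 0 this is bounded on Y ≥ Y₀ and tends to 0 as det Y → ∞.

If k ≥ n, square integrability is used instead. By the mean value inequality, det(Y)^k |f|² at γZ is
at most a constant times its integral over a neighbourhood of fixed invariant size. Folded into a
fundamental domain, this neighbourhood has multiplicity O(det(Y)^n) (`exists_multiplicity_bound`),
which rests on a count of integral symplectic matrices (`exists_card_SpZ_le`), and it only meets
orbits that climb to height comparable to det Y. Hence |det(CZ+D)^(-k) f(γZ)|² is O(det(Y)^(n-k))
times the integral of det(Y)^k |f|² over such orbits (`exists_density_le`). The factor is bounded as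
k ≥ n, and the integral tends to 0 because heights along an orbit are bounded
(`exists_lintegral_highSet_le`). -/

noncomputable section

namespace SiegelMaass

open scoped ComplexOrder MatrixOrder

variable {n : ℕ}

/-! ### Matrices with real entries as complex matrices -/

section toC
variable {m k l : Type*}

/-- A real matrix as a complex matrix. -/
def toC (M : Matrix m k ℝ) : Matrix m k ℂ := M.map Complex.ofReal

@[simp] theorem toC_apply (M : Matrix m k ℝ) (i : m) (j : k) : toC M i j = (M i j : ℂ) := rfl

theorem toC_mul [Fintype k] (M : Matrix m k ℝ) (N : Matrix k l ℝ) : toC (M * N) = toC M * toC N :=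
  Matrix.map_mul (f := Complex.ofRealHom)

theorem toC_add (M N : Matrix m k ℝ) : toC (M + N) = toC M + toC N := by ext; simp
theorem toC_sub (M N : Matrix m k ℝ) : toC (M - N) = toC M - toC N := by ext; simp
theorem toC_neg (M : Matrix m k ℝ) : toC (-M) = -toC M := by ext; simp
@[simp] theorem toC_zero : toC (0 : Matrix m k ℝ) = 0 := by ext; simp
@[simp] theorem toC_one [DecidableEq m] : toC (1 : Matrix m m ℝ) = 1 := by
  ext i j; simp [Matrix.one_apply]; split_ifs <;> simp
theorem toC_transpose (M : Matrix m k ℝ) : toC Mᵀ = (toC M)ᵀ := by ext; simp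
@[simp] theorem toC_map_conj (M : Matrix m k ℝ) : (toC M).map conj = toC M := by ext; simp
@[simp] theorem toC_conjTranspose (M : Matrix m k ℝ) : (toC M)ᴴ = (toC M)ᵀ := by ext; simp
theorem toC_injective : Function.Injective (toC : Matrix m k ℝ → Matrix m k ℂ) := by
  intro M N h
  ext i j
  exact Complex.ofReal_injective (congrFun (congrFun h i) j)

theorem toC_det [Fintype m] [DecidableEq m] (M : Matrix m m ℝ) : (toC M).det = (M.det : ℂ) :=
  (RingHom.map_det Complex.ofRealHom M).symm

theorem toC_inv [Fintype m] [DecidableEq m] (M : Matrix m m ℝ) (h : M.det ≠ 0) :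
    toC M⁻¹ = (toC M)⁻¹ := by
  symm
  apply Matrix.inv_eq_right_inv
  rw [← toC_mul, Matrix.mul_nonsing_inv _ (isUnit_iff_ne_zero.mpr h), toC_one]

theorem map_conj_mul [Fintype k] (M : Matrix m k ℂ) (N : Matrix k l ℂ) :
    (M * N).map conj = M.map conj * N.map conj := Matrix.map_mul

theorem map_conj_add (M N : Matrix m k ℂ) :
    (M + N).map conj = M.map conj + N.map conj := by ext; simp

theorem map_conj_inv [Fintype m] [DecidableEq m] (M : Matrix m m ℂ) (h : M.det ≠ 0) :
    (M⁻¹).map conj = (M.map conj)⁻¹ := by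
  symm
  apply Matrix.inv_eq_right_inv
  rw [← map_conj_mul, Matrix.mul_nonsing_inv _ (isUnit_iff_ne_zero.mpr h)]
  exact Matrix.map_one _ (map_zero _) (map_one _)

theorem det_map_conj [Fintype m] [DecidableEq m] (M : Matrix m m ℂ) :
    (M.map conj).det = conj M.det :=
  (RingHom.map_det (starRingEnd ℂ) M).symm

theorem posDef_toC [Fintype m] [DecidableEq m] {M : Matrix m m ℝ} (h : M.PosDef) :
    (toC M).PosDef := by
  obtain ⟨B, hB, rfl⟩ := CStarAlgebra.isStrictlyPositive_iff_eq_star_mul_self.mp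
    (Matrix.isStrictlyPositive_iff_posDef.mpr h)
  have hB' : B.det ≠ 0 := ((Matrix.isUnit_iff_isUnit_det B).mp hB).ne_zero
  have : toC (star B * B) = (toC B)ᴴ * toC B := by
    rw [toC_mul, toC_conjTranspose, ← toC_transpose]; congr 1
  rw [this]
  apply Matrix.PosDef.conjTranspose_mul_self
  apply Matrix.mulVec_injective_of_isUnit
  rw [Matrix.isUnit_iff_isUnit_det, toC_det]
  simpa using hB'

theorem posDef_of_toC [Fintype m] {M : Matrix m m ℝ} (h : (toC M).PosDef) : M.PosDef := by
  apply Matrix.PosDef.of_dotProduct_mulVec_pos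
  · have := h.isHermitian
    apply toC_injective
    rw [Matrix.IsHermitian, toC_conjTranspose, ← toC_transpose] at this
    rwa [Matrix.conjTranspose_eq_transpose_of_trivial]
  · intro x hx
    have hx' : (fun i => (x i : ℂ)) ≠ 0 := by
      intro h0; apply hx; ext i; simpa using congrFun h0 i
    have := h.dotProduct_mulVec_pos hx'
    have e : star (fun i => (x i : ℂ)) ⬝ᵥ toC M *ᵥ (fun i => (x i : ℂ))
        = ((star x ⬝ᵥ M *ᵥ x : ℝ) : ℂ) := by
      simp [dotProduct, Matrix.mulVec]
    rw [e] at this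
    exact_mod_cast this

end toC

/-! ### Real and imaginary parts -/

/-- `X = Re Z`. -/
def reMat (z : SymC n) : Matrix (Fin n) (Fin n) ℝ := Matrix.of fun j k => (z s(j, k)).re

theorem toMat_transpose (z : SymC n) : (toMat z)ᵀ = toMat z := by
  ext j k; simp [toMat, Sym2.eq_swap]

theorem imMat_transpose (z : SymC n) : (imMat z)ᵀ = imMat z := by
  ext j k; simp [imMat, Sym2.eq_swap]

theorem reMat_transpose (z : SymC n) : (reMat z)ᵀ = reMat z := by
  ext j k; simp [reMat, Sym2.eq_swap]

theorem toMat_injective : Function.Injective (toMat : SymC n → _) := by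
  intro z w h
  rw [← ofMat_toMat z, h, ofMat_toMat]

theorem toMat_eq (z : SymC n) : toMat z = toC (reMat z) + Complex.I • toC (imMat z) := by
  ext j k
  simp only [toMat, reMat, imMat, Matrix.of_apply, Matrix.add_apply, toC_apply, Matrix.smul_apply,
    smul_eq_mul]
  rw [mul_comm]; exact (Complex.re_add_im _).symm

theorem toMat_star (z : SymC n) : toMat (star z) = (toMat z).map conj := by
  ext j k; simp [toMat]

theorem toMat_add (z w : SymC n) : toMat (z + w) = toMat z + toMat w := by
  ext; simp [toMat]

theorem toMat_sub (z w : SymC n) : toMat (z - w) = toMat z - toMat w := by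
  ext; simp [toMat]

theorem toMat_smul (c : ℂ) (z : SymC n) : toMat (c • z) = c • toMat z := by
  ext; simp [toMat]

theorem toMat_sub_star (z : SymC n) :
    toMat z - toMat (star z) = (2 * Complex.I) • toC (imMat z) := by
  ext j k
  simp only [toMat, imMat, Matrix.sub_apply, Matrix.of_apply, Pi.star_apply, Matrix.smul_apply,
    toC_apply, smul_eq_mul, RCLike.star_def]
  rw [Complex.sub_conj]; push_cast; ring

theorem subConj_eq (z : SymC n) : subConj z = (2 * Complex.I) • toC (imMat z) := by
  rw [subConj, ← toMat_star, toMat_sub_star]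

theorem det_imMat_pos {z : SymC n} (hz : z ∈ upperHalfSpace n) : 0 < (imMat z).det :=
  Matrix.PosDef.det_pos hz

theorem continuous_imMat : Continuous (imMat : SymC n → _) := by
  unfold imMat; fun_prop

/-- Homogeneity reduces positivity to a compact set of vectors; this is what makes ℍ_n open. -/
theorem posDef_iff_sphere {Y : Matrix (Fin n) (Fin n) ℝ} (hY : Yᵀ = Y) :
    Y.PosDef ↔ ∀ x ∈ Metric.sphere (0 : Fin n → ℝ) 1, 0 < x ⬝ᵥ Y *ᵥ x := by
  constructor
  · intro h x hx
    have hx0 : x ≠ 0 := by rintro rfl; simp at hx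
    simpa using h.dotProduct_mulVec_pos hx0
  · intro h
    refine Matrix.PosDef.of_dotProduct_mulVec_pos ?_ fun x hx => ?_
    · rwa [Matrix.IsHermitian, Matrix.conjTranspose_eq_transpose_of_trivial]
    · have hn : 0 < ‖x‖ := norm_pos_iff.mpr hx
      have := h (‖x‖⁻¹ • x) (by simp [norm_smul, hn.ne'])
      rw [Matrix.mulVec_smul, smul_dotProduct, dotProduct_smul, smul_eq_mul, smul_eq_mul,
        ← mul_assoc] at this
      simpa using pos_of_mul_pos_right this (by positivity)

theorem isOpen_upperHalfSpace (n : ℕ) : IsOpen (upperHalfSpace n) := by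
  have e : upperHalfSpace n =
      {z | ∀ x ∈ Metric.sphere (0 : Fin n → ℝ) 1, 0 < x ⬝ᵥ imMat z *ᵥ x} := by
    ext z; exact posDef_iff_sphere (imMat_transpose z)
  rw [e, isOpen_iff_eventually]
  intro z hz
  refine (isCompact_sphere (0 : Fin n → ℝ) 1).eventually_forall_of_forall_eventually
    fun x hx => ?_
  have hc : Continuous fun p : SymC n × (Fin n → ℝ) => p.2 ⬝ᵥ imMat p.1 *ᵥ p.2 := by
    have := continuous_imMat (n := n)
    fun_prop
  exact hc.continuousAt.eventually (lt_mem_nhds (hz x hx))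

/-! ### The symplectic action -/

/-- The block `A` of `γ`; likewise `blockB`, `blockC`, `blockD`. -/
abbrev blockA (γ : SpR n) : Matrix (Fin n) (Fin n) ℝ := γ.1.toBlocks₁₁
abbrev blockB (γ : SpR n) : Matrix (Fin n) (Fin n) ℝ := γ.1.toBlocks₁₂
abbrev blockC (γ : SpR n) : Matrix (Fin n) (Fin n) ℝ := γ.1.toBlocks₂₁
abbrev blockD (γ : SpR n) : Matrix (Fin n) (Fin n) ℝ := γ.1.toBlocks₂₂

theorem num_eq (γ : SpR n) (z : SymC n) :
    num γ z = toC (blockA γ) * toMat z + toC (blockB γ) := rfl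

theorem denom_eq (γ : SpR n) (z : SymC n) :
    denom γ z = toC (blockC γ) * toMat z + toC (blockD γ) := rfl

theorem fromBlocks_block (γ : SpR n) :
    fromBlocks (blockA γ) (blockB γ) (blockC γ) (blockD γ) = γ.1 := fromBlocks_toBlocks _

theorem block_relations (γ : SpR n) :
    (blockA γ)ᵀ * blockC γ = (blockC γ)ᵀ * blockA γ ∧
    (blockB γ)ᵀ * blockD γ = (blockD γ)ᵀ * blockB γ ∧
    (blockA γ)ᵀ * blockD γ - (blockC γ)ᵀ * blockB γ = 1 := by
  have h := γ.2
  rw [← fromBlocks_block γ] at h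
  exact SymplecticGroup.fromBlocks_mem_iff.mp h

/-- The defining relations of the symplectic group, polarized in two points. Taking w = z gives the
symmetry of γZ, w = z̄ the formula for Im γZ, and general w an exact difference formula from which
the derivative of the action is read off. -/
theorem num_transpose_mul_denom_sub (γ : SpR n) (z w : SymC n) :
    (num γ z)ᵀ * denom γ w - (denom γ z)ᵀ * num γ w = toMat z - toMat w := by
  obtain ⟨h1, h2, h3⟩ := block_relations γ
  have h4 := congrArg Matrix.transpose h3
  rw [num_eq, denom_eq, num_eq, denom_eq]
  have h1' := congrArg toC h1
  have h2' := congrArg toC h2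
  have h3' := congrArg toC h3
  have h4' := congrArg toC h4
  simp only [toC_mul, toC_transpose, toC_sub, toC_one, Matrix.transpose_sub, Matrix.transpose_mul,
    Matrix.transpose_transpose, Matrix.transpose_one] at h1' h2' h3' h4'
  simp only [Matrix.transpose_add, Matrix.transpose_mul, toMat_transpose]
  generalize toC (blockA γ) = A at *
  generalize toC (blockB γ) = B at *
  generalize toC (blockC γ) = C at *
  generalize toC (blockD γ) = D at *
  generalize toMat z = Z
  generalize toMat w = W
  have : (Z * Aᵀ + Bᵀ) * (C * W + D) - (Z * Cᵀ + Dᵀ) * (A * W + B)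
      = Z * (Aᵀ * C - Cᵀ * A) * W + Z * (Aᵀ * D - Cᵀ * B) - (Dᵀ * A - Bᵀ * C) * W
        + (Bᵀ * D - Dᵀ * B) := by noncomm_ring
  rw [this, h1', h2', h3', h4']
  simp

theorem isUnit_det_denom (γ : SpR n) {z : SymC n} (hz : z ∈ upperHalfSpace n) :
    IsUnit (denom γ z).det := isUnit_iff_ne_zero.mpr (det_denom_ne_zero γ hz)

theorem isUnit_det_denom_transpose (γ : SpR n) {z : SymC n} (hz : z ∈ upperHalfSpace n) :
    IsUnit (denom γ z)ᵀ.det := by rw [Matrix.det_transpose]; exact isUnit_det_denom γ hz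

theorem denom_inv_transpose_mul (γ : SpR n) {z : SymC n} (hz : z ∈ upperHalfSpace n) :
    ((denom γ z)⁻¹)ᵀ * (denom γ z)ᵀ = 1 := by
  rw [← Matrix.transpose_mul, Matrix.mul_nonsing_inv _ (isUnit_det_denom γ hz),
    Matrix.transpose_one]

theorem denom_star (γ : SpR n) (z : SymC n) : denom γ (star z) = (denom γ z).map conj := by
  rw [denom_eq, denom_eq, toMat_star, map_conj_add, map_conj_mul, toC_map_conj, toC_map_conj]

theorem num_star (γ : SpR n) (z : SymC n) : num γ (star z) = (num γ z).map conj := by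
  rw [num_eq, num_eq, toMat_star, map_conj_add, map_conj_mul, toC_map_conj, toC_map_conj]

theorem toMat_act (γ : SpR n) {z : SymC n} (hz : z ∈ upperHalfSpace n) :
    toMat (act γ z) = num γ z * (denom γ z)⁻¹ := by
  apply toMat_ofMat
  have h := num_transpose_mul_denom_sub γ z z
  rw [sub_self, sub_eq_zero] at h
  rw [Matrix.transpose_mul, Matrix.transpose_nonsing_inv]
  have hu := isUnit_det_denom γ hz
  have hu' := isUnit_det_denom_transpose γ hz
  calc ((denom γ z)ᵀ)⁻¹ * (num γ z)ᵀ
      = ((denom γ z)ᵀ)⁻¹ * ((num γ z)ᵀ * denom γ z) * (denom γ z)⁻¹ := by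
        rw [Matrix.mul_assoc, Matrix.mul_nonsing_inv_cancel_right _ _ hu]
    _ = _ := by rw [h, Matrix.nonsing_inv_mul_cancel_left _ _ hu']

theorem toMat_act_mul_denom (γ : SpR n) {z : SymC n} (hz : z ∈ upperHalfSpace n) :
    toMat (act γ z) * denom γ z = num γ z := by
  rw [toMat_act γ hz, Matrix.nonsing_inv_mul_cancel_right _ _ (isUnit_det_denom γ hz)]

/-- `γ Z - γ W = (C Z + D)⁻ᵀ (Z - W) (C W + D)⁻¹`. -/
theorem toMat_act_sub_act (γ : SpR n) {z w : SymC n} (hz : z ∈ upperHalfSpace n)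
    (hw : w ∈ upperHalfSpace n) :
    toMat (act γ z) - toMat (act γ w) =
      ((denom γ z)⁻¹)ᵀ * (toMat z - toMat w) * (denom γ w)⁻¹ := by
  have e1 : toMat (act γ z) = ((denom γ z)⁻¹)ᵀ * (num γ z)ᵀ := by
    rw [← Matrix.transpose_mul, ← toMat_act γ hz, toMat_transpose]
  rw [← num_transpose_mul_denom_sub γ z w, e1, toMat_act γ hw, Matrix.mul_sub, Matrix.sub_mul,
    ← Matrix.mul_assoc, Matrix.mul_nonsing_inv_cancel_right _ _ (isUnit_det_denom γ hw),
    ← Matrix.mul_assoc, denom_inv_transpose_mul γ hz, Matrix.one_mul]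

theorem det_denom_conj_ne_zero (γ : SpR n) {z : SymC n} (hz : z ∈ upperHalfSpace n) :
    ((denom γ z).map conj).det ≠ 0 := by
  rw [det_map_conj]; simpa using det_denom_ne_zero γ hz

/-- This is the difference formula for γZ with second point z̄. As z̄ lies outside ℍ_n, the argument
is repeated with the conjugated denominator, whose determinant is still nonzero. -/
theorem toC_imMat_act (γ : SpR n) {z : SymC n} (hz : z ∈ upperHalfSpace n) :
    toC (imMat (act γ z)) =
      ((denom γ z)⁻¹)ᵀ * toC (imMat z) * ((denom γ z)⁻¹).map conj := by
  have hc : IsUnit ((denom γ z).map conj).det := isUnit_iff_ne_zero.mpr (det_denom_conj_ne_zero γ hz)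
  have h : toMat (act γ z) - toMat (star (act γ z)) =
      ((denom γ z)⁻¹)ᵀ * (toMat z - toMat (star z)) * ((denom γ z)⁻¹).map conj := by
    have e1 : toMat (act γ z) = ((denom γ z)⁻¹)ᵀ * (num γ z)ᵀ := by
      rw [← Matrix.transpose_mul, ← toMat_act γ hz, toMat_transpose]
    have e2 : toMat (star (act γ z)) = (num γ z).map conj * ((denom γ z).map conj)⁻¹ := by
      rw [toMat_star, toMat_act γ hz, map_conj_mul, map_conj_inv _ (det_denom_ne_zero γ hz)]
    rw [← num_transpose_mul_denom_sub γ z (star z), e1, e2, denom_star, num_star,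
      map_conj_inv _ (det_denom_ne_zero γ hz), Matrix.mul_sub, Matrix.sub_mul,
      ← Matrix.mul_assoc, Matrix.mul_nonsing_inv_cancel_right _ _ hc, ← Matrix.mul_assoc,
      denom_inv_transpose_mul γ hz, Matrix.one_mul]
  rw [toMat_sub_star, toMat_sub_star, Matrix.mul_smul, Matrix.smul_mul] at h
  exact smul_right_injective _ (by simp : (2 * Complex.I : ℂ) ≠ 0) h

theorem act_mem (γ : SpR n) {z : SymC n} (hz : z ∈ upperHalfSpace n) :
    act γ z ∈ upperHalfSpace n := by
  apply posDef_of_toC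
  rw [toC_imMat_act γ hz]
  have e : ((denom γ z)⁻¹)ᵀ = (((denom γ z)⁻¹).map conj)ᴴ := by ext; simp
  rw [e]
  apply (posDef_toC hz).conjTranspose_mul_mul_same
  apply Matrix.mulVec_injective_of_isUnit
  rw [Matrix.isUnit_iff_isUnit_det, map_conj_inv _ (det_denom_ne_zero γ hz)]
  exact (Matrix.isUnit_nonsing_inv_det _ (isUnit_iff_ne_zero.mpr (det_denom_conj_ne_zero γ hz)))

theorem det_imMat_act (γ : SpR n) {z : SymC n} (hz : z ∈ upperHalfSpace n) :
    (imMat (act γ z)).det = (imMat z).det / ‖(denom γ z).det‖ ^ 2 := by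
  have h := congrArg Matrix.det (toC_imMat_act γ hz)
  rw [Matrix.det_mul, Matrix.det_mul, Matrix.det_transpose, det_map_conj, toC_det, toC_det,
    Matrix.det_nonsing_inv, Ring.inverse_eq_inv', mul_comm _ ((imMat z).det : ℂ), mul_assoc,
    Complex.mul_conj, Complex.normSq_eq_norm_sq, norm_inv] at h
  rw [div_eq_mul_inv, ← inv_pow]
  exact_mod_cast h

theorem blockA_mul (γ δ : SpR n) :
    blockA (γ * δ) = blockA γ * blockA δ + blockB γ * blockC δ ∧
    blockB (γ * δ) = blockA γ * blockB δ + blockB γ * blockD δ ∧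
    blockC (γ * δ) = blockC γ * blockA δ + blockD γ * blockC δ ∧
    blockD (γ * δ) = blockC γ * blockB δ + blockD γ * blockD δ := by
  have h : (γ * δ).1 = fromBlocks (blockA γ * blockA δ + blockB γ * blockC δ)
      (blockA γ * blockB δ + blockB γ * blockD δ) (blockC γ * blockA δ + blockD γ * blockC δ)
      (blockC γ * blockB δ + blockD γ * blockD δ) := by
    rw [← Matrix.fromBlocks_multiply, fromBlocks_block, fromBlocks_block]; rfl
  simp [blockA, blockB, blockC, blockD, h]

theorem denom_mul (γ δ : SpR n) {z : SymC n} (hz : z ∈ upperHalfSpace n) :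
    denom (γ * δ) z = denom γ (act δ z) * denom δ z := by
  obtain ⟨-, -, hC, hD⟩ := blockA_mul γ δ
  rw [denom_eq γ, Matrix.add_mul, Matrix.mul_assoc, toMat_act_mul_denom δ hz, denom_eq, denom_eq,
    num_eq, hC, hD]
  simp only [toC_add, toC_mul]
  noncomm_ring

theorem num_mul (γ δ : SpR n) {z : SymC n} (hz : z ∈ upperHalfSpace n) :
    num (γ * δ) z = num γ (act δ z) * denom δ z := by
  obtain ⟨hA, hB, -, -⟩ := blockA_mul γ δ
  rw [num_eq γ, Matrix.add_mul, Matrix.mul_assoc, toMat_act_mul_denom δ hz, denom_eq, num_eq,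
    num_eq, hA, hB]
  simp only [toC_add, toC_mul]
  noncomm_ring

theorem act_mul (γ δ : SpR n) {z : SymC n} (hz : z ∈ upperHalfSpace n) :
    act (γ * δ) z = act γ (act δ z) := by
  apply toMat_injective
  have hw := act_mem δ hz
  rw [toMat_act _ hz, toMat_act _ hw, num_mul _ _ hz, denom_mul _ _ hz, Matrix.mul_inv_rev,
    ← Matrix.mul_assoc, Matrix.mul_nonsing_inv_cancel_right _ _ (isUnit_det_denom δ hz)]

theorem denom_one (z : SymC n) : denom 1 z = 1 := by
  have hC : blockC (1 : SpR n) = 0 := by simp [blockC, toBlocks₂₁]; rfl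
  have hD : blockD (1 : SpR n) = 1 := by
    ext i j; simp [blockD, toBlocks₂₂, Matrix.one_apply]
  rw [denom_eq, hC, hD]; simp

theorem act_one (z : SymC n) (hz : z ∈ upperHalfSpace n) : act 1 z = z := by
  apply toMat_injective
  have hA : blockA (1 : SpR n) = 1 := by
    ext i j; simp [blockA, toBlocks₁₁, Matrix.one_apply]
  have hB : blockB (1 : SpR n) = 0 := by simp [blockB, toBlocks₁₂]; rfl
  rw [toMat_act _ hz, denom_one, num_eq, hA, hB]; simp

/-- The Siegel upper half-space as a type. -/
abbrev Half (n : ℕ) : Type := upperHalfSpace n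

instance : MulAction (SpR n) (Half n) where
  smul γ z := ⟨act γ z, act_mem γ z.2⟩
  one_smul z := Subtype.ext (act_one _ z.2)
  mul_smul γ δ z := Subtype.ext (act_mul γ δ z.2)

@[simp] theorem coe_smul (γ : SpR n) (z : Half n) : ((γ • z : Half n) : SymC n) = act γ z := rfl

end SiegelMaass
end

/-! ### Geometry of ℍ_n: transitivity, symmetries and an invariant of two points -/

noncomputable section

namespace SiegelMaass

open scoped ComplexOrder MatrixOrder

variable {n : ℕ}

/-! ### Transitivity and the geodesic symmetries -/

/-- The matrix `(A, X A⁻ᵀ; 0, A⁻ᵀ)`, acting by `Z ↦ A Z Aᵀ + X`. -/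
def affineSp (A X : Matrix (Fin n) (Fin n) ℝ) (hA : IsUnit A.det) (hX : Xᵀ = X) : SpR n :=
  ⟨fromBlocks A (X * (Aᵀ)⁻¹) 0 (Aᵀ)⁻¹, by
    have hA' : IsUnit Aᵀ.det := by rwa [Matrix.det_transpose]
    rw [SymplecticGroup.fromBlocks_mem_iff]
    refine ⟨by simp, ?_, ?_⟩
    · rw [Matrix.transpose_mul, Matrix.transpose_nonsing_inv, Matrix.transpose_transpose, hX,
        Matrix.mul_assoc]
    · rw [Matrix.mul_nonsing_inv _ hA']; simp⟩

theorem denom_affineSp (A X : Matrix (Fin n) (Fin n) ℝ) (hA : IsUnit A.det) (hX : Xᵀ = X)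
    (z : SymC n) : denom (affineSp A X hA hX) z = toC (Aᵀ)⁻¹ := by
  rw [denom_eq]; simp [affineSp, blockC, blockD]

theorem toMat_act_affineSp (A X : Matrix (Fin n) (Fin n) ℝ) (hA : IsUnit A.det) (hX : Xᵀ = X)
    {z : SymC n} (hz : z ∈ upperHalfSpace n) :
    toMat (act (affineSp A X hA hX) z) = toC A * toMat z * toC Aᵀ + toC X := by
  have hA' : IsUnit Aᵀ.det := by rwa [Matrix.det_transpose]
  have h := toMat_act_mul_denom (affineSp A X hA hX) hz
  rw [denom_affineSp] at h
  have e : toMat (act (affineSp A X hA hX) z) =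
      num (affineSp A X hA hX) z * toC Aᵀ := by
    rw [← h, Matrix.mul_assoc, ← toC_mul, Matrix.nonsing_inv_mul _ hA', toC_one, Matrix.mul_one]
  rw [e, num_eq, Matrix.add_mul]
  simp only [blockA, blockB, affineSp, toBlocks_fromBlocks₁₁, toBlocks_fromBlocks₁₂]
  rw [← toC_mul, Matrix.mul_assoc X, Matrix.nonsing_inv_mul _ hA', Matrix.mul_one]

/-- The point `i 1_n`. -/
def basePt (n : ℕ) : SymC n := ofMat (Complex.I • 1)

theorem toMat_basePt : toMat (basePt n) = Complex.I • 1 := toMat_ofMat _ (by simp)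

theorem imMat_eq_of_toMat {z : SymC n} {X Y : Matrix (Fin n) (Fin n) ℝ}
    (h : toMat z = toC X + Complex.I • toC Y) : reMat z = X ∧ imMat z = Y := by
  constructor <;> ext j k <;> have := congrFun (congrFun h j) k <;>
    simp only [toMat, Matrix.of_apply, Matrix.add_apply, toC_apply, Matrix.smul_apply,
      smul_eq_mul] at this <;> simp [reMat, imMat, this]

theorem imMat_basePt : imMat (basePt n) = 1 :=
  (imMat_eq_of_toMat (X := 0) (by simp [toMat_basePt])).2

theorem reMat_basePt : reMat (basePt n) = 0 :=
  (imMat_eq_of_toMat (Y := 1) (by simp [toMat_basePt])).1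

theorem basePt_mem : basePt n ∈ upperHalfSpace n := by
  change (imMat _).PosDef
  rw [imMat_basePt]; exact Matrix.PosDef.one

theorem act_affineSp_basePt (A X : Matrix (Fin n) (Fin n) ℝ) (hA : IsUnit A.det) (hX : Xᵀ = X)
    {z : SymC n} (hre : reMat z = X) (him : imMat z = A * Aᵀ) :
    act (affineSp A X hA hX) (basePt n) = z := by
  apply toMat_injective
  rw [toMat_act_affineSp _ _ _ _ basePt_mem, toMat_basePt, toMat_eq z, hre, him, toC_mul]
  simp [add_comm]

theorem exists_eq_mul_transpose {Y : Matrix (Fin n) (Fin n) ℝ} (h : Y.PosDef) :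
    ∃ A : Matrix (Fin n) (Fin n) ℝ, IsUnit A.det ∧ Y = A * Aᵀ := by
  obtain ⟨B, hB, e⟩ := CStarAlgebra.isStrictlyPositive_iff_eq_star_mul_self.mp
    (Matrix.isStrictlyPositive_iff_posDef.mpr h)
  refine ⟨Bᵀ, by rw [Matrix.det_transpose]; exact (Matrix.isUnit_iff_isUnit_det B).mp hB, ?_⟩
  rw [Matrix.transpose_transpose, e, Matrix.star_eq_conjTranspose,
    Matrix.conjTranspose_eq_transpose_of_trivial]

theorem exists_act_basePt {z : SymC n} (hz : z ∈ upperHalfSpace n) :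
    ∃ γ : SpR n, act γ (basePt n) = z := by
  obtain ⟨A, hA, e⟩ := exists_eq_mul_transpose hz
  exact ⟨affineSp A (reMat z) hA (reMat_transpose z), act_affineSp_basePt _ _ _ _ rfl e⟩

/-- Conjugating Z ↦ -Z⁻¹, which fixes i, by an element that moves i to z gives the geodesic symmetry
at z. Since C Z + D = i there, its derivative V ↦ (C Z + D)⁻ᵀ V (C Z + D)⁻¹ at z is -1. -/
theorem exists_symmetry {z : SymC n} (hz : z ∈ upperHalfSpace n) :
    ∃ σ : SpR n, act σ z = z ∧ denom σ z = Complex.I • 1 := by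
  obtain ⟨g, hg⟩ := exists_act_basePt hz
  let J : SpR n := SymplecticGroup.symJ (Fin n) ℝ
  have hJ : J.1 = fromBlocks 0 (-1) 1 0 := rfl
  have hd : denom J (basePt n) = Complex.I • 1 := by
    rw [denom_eq, toMat_basePt]; simp [blockC, blockD, hJ]
  have hn : num J (basePt n) = -1 := by
    rw [num_eq, toMat_basePt]; simp [blockA, blockB, hJ, toC_neg]
  have hJi : act J (basePt n) = basePt n := by
    apply toMat_injective
    have h := toMat_act_mul_denom J (basePt_mem (n := n))
    rw [hd, hn, Matrix.mul_smul, Matrix.mul_one] at h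
    rw [toMat_basePt]
    have := congrArg (fun M => (-Complex.I) • M) h
    simpa [smul_smul] using this
  have hgz : act g⁻¹ z = basePt n := by
    rw [← hg, ← act_mul _ _ basePt_mem, inv_mul_cancel, act_one _ basePt_mem]
  refine ⟨g * J * g⁻¹, ?_, ?_⟩
  · rw [act_mul _ _ hz, hgz, act_mul _ _ basePt_mem, hJi, hg]
  · rw [denom_mul _ _ hz, hgz, denom_mul _ _ basePt_mem, hJi, hd, Matrix.mul_smul, Matrix.mul_one,
      Matrix.smul_mul, ← hgz, ← denom_mul _ _ hz, mul_inv_cancel, denom_one]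

/-! ### The positive definite symplectic matrix attached to a point -/

/-- The real part of `(Z; 1) Y⁻¹ (Z̄, 1)`. -/
def gram (z : SymC n) : Matrix (Fin n ⊕ Fin n) (Fin n ⊕ Fin n) ℝ :=
  fromBlocks (reMat z * (imMat z)⁻¹ * reMat z + imMat z) (reMat z * (imMat z)⁻¹)
    ((imMat z)⁻¹ * reMat z) (imMat z)⁻¹

theorem toC_fromBlocks (A B C D : Matrix (Fin n) (Fin n) ℝ) : toC (fromBlocks A B C D) =
    fromBlocks (toC A) (toC B) (toC C) (toC D) := Matrix.fromBlocks_map _ _ _ _ _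

/-- The matrix `(Z; 1)`. -/
def col (z : SymC n) : Matrix (Fin n ⊕ Fin n) (Fin n) ℂ := fromRows (toMat z) 1

/-- The hermitian matrix on the left transforms simply under the group, while its imaginary part
does not depend on z. So the real part must transform by itself. -/
theorem fromRows_mul_inv_mul {z : SymC n} (hz : z ∈ upperHalfSpace n) :
    col z * toC (imMat z)⁻¹ * (col z)ᴴ =
      toC (gram z) - Complex.I • toC (J (Fin n) ℝ) := by
  have hY : IsUnit (imMat z).det := (det_imMat_pos hz).ne'.isUnit
  have e1 : toC (imMat z) * toC (imMat z)⁻¹ = 1 := by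
    rw [← toC_mul, Matrix.mul_nonsing_inv _ hY, toC_one]
  have e2 : toC (imMat z)⁻¹ * toC (imMat z) = 1 := by
    rw [← toC_mul, Matrix.nonsing_inv_mul _ hY, toC_one]
  have e3 : (toMat z)ᴴ = toC (reMat z) - Complex.I • toC (imMat z) := by
    rw [toMat_eq, Matrix.conjTranspose_add, Matrix.conjTranspose_smul, toC_conjTranspose,
      toC_conjTranspose, ← toC_transpose, ← toC_transpose, reMat_transpose, imMat_transpose]
    simp [sub_eq_add_neg]
  have es (A B C D A' B' C' D' : Matrix (Fin n) (Fin n) ℂ) :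
      fromBlocks A B C D - fromBlocks A' B' C' D' =
        fromBlocks (A - A') (B - B') (C - C') (D - D') := by
    ext (i | i) (j | j) <;> rfl
  rw [col, Matrix.conjTranspose_fromRows_eq_fromCols_conjTranspose, Matrix.fromRows_mul,
    Matrix.fromRows_mul_fromCols, e3, gram, J, toC_fromBlocks,
    toC_fromBlocks, Matrix.fromBlocks_smul, es, toMat_eq]
  simp only [toC_add, toC_mul, toC_neg, toC_one, toC_zero, Matrix.conjTranspose_one]
  generalize toC (reMat z) = X at *
  generalize toC (imMat z) = Y at *
  generalize toC (imMat z)⁻¹ = V at *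
  congr 1
  · rw [Matrix.add_mul, Matrix.smul_mul, e1, Matrix.add_mul, Matrix.mul_sub, Matrix.mul_sub,
      Matrix.mul_smul, Matrix.mul_assoc X V Y, e2]
    simp only [Matrix.smul_mul, Matrix.mul_smul, smul_smul, Matrix.one_mul, Matrix.mul_one,
      Complex.I_mul_I, smul_zero, sub_zero, Matrix.mul_assoc]
    simp
    abel
  · rw [Matrix.mul_one, Matrix.add_mul, Matrix.smul_mul, e1]; simp
  · rw [Matrix.one_mul, Matrix.mul_sub, Matrix.mul_smul, e2]
  · simp

theorem toC_imMat_act' (γ : SpR n) {z : SymC n} (hz : z ∈ upperHalfSpace n) :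
    toC (imMat (act γ z)) = ((denom γ z)⁻¹)ᴴ * toC (imMat z) * (denom γ z)⁻¹ := by
  have h := congrArg Matrix.transpose (toC_imMat_act γ hz)
  rw [← toC_transpose, imMat_transpose, Matrix.transpose_mul, Matrix.transpose_mul,
    ← toC_transpose, imMat_transpose, Matrix.transpose_transpose, ← Matrix.mul_assoc] at h
  exact h

theorem toC_imMat_act_inv (γ : SpR n) {z : SymC n} (hz : z ∈ upperHalfSpace n) :
    toC (imMat (act γ z))⁻¹ = denom γ z * toC (imMat z)⁻¹ * (denom γ z)ᴴ := by
  have hd := isUnit_det_denom γ hz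
  have hd' : IsUnit (denom γ z)ᴴ.det := by
    rw [Matrix.det_conjTranspose]; exact hd.star
  rw [toC_inv _ (det_imMat_pos (act_mem γ hz)).ne', toC_imMat_act' γ hz, Matrix.mul_inv_rev,
    Matrix.mul_inv_rev, toC_inv _ (det_imMat_pos hz).ne', Matrix.conjTranspose_nonsing_inv,
    Matrix.nonsing_inv_nonsing_inv _ hd, Matrix.nonsing_inv_nonsing_inv _ hd', ← Matrix.mul_assoc]

theorem mul_col (γ : SpR n) {z : SymC n} (hz : z ∈ upperHalfSpace n) :
    toC γ.1 * col z = col (act γ z) * denom γ z := by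
  rw [← fromBlocks_block γ, toC_fromBlocks, col, col, Matrix.fromBlocks_mul_fromRows,
    Matrix.fromRows_mul, toMat_act_mul_denom γ hz, Matrix.mul_one, Matrix.mul_one, Matrix.one_mul,
    num_eq, denom_eq]

/-- The factors C Z + D produced by γ(Z; 1) = (γZ; 1)(CZ + D) are absorbed by the transformation of
Y⁻¹. The imaginary part -J is preserved because γ J γᵀ = J, and cancels. -/
theorem gram_act (γ : SpR n) {z : SymC n} (hz : z ∈ upperHalfSpace n) :
    gram (act γ z) = γ.1 * gram z * γ.1ᵀ := by
  have h3 := fromRows_mul_inv_mul (act_mem γ hz)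
  have h4 : col (act γ z) * toC (imMat (act γ z))⁻¹ * (col (act γ z))ᴴ =
      toC γ.1 * (toC (gram z) - Complex.I • toC (J (Fin n) ℝ)) * (toC γ.1)ᴴ := by
    rw [toC_imMat_act_inv γ hz, ← fromRows_mul_inv_mul hz]
    calc _ = (col (act γ z) * denom γ z) * toC (imMat z)⁻¹ *
          (col (act γ z) * denom γ z)ᴴ := by
          rw [Matrix.conjTranspose_mul]; simp only [Matrix.mul_assoc]
      _ = _ := by
          rw [← mul_col γ hz, Matrix.conjTranspose_mul]; simp only [Matrix.mul_assoc]
  have h5 : γ.1 * J (Fin n) ℝ * γ.1ᵀ = J (Fin n) ℝ := SymplecticGroup.mem_iff.mp γ.2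
  rw [h3, Matrix.mul_sub, Matrix.sub_mul, toC_conjTranspose, ← toC_transpose, Matrix.mul_smul,
    Matrix.smul_mul, ← toC_mul, ← toC_mul, ← toC_mul, ← toC_mul, h5] at h4
  exact toC_injective (sub_left_injective h4)

/-! ### An invariant proper function of two points -/

/-- A `Sp_n(ℝ)`-invariant function of two points of `ℍ_n`, proper in each of them. -/
def pairing (z w : SymC n) : ℝ := (gram z * (J (Fin n) ℝ)ᵀ * gram w * J (Fin n) ℝ).trace

theorem pairing_act (γ : SpR n) {z w : SymC n} (hz : z ∈ upperHalfSpace n)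
    (hw : w ∈ upperHalfSpace n) : pairing (act γ z) (act γ w) = pairing z w := by
  have h1 : γ.1ᵀ * J (Fin n) ℝ * γ.1 = J (Fin n) ℝ := SymplecticGroup.mem_iff'.mp γ.2
  have h2 : γ.1ᵀ * (J (Fin n) ℝ)ᵀ * γ.1 = (J (Fin n) ℝ)ᵀ := by
    rw [J_transpose, Matrix.mul_neg, Matrix.neg_mul, h1]
  rw [pairing, gram_act γ hz, gram_act γ hw]
  calc _ = (γ.1 * (gram z * (γ.1ᵀ * (J (Fin n) ℝ)ᵀ * γ.1) * gram w * γ.1ᵀ * J (Fin n) ℝ)).trace := by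
        simp only [Matrix.mul_assoc]
    _ = _ := by
        rw [Matrix.trace_mul_comm, h2, pairing]
        conv_rhs => arg 1; arg 2; rw [← h1]
        simp only [Matrix.mul_assoc]

theorem pairing_comm (z w : SymC n) : pairing z w = pairing w z := by
  rw [pairing, pairing, J_transpose]
  simp only [Matrix.mul_neg, Matrix.neg_mul, Matrix.trace_neg]
  rw [Matrix.mul_assoc, Matrix.trace_mul_comm]
  simp only [Matrix.mul_assoc]

/-- All three terms are nonnegative on ℍ_n, so a bound on the sum bounds each: this is where
properness comes from. -/
theorem pairing_basePt (z : SymC n) : pairing z (basePt n) =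
    (imMat z).trace + (imMat z)⁻¹.trace + (reMat z * (imMat z)⁻¹ * reMat z).trace := by
  have h : gram (basePt n) = 1 := by
    rw [gram, imMat_basePt, reMat_basePt]; simp
  have hJ : (J (Fin n) ℝ)ᵀ * J (Fin n) ℝ = 1 := by rw [J_transpose, Matrix.neg_mul, J_squared]; simp
  rw [pairing, h, Matrix.mul_one, Matrix.mul_assoc, hJ, Matrix.mul_one, gram,
    Matrix.trace, Fintype.sum_sum_type]
  simp [Matrix.trace, Finset.sum_add_distrib]
  ring

theorem dotProduct_le_trace {A : Matrix (Fin n) (Fin n) ℝ} (h : A.PosSemidef) (x : Fin n → ℝ) :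
    x ⬝ᵥ A *ᵥ x ≤ A.trace * (x ⬝ᵥ x) := by
  obtain ⟨B, rfl⟩ := CStarAlgebra.nonneg_iff_eq_star_mul_self.mp
    (Matrix.nonneg_iff_posSemidef.mpr h)
  rw [Matrix.star_eq_conjTranspose] at *
  rw [Matrix.conjTranspose_eq_transpose_of_trivial, ← Matrix.mulVec_mulVec,
    Matrix.dotProduct_mulVec, Matrix.vecMul_transpose]
  simp only [dotProduct, Matrix.mulVec, Matrix.trace, Matrix.diag, Matrix.mul_apply,
    Matrix.transpose_apply]
  rw [Finset.sum_comm, Finset.sum_mul]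
  refine Finset.sum_le_sum fun i _ => ?_
  have := Finset.sum_mul_sq_le_sq_mul_sq Finset.univ (fun j => B i j) x
  simpa [sq] using this

theorem abs_apply_le_trace {A : Matrix (Fin n) (Fin n) ℝ} (h : A.PosSemidef) (i j : Fin n) :
    |A i j| ≤ A.trace := by
  obtain ⟨B, rfl⟩ := CStarAlgebra.nonneg_iff_eq_star_mul_self.mp
    (Matrix.nonneg_iff_posSemidef.mpr h)
  rw [Matrix.star_eq_conjTranspose] at *
  rw [Matrix.conjTranspose_eq_transpose_of_trivial]
  set T := (Bᵀ * B).trace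
  have hd (k : Fin n) : ∑ l, B l k ^ 2 ≤ T := by
    have : T = ∑ k, ∑ l, B l k ^ 2 := by
      simp [T, Matrix.trace, Matrix.mul_apply, sq]
    rw [this]
    exact Finset.single_le_sum (f := fun k => ∑ l, B l k ^ 2)
      (fun k _ => Finset.sum_nonneg fun l _ => sq_nonneg _) (Finset.mem_univ k)
  have hT : 0 ≤ T := (Finset.sum_nonneg fun l _ => sq_nonneg (B l i)).trans (hd i)
  apply abs_le_of_sq_le_sq _ hT
  have := Finset.sum_mul_sq_le_sq_mul_sq Finset.univ (fun l => B l i) (fun l => B l j)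
  simp only [Matrix.mul_apply, Matrix.transpose_apply]
  calc _ ≤ _ := this
    _ ≤ T * T := mul_le_mul (hd i) (hd j) (Finset.sum_nonneg fun l _ => sq_nonneg _) hT
    _ = T ^ 2 := (sq T).symm

/-- Inversion reverses the order A ≤ R. The proof evaluates the form A at A⁻¹x - R⁻¹x, which is
nonnegative, and bounds the term quadratic in R⁻¹x by the hypothesis. -/
theorem dotProduct_inv_ge {A : Matrix (Fin n) (Fin n) ℝ} (h : A.PosDef) {R : ℝ} (hR : 0 < R)
    (hA : ∀ x : Fin n → ℝ, x ⬝ᵥ A *ᵥ x ≤ R * (x ⬝ᵥ x)) (x : Fin n → ℝ) :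
    x ⬝ᵥ x ≤ R * (x ⬝ᵥ A⁻¹ *ᵥ x) := by
  have hu : IsUnit A.det := h.det_pos.ne'.isUnit
  set y := A⁻¹ *ᵥ x with hy
  have hAy : A *ᵥ y = x := by
    rw [hy, Matrix.mulVec_mulVec, Matrix.mul_nonsing_inv _ hu, Matrix.one_mulVec]
  have hAT : Aᵀ = A := by
    have := h.isHermitian; rwa [Matrix.IsHermitian, Matrix.conjTranspose_eq_transpose_of_trivial] at this
  have h1 : 0 ≤ (y - R⁻¹ • x) ⬝ᵥ A *ᵥ (y - R⁻¹ • x) := by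
    simpa using h.posSemidef.dotProduct_mulVec_nonneg (y - R⁻¹ • x)
  have h2 : y ⬝ᵥ A *ᵥ x = x ⬝ᵥ x := by
    rw [Matrix.dotProduct_mulVec, ← Matrix.mulVec_transpose, hAT, hAy]
  rw [Matrix.mulVec_sub, Matrix.mulVec_smul, hAy, sub_dotProduct, dotProduct_sub, dotProduct_sub,
    smul_dotProduct, smul_dotProduct, dotProduct_smul, dotProduct_smul, h2] at h1
  simp only [smul_eq_mul] at h1
  have h3 := mul_le_mul_of_nonneg_left (hA x) (by positivity : 0 ≤ R⁻¹ * R⁻¹)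
  have h4 : R⁻¹ * (x ⬝ᵥ x) ≤ y ⬝ᵥ x := by
    have : R⁻¹ * R⁻¹ * (R * (x ⬝ᵥ x)) = R⁻¹ * (x ⬝ᵥ x) := by field_simp
    nlinarith
  rw [dotProduct_comm y x, inv_mul_le_iff₀ hR] at h4
  exact h4

theorem imMat_inv_posDef {z : SymC n} (hz : z ∈ upperHalfSpace n) : (imMat z)⁻¹.PosDef :=
  Matrix.PosDef.inv hz

/-- A compact subset of `ℍ_n`. -/
theorem isCompact_setOf_le_imMat {R : ℝ} :
    IsCompact {z : SymC n | (∀ x, x ⬝ᵥ x ≤ R * (x ⬝ᵥ imMat z *ᵥ x)) ∧ ‖z‖ ≤ R} := by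
  have e : {z : SymC n | (∀ x, x ⬝ᵥ x ≤ R * (x ⬝ᵥ imMat z *ᵥ x)) ∧ ‖z‖ ≤ R} =
      Metric.closedBall 0 R ∩ ⋂ x, {z | x ⬝ᵥ x ≤ R * (x ⬝ᵥ imMat z *ᵥ x)} := by
    ext z; simp [and_comm]
  rw [e]
  refine (isCompact_closedBall _ _).inter_right (isClosed_iInter fun x => ?_)
  have := continuous_imMat (n := n)
  exact isClosed_le (by fun_prop) (by fun_prop)

theorem mem_upperHalfSpace_of_le {R : ℝ} {z : SymC n} (hR : 0 < R)
    (h : ∀ x, x ⬝ᵥ x ≤ R * (x ⬝ᵥ imMat z *ᵥ x)) : z ∈ upperHalfSpace n := by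
  apply (posDef_iff_sphere (imMat_transpose z)).mpr
  intro x hx
  have hx0 : x ≠ 0 := by rintro rfl; simp at hx
  have h1 : 0 < x ⬝ᵥ x := by
    have := Matrix.PosDef.one (n := Fin n) (R := ℝ) |>.dotProduct_mulVec_pos hx0
    simpa using this
  exact pos_of_mul_pos_right (h1.trans_le (h x)) hR.le

/-- The bound on tr Y⁻¹ keeps Y away from the boundary, and the bound on tr Y bounds Y. The latter
also bounds Y⁻¹ from below, so that tr(X Y⁻¹ X) controls X. -/
theorem exists_compact_of_pairing_basePt_le (R : ℝ) : ∃ C : Set (SymC n), IsCompact C ∧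
    C ⊆ upperHalfSpace n ∧ ∀ z ∈ upperHalfSpace n, pairing z (basePt n) ≤ R → z ∈ C := by
  -- The maximum with 1 makes `T` positive for the inversions. The compact set uses 2T because an
  -- entry of Z is bounded by the sum of the bounds for its real and imaginary parts.
  set T := max R 1
  have hT : 1 ≤ T := le_max_right _ _
  refine ⟨_, isCompact_setOf_le_imMat (R := T + T), fun z hz =>
    mem_upperHalfSpace_of_le (by linarith) hz.1, fun z hz h => ?_⟩
  replace h := h.trans (le_max_left R 1)
  rw [pairing_basePt] at h
  have hY := Matrix.PosDef.posSemidef hz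
  have hV := imMat_inv_posDef hz
  have e : reMat z * (imMat z)⁻¹ * reMat z = (reMat z)ᴴ * (imMat z)⁻¹ * reMat z := by
    rw [Matrix.conjTranspose_eq_transpose_of_trivial, reMat_transpose]
  have hX : (reMat z * (imMat z)⁻¹ * reMat z).PosSemidef := by
    rw [e]; exact hV.posSemidef.conjTranspose_mul_mul_same _
  have t1 := hY.trace_nonneg
  have t2 := hV.posSemidef.trace_nonneg
  have t3 := hX.trace_nonneg
  have hx (x : Fin n → ℝ) : 0 ≤ x ⬝ᵥ x := by
    simpa using dotProduct_star_self_nonneg x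
  have b1 (x : Fin n → ℝ) : x ⬝ᵥ imMat z *ᵥ x ≤ T * (x ⬝ᵥ x) :=
    (dotProduct_le_trace hY x).trans (mul_le_mul_of_nonneg_right (by linarith) (hx x))
  have b2 (x : Fin n → ℝ) : x ⬝ᵥ (imMat z)⁻¹ *ᵥ x ≤ T * (x ⬝ᵥ x) :=
    (dotProduct_le_trace hV.posSemidef x).trans (mul_le_mul_of_nonneg_right (by linarith) (hx x))
  constructor
  · intro x
    have := dotProduct_inv_ge hV (by linarith) b2 x
    rw [Matrix.nonsing_inv_nonsing_inv _ (det_imMat_pos hz).ne'.isUnit] at this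
    have h0 : 0 ≤ x ⬝ᵥ imMat z *ᵥ x := by simpa using hY.dotProduct_mulVec_nonneg x
    nlinarith
  · rw [pi_norm_le_iff_of_nonneg (by linarith)]
    intro p
    induction p with
    | _ j k =>
      have c1 : |imMat z j k| ≤ T := (abs_apply_le_trace hY j k).trans (by linarith)
      have c2 : |reMat z j k| ≤ T := by
        apply abs_le_of_sq_le_sq _ (by linarith)
        have d1 : (reMat z *ᵥ Pi.single k 1) ⬝ᵥ (reMat z *ᵥ Pi.single k 1) ≤ T * T := by
          have d2 := dotProduct_inv_ge hz (by linarith) b1 (reMat z *ᵥ Pi.single k 1)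
          refine d2.trans (mul_le_mul_of_nonneg_left ?_ (by linarith))
          have d3 := dotProduct_le_trace hX (Pi.single k 1)
          rw [← Matrix.mulVec_mulVec, ← Matrix.mulVec_mulVec,
            Matrix.dotProduct_mulVec, ← Matrix.mulVec_transpose, reMat_transpose] at d3
          simp only [single_dotProduct, Pi.single_eq_same, mul_one] at d3
          linarith
        have d4 : reMat z j k ^ 2 ≤ (reMat z *ᵥ Pi.single k 1) ⬝ᵥ (reMat z *ᵥ Pi.single k 1) := by
          simp only [Matrix.mulVec_single_one, dotProduct, Matrix.col_apply, ← sq]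
          exact Finset.single_le_sum (f := fun i => reMat z i k ^ 2)
            (fun i _ => sq_nonneg _) (Finset.mem_univ j)
        nlinarith
      calc ‖z s(j, k)‖ ≤ |(z s(j, k)).re| + |(z s(j, k)).im| := Complex.norm_le_abs_re_add_abs_im _
        _ ≤ T + T := add_le_add c2 c1

theorem continuousOn_act (γ : SpR n) : ContinuousOn (act γ) (upperHalfSpace n) := by
  have h : ContinuousOn (fun z : SymC n => num γ z * (denom γ z)⁻¹) (upperHalfSpace n) := by
    have h1 : Continuous fun z : SymC n => num γ z := by unfold num toMat; fun_prop
    have h2 : Continuous fun z : SymC n => denom γ z := by unfold denom toMat; fun_prop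
    refine h1.continuousOn.mul fun z hz => ContinuousAt.continuousWithinAt ?_
    have h3 : ContinuousAt (Ring.inverse : ℂ → ℂ) ((denom γ z).det) := by
      rw [Ring.inverse_eq_inv']
      exact continuousAt_inv₀ (det_denom_ne_zero γ hz)
    exact ContinuousAt.comp (f := fun z : SymC n => denom γ z)
      (continuousAt_matrix_inv _ h3) h2.continuousAt
  unfold act ofMat
  rw [continuousOn_pi]
  intro p
  exact (continuous_apply_apply p.inf p.sup).comp_continuousOn h

theorem exists_compact_of_pairing_le {w : SymC n} (hw : w ∈ upperHalfSpace n) (R : ℝ) :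
    ∃ C : Set (SymC n), IsCompact C ∧
      C ⊆ upperHalfSpace n ∧ ∀ z ∈ upperHalfSpace n, pairing z w ≤ R → z ∈ C := by
  obtain ⟨C, hC, hCH, hm⟩ := exists_compact_of_pairing_basePt_le (n := n) R
  obtain ⟨γ, rfl⟩ := exists_act_basePt hw
  refine ⟨act γ '' C, hC.image_of_continuousOn ((continuousOn_act γ).mono hCH), ?_, ?_⟩
  · rintro _ ⟨z, hz, rfl⟩; exact act_mem γ (hCH hz)
  · intro z hz h
    refine ⟨act γ⁻¹ z, hm _ (act_mem _ hz) ?_, ?_⟩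
    · rw [← pairing_act γ (act_mem _ hz) basePt_mem, ← act_mul _ _ hz, mul_inv_cancel,
        act_one _ hz]
      exact h
    · rw [← act_mul _ _ hz, mul_inv_cancel, act_one _ hz]

end SiegelMaass
end

/-! ### The Jacobian of the action and the invariant measure -/

noncomputable section

namespace SiegelMaass

variable {n : ℕ}

/-! ### The determinant of `V ↦ Uᵀ V U` on symmetric matrices -/

section symCongr
variable {K : Type*}

/-- The symmetric matrix with given independent entries. -/
def symMat (v : Sym2 (Fin n) → K) : Matrix (Fin n) (Fin n) K := Matrix.of fun j k => v s(j, k)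

theorem symMat_transpose (v : Sym2 (Fin n) → K) : (symMat v)ᵀ = symMat v := by
  ext j k; simp [symMat, Sym2.eq_swap]

theorem symMat_injective : Function.Injective (symMat : (Sym2 (Fin n) → K) → _) := by
  intro v w h
  funext p
  induction p with
  | _ a b => exact congrFun (congrFun h a) b

variable [Field K]

/-- `V ↦ Uᵀ V U` on symmetric matrices. -/
def symCongr (U : Matrix (Fin n) (Fin n) K) : (Sym2 (Fin n) → K) →ₗ[K] (Sym2 (Fin n) → K) where
  toFun v p := (Uᵀ * symMat v * U) p.inf p.sup
  map_add' v w := by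
    have : symMat (v + w) = symMat v + symMat w := rfl
    funext p
    simp [this, Matrix.mul_add, Matrix.add_mul]
  map_smul' c v := by
    have : symMat (c • v) = c • symMat v := rfl
    funext p
    simp [this]

theorem symMat_symCongr (U : Matrix (Fin n) (Fin n) K) (v : Sym2 (Fin n) → K) :
    symMat (symCongr U v) = Uᵀ * symMat v * U := by
  have hs : (Uᵀ * symMat v * U)ᵀ = Uᵀ * symMat v * U := by
    simp only [Matrix.transpose_mul, symMat_transpose, Matrix.transpose_transpose, Matrix.mul_assoc]
  ext a b
  rcases le_total a b with h | h
  · simp [symMat, symCongr, h]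
  · simpa [symMat, symCongr, h] using congrFun (congrFun hs a) b

theorem symCongr_mul (U V : Matrix (Fin n) (Fin n) K) :
    symCongr (U * V) = symCongr V * symCongr U := by
  refine LinearMap.ext fun v => symMat_injective ?_
  rw [Module.End.mul_apply, symMat_symCongr, symMat_symCongr, symMat_symCongr,
    Matrix.transpose_mul]
  simp only [Matrix.mul_assoc]

theorem symCongr_one : symCongr (1 : Matrix (Fin n) (Fin n) K) = 1 := by
  refine LinearMap.ext fun v => symMat_injective ?_
  rw [symMat_symCongr]; simp

theorem card_filter_mem_sym2 (j : Fin n) :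
    (Finset.univ.filter fun p : Sym2 (Fin n) => j ∈ p).card = n := by
  have : (Finset.univ.filter fun p : Sym2 (Fin n) => j ∈ p) =
      Finset.univ.image fun k : Fin n => s(j, k) := by
    ext p
    simp only [Finset.mem_filter, Finset.mem_univ, true_and, Finset.mem_image]
    exact ⟨fun h => ⟨_, Sym2.other_spec h⟩, fun ⟨k, hk⟩ => hk ▸ Sym2.mem_mk_left _ _⟩
  rw [this, Finset.card_image_of_injective]
  · simp
  · intro a b h
    rcases Sym2.eq_iff.mp h with h | h
    · exact h.2
    · rw [h.2, ← h.1]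

/-- The map is diagonal with eigenvalues D_a D_b over unordered pairs. The index j belongs to n
pairs and counts twice in the pair {j, j}, hence the exponent n + 1. -/
theorem det_symCongr_diagonal (D : Fin n → K) :
    LinearMap.det (symCongr (Matrix.diagonal D)) = (∏ j, D j) ^ (n + 1) := by
  have hc (p : Sym2 (Fin n)) : D p.inf * D p.sup =
      ∏ j, D j ^ ((if j ∈ p then 1 else 0) + if p = s(j, j) then 1 else 0) := by
    induction p with
    | _ a b =>
      have e : D (s(a, b)).inf * D (s(a, b)).sup = D a * D b := by
        rcases le_total a b with h | h <;> simp [h, mul_comm]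
      rw [e]
      rcases eq_or_ne a b with rfl | h
      · rw [Finset.prod_eq_single a]
        · simp [sq]
        · intro j _ hj; simp [hj, hj.symm]
        · simp
      · have : ∀ j, (if j ∈ s(a, b) then 1 else 0) + (if s(a, b) = s(j, j) then 1 else 0)
            = (if j = a then 1 else 0) + if j = b then 1 else 0 := by
          intro j
          by_cases h1 : j = a
          · subst h1; simp [h, h.symm]
          · by_cases h2 : j = b
            · subst h2; simp [h1, h]
            · simp [h1, h2, Ne.symm h1]
        simp only [this, pow_add, Finset.prod_mul_distrib, pow_ite, pow_one, pow_zero]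
        simp
  have hm : LinearMap.toMatrix' (symCongr (Matrix.diagonal D)) =
      Matrix.diagonal fun p : Sym2 (Fin n) => D p.inf * D p.sup := by
    apply (Matrix.toLin' ).injective
    rw [Matrix.toLin'_toMatrix']
    refine LinearMap.ext fun v => funext fun p => ?_
    rw [Matrix.toLin'_apply, Matrix.mulVec_diagonal]
    have : s(p.inf, p.sup) = p := by
      induction p with
      | _ a b => rcases le_total a b with h | h <;> simp [h, Sym2.eq_swap]
    simp only [symCongr, LinearMap.coe_mk, AddHom.coe_mk, Matrix.diagonal_transpose,
      Matrix.mul_diagonal, Matrix.diagonal_mul, symMat, Matrix.of_apply, this]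
    ring
  rw [← LinearMap.det_toMatrix', hm, Matrix.det_diagonal]
  simp only [hc]
  rw [Finset.prod_comm, ← Finset.prod_pow]
  refine Finset.prod_congr rfl fun j _ => ?_
  rw [Finset.prod_pow_eq_pow_sum, Finset.sum_add_distrib, Finset.sum_boole, card_filter_mem_sym2]
  simp

/-- A transvection T is conjugate to T² by a diagonal matrix, so its nonzero image d under a
multiplicative map satisfies d = d². -/
theorem det_symCongr_transvection [CharZero K] (t : Matrix.TransvectionStruct (Fin n) K) :
    LinearMap.det (symCongr t.toMatrix) = 1 := by
  obtain ⟨i, j, hij, c⟩ := t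
  set T : Matrix (Fin n) (Fin n) K := Matrix.transvection i j c
  -- Scaling the coordinate i by 2 doubles the parameter of the transvection; its determinant is
  -- nonzero in characteristic zero.
  set D : Fin n → K := fun k => if k = i then 2 else 1
  have h1 : Matrix.diagonal D * T = T * T * Matrix.diagonal D := by
    have hT : T * T = Matrix.transvection i j (c + c) :=
      Matrix.transvection_mul_transvection_same i j hij c c
    rw [hT]
    simp only [T, Matrix.transvection, Matrix.mul_add, Matrix.add_mul, Matrix.mul_one,
      Matrix.one_mul]
    congr 1
    ext a b
    simp only [Matrix.diagonal_mul, Matrix.mul_diagonal, Matrix.single_apply, D]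
    by_cases ha : i = a
    · by_cases hb : j = b
      · subst ha hb; simp [hij.symm]; ring
      · simp [hb]
    · simp [ha]
  have h2 := congrArg (fun M => LinearMap.det (symCongr M)) h1
  simp only [symCongr_mul, map_mul] at h2
  have hd : LinearMap.det (symCongr (Matrix.diagonal D)) ≠ 0 := by
    rw [det_symCongr_diagonal]
    refine pow_ne_zero _ (Finset.prod_ne_zero_iff.mpr fun k _ => ?_)
    simp only [D]; split_ifs <;> simp
  have ht : LinearMap.det (symCongr T) ≠ 0 := by
    have : T * Matrix.transvection i j (-c) = 1 := by
      simp [T, Matrix.transvection_mul_transvection_same i j hij]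
    have h3 := congrArg (fun M => LinearMap.det (symCongr M)) this
    simp only [symCongr_mul, map_mul, symCongr_one, map_one] at h3
    exact right_ne_zero_of_mul_eq_one h3
  change LinearMap.det (symCongr T) = 1
  apply mul_left_cancel₀ ht
  apply mul_left_cancel₀ hd
  linear_combination -h2

theorem det_symCongr [CharZero K] (U : Matrix (Fin n) (Fin n) K) :
    LinearMap.det (symCongr U) = U.det ^ (n + 1) := by
  induction U using Matrix.diagonal_transvection_induction with
  | hdiag D _ => rw [det_symCongr_diagonal, Matrix.det_diagonal]
  | htransvec t => rw [det_symCongr_transvection, t.det]; simp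
  | hmul A B hA hB => rw [symCongr_mul, map_mul, hA, hB, Matrix.det_mul]; ring

end symCongr

/-! ### The derivative of the symplectic action -/

theorem toMat_symCongr (U : Matrix (Fin n) (Fin n) ℂ) (v : SymC n) :
    toMat (symCongr U v) = Uᵀ * toMat v * U := symMat_symCongr U v

/-- `V ↦ P V Q` on `SymC n`, keeping only the upper triangular entries. -/
def sandwich (Q : Matrix (Fin n) (Fin n) ℂ) :
    Matrix (Fin n) (Fin n) ℂ →ₗ[ℂ] (SymC n →L[ℂ] SymC n) where
  toFun P := LinearMap.toContinuousLinearMap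
    { toFun := fun v => ofMat (P * toMat v * Q)
      map_add' := fun v w => by
        funext p; simp [ofMat, toMat_add, Matrix.mul_add, Matrix.add_mul]
      map_smul' := fun c v => by
        funext p; simp [ofMat, toMat_smul] }
  map_add' P P' := by
    ext v p; simp [ofMat, Matrix.add_mul]
  map_smul' c P := by
    ext v p; simp [ofMat]

theorem sandwich_apply (P Q : Matrix (Fin n) (Fin n) ℂ) (v : SymC n) :
    sandwich Q P v = ofMat (P * toMat v * Q) := rfl

theorem continuousAt_denom_inv (γ : SpR n) {z : SymC n} (hz : z ∈ upperHalfSpace n) :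
    ContinuousAt (fun w => (denom γ w)⁻¹) z := by
  have h2 : Continuous fun z : SymC n => denom γ z := by unfold denom toMat; fun_prop
  have h3 : ContinuousAt (Ring.inverse : ℂ → ℂ) ((denom γ z).det) := by
    rw [Ring.inverse_eq_inv']
    exact continuousAt_inv₀ (det_denom_ne_zero γ hz)
  exact ContinuousAt.comp (f := fun z : SymC n => denom γ z)
    (continuousAt_matrix_inv _ h3) h2.continuousAt

/-- An exact difference formula whose linear factor is continuous in w avoids differentiating the
matrix inverse: the remainder is (L_w - L_z)(w - z). -/
theorem hasFDerivAt_of_slope {𝕜 E F : Type*} [NontriviallyNormedField 𝕜] [NormedAddCommGroup E]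
    [NormedSpace 𝕜 E] [NormedAddCommGroup F] [NormedSpace 𝕜 F] {g : E → F} {L : E → E →L[𝕜] F}
    {z : E} (hL : ContinuousAt L z) (h : ∀ᶠ w in nhds z, g w - g z = L w (w - z)) :
    HasFDerivAt g (L z) z := by
  rw [hasFDerivAt_iff_isLittleO]
  have h1 : (fun w => L w - L z) =o[nhds z] fun _ => (1 : ℝ) := by
    rw [Asymptotics.isLittleO_one_iff]
    simpa using hL.tendsto.sub_const (L z)
  have h2 : (fun w => (L w - L z) (w - z)) =o[nhds z] fun w => w - z := by
    have h3 : (fun w => (L w - L z) (w - z)) =O[nhds z] fun w => ‖L w - L z‖ * ‖w - z‖ :=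
      Asymptotics.IsBigO.of_bound 1 (.of_forall fun w => by
        simpa using (L w - L z).le_opNorm (w - z))
    refine h3.trans_isLittleO ?_
    have := h1.norm_left.mul_isBigO (Asymptotics.isBigO_refl (fun w => ‖w - z‖) (nhds z))
    simpa using this
  refine h2.congr' ?_ .rfl
  filter_upwards [h] with w hw
  rw [hw]; simp

/-- The derivative of the action is `V ↦ (C Z + D)⁻ᵀ V (C Z + D)⁻¹`. -/
theorem hasFDerivAt_act (γ : SpR n) {z : SymC n} (hz : z ∈ upperHalfSpace n) :
    HasFDerivAt (act γ) (LinearMap.toContinuousLinearMap (symCongr (denom γ z)⁻¹) :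
      SymC n →L[ℂ] SymC n) z := by
  have e : (LinearMap.toContinuousLinearMap (symCongr (denom γ z)⁻¹) : SymC n →L[ℂ] SymC n)
      = sandwich (denom γ z)⁻¹ ((denom γ z)⁻¹)ᵀ := by
    ext v p
    rw [sandwich_apply, ← toMat_symCongr, ofMat_toMat]; rfl
  rw [e]
  refine hasFDerivAt_of_slope (L := fun w => sandwich (denom γ z)⁻¹ ((denom γ w)⁻¹)ᵀ) ?_ ?_
  · have h1 : Continuous (sandwich (denom γ z)⁻¹) := LinearMap.continuous_of_finiteDimensional _
    have h2 := continuousAt_denom_inv γ hz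
    exact h1.continuousAt.comp
      (continuous_id.matrix_transpose.continuousAt.comp h2)
  · filter_upwards [(isOpen_upperHalfSpace n).mem_nhds hz] with w hw
    rw [sandwich_apply, toMat_sub, ← toMat_act_sub_act γ hw hz, ← toMat_sub, ofMat_toMat]

theorem hasFDerivAt_act_real (γ : SpR n) {z : SymC n} (hz : z ∈ upperHalfSpace n) :
    HasFDerivAt (act γ) ((LinearMap.toContinuousLinearMap (symCongr (denom γ z)⁻¹) :
      SymC n →L[ℂ] SymC n).restrictScalars ℝ) z :=
  (hasFDerivAt_act γ hz).restrictScalars ℝ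

/-- The real Jacobian is the squared modulus of the complex one, and the complex one is det(CZ +
D)^(-(n+1)) by `det_symCongr`. -/
theorem abs_det_deriv_act (γ : SpR n) (z : SymC n) :
    |((LinearMap.toContinuousLinearMap (symCongr (denom γ z)⁻¹) :
      SymC n →L[ℂ] SymC n).restrictScalars ℝ).det| =
      ((‖(denom γ z).det‖ ^ 2) ^ (n + 1))⁻¹ := by
  have h : ((LinearMap.toContinuousLinearMap (symCongr (denom γ z)⁻¹) :
      SymC n →L[ℂ] SymC n).restrictScalars ℝ).det =
      LinearMap.det ((symCongr (denom γ z)⁻¹).restrictScalars ℝ) := rfl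
  rw [h, LinearMap.det_restrictScalars, Algebra.norm_complex_apply, det_symCongr,
    Complex.normSq_eq_norm_sq, abs_of_nonneg (sq_nonneg _), Matrix.det_nonsing_inv,
    Ring.inverse_eq_inv', norm_pow, norm_inv, inv_pow, inv_pow, ← pow_mul, ← pow_mul, mul_comm]

theorem injOn_act (γ : SpR n) : Set.InjOn (act γ) (upperHalfSpace n) := by
  intro z hz w hw h
  have := congrArg (act γ⁻¹) h
  rwa [← act_mul _ _ hz, ← act_mul _ _ hw, inv_mul_cancel, act_one _ hz, act_one _ hw] at this

theorem act_image_preimage (γ : SpR n) (s : Set (SymC n)) :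
    act γ '' (act γ ⁻¹' s ∩ upperHalfSpace n) = s ∩ upperHalfSpace n := by
  ext w
  constructor
  · rintro ⟨z, ⟨hz, hzH⟩, rfl⟩; exact ⟨hz, act_mem γ hzH⟩
  · rintro ⟨hs, hw⟩
    have e : act γ (act γ⁻¹ w) = w := by rw [← act_mul _ _ hw, mul_inv_cancel, act_one _ hw]
    exact ⟨act γ⁻¹ w, ⟨by rwa [Set.mem_preimage, e], act_mem _ hw⟩, e⟩

/-! ### The invariant measure -/

theorem measurable_det_imMat : Measurable fun z : SymC n => (imMat z).det := by
  have := continuous_imMat (n := n)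
  have h : Continuous fun z : SymC n => (imMat z).det := by fun_prop
  exact h.measurable

theorem measurableSet_upperHalfSpace : MeasurableSet (upperHalfSpace n) :=
  (isOpen_upperHalfSpace n).measurableSet

theorem lintegral_siegelMeasure (f : SymC n → ENNReal) :
    ∫⁻ z, f z ∂siegelMeasure n =
      ∫⁻ z in upperHalfSpace n, ENNReal.ofReal (((imMat z).det ^ (n + 1))⁻¹) * f z := by
  rw [siegelMeasure, lintegral_withDensity_eq_lintegral_mul_non_measurable]
  · rfl
  · exact ((measurable_det_imMat.pow_const _).inv).ennreal_ofReal
  · exact .of_forall fun z => ENNReal.ofReal_lt_top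

/-- The measure on the half-space as a type. -/
def halfMeasure (n : ℕ) : Measure (Half n) := (siegelMeasure n).comap Subtype.val

theorem siegelMeasure_restrict : (siegelMeasure n).restrict (upperHalfSpace n) = siegelMeasure n := by
  rw [siegelMeasure, restrict_withDensity measurableSet_upperHalfSpace,
    Measure.restrict_restrict measurableSet_upperHalfSpace, Set.inter_self]

theorem map_halfMeasure : (halfMeasure n).map Subtype.val = siegelMeasure n := by
  rw [halfMeasure, (MeasurableEmbedding.subtype_coe measurableSet_upperHalfSpace).map_comap,
    Subtype.range_coe, siegelMeasure_restrict]

theorem lintegral_halfMeasure (f : SymC n → ENNReal) :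
    ∫⁻ z, f z ∂halfMeasure n = ∫⁻ z, f z ∂siegelMeasure n := by
  rw [← map_halfMeasure,
    (MeasurableEmbedding.subtype_coe measurableSet_upperHalfSpace).lintegral_map]

theorem continuous_smul_half (γ : SpR n) : Continuous fun z : Half n => γ • z :=
  Continuous.subtype_mk ((continuousOn_act γ).comp_continuous continuous_subtype_val
    fun z => z.2) _

/-- Change of variables: the Jacobian |det(CZ + D)|^(-2(n+1)) is exactly the factor by which
det(Y)^(n+1) changes under γ. -/
theorem siegelMeasure_preimage_act (γ : SpR n) {s : Set (SymC n)} (hs : MeasurableSet s) :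
    siegelMeasure n (act γ ⁻¹' s ∩ upperHalfSpace n) = siegelMeasure n (s ∩ upperHalfSpace n) := by
  have hH := measurableSet_upperHalfSpace (n := n)
  have hm : MeasurableSet (act γ ⁻¹' s ∩ upperHalfSpace n) := by
    have := (continuous_smul_half γ).measurable (measurable_subtype_coe hs)
    have h2 := (MeasurableEmbedding.subtype_coe hH).measurableSet_image.mpr this
    convert h2 using 1
    ext z; constructor
    · rintro ⟨h, hz⟩; exact ⟨⟨z, hz⟩, h, rfl⟩
    · rintro ⟨⟨z, hz⟩, h, rfl⟩; exact ⟨h, hz⟩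
  have key (t : Set (SymC n)) (ht : MeasurableSet t) : siegelMeasure n (t ∩ upperHalfSpace n) =
      ∫⁻ z in t ∩ upperHalfSpace n, ENNReal.ofReal (((imMat z).det ^ (n + 1))⁻¹) := by
    rw [siegelMeasure, withDensity_apply _ (ht.inter hH),
      Measure.restrict_restrict (ht.inter hH), Set.inter_assoc, Set.inter_self]
  rw [key s hs]
  have h1 := key _ hm
  rw [Set.inter_assoc, Set.inter_self] at h1
  rw [h1, ← act_image_preimage γ s, lintegral_image_eq_lintegral_abs_det_fderiv_mul volume hm
    (fun z hz => (hasFDerivAt_act_real γ hz.2).hasFDerivWithinAt)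
    ((injOn_act γ).mono Set.inter_subset_right)]
  refine setLIntegral_congr_fun hm fun z hz => ?_
  have hd : 0 < ‖(denom γ z).det‖ := norm_pos_iff.mpr (det_denom_ne_zero γ hz.2)
  have hy := det_imMat_pos hz.2
  rw [abs_det_deriv_act, ← ENNReal.ofReal_mul (by positivity), det_imMat_act γ hz.2]
  congr 1
  rw [div_pow, inv_div]
  field_simp

theorem measurePreserving_smul (γ : SpR n) :
    MeasurePreserving (fun z : Half n => γ • z) (halfMeasure n) (halfMeasure n) := by
  have hH := measurableSet_upperHalfSpace (n := n)
  have he := MeasurableEmbedding.subtype_coe hH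
  refine ⟨(continuous_smul_half γ).measurable, ?_⟩
  ext s hs
  rw [Measure.map_apply (continuous_smul_half γ).measurable hs, halfMeasure, he.comap_apply,
    he.comap_apply]
  have h2 := siegelMeasure_preimage_act γ (he.measurableSet_image.mpr hs)
  have e1 : Subtype.val '' s ∩ upperHalfSpace n = Subtype.val '' s :=
    Set.inter_eq_left.mpr (by rintro _ ⟨z, -, rfl⟩; exact z.2)
  rw [e1] at h2
  rw [← h2]
  congr 1
  ext z; constructor
  · rintro ⟨z, hz, rfl⟩; exact ⟨⟨_, hz, rfl⟩, z.2⟩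
  · rintro ⟨⟨w, hw, e⟩, hz⟩
    have : w = γ • (⟨z, hz⟩ : Half n) := Subtype.ext e
    exact ⟨⟨z, hz⟩, by rwa [Set.mem_preimage, ← this], rfl⟩

end SiegelMaass
end

/-! ### The Laplacian as a divergence and the gradient form -/

noncomputable section

namespace SiegelMaass

variable {n : ℕ}

/-! ### Calculus with `∂/∂Z` and `∂/∂Z̄` -/

/-- `(v_{j,k} + s i v_{j,k})/2`-derivative: `s = -i` gives `∂/∂Z`, `s = i` gives `∂/∂Z̄`. -/
def wirt (s : ℂ) (L : SymC n →L[ℝ] ℂ) (v : SymC n) : ℂ := 1 / 2 * (L v + s * L (Complex.I • v))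

/-- The symmetric matrix `(e_j e_kᵀ + e_k e_jᵀ) / 2`. -/
def eDir (j k : Fin n) : SymC n := Pi.single s(j, k) (((1 + if j = k then 1 else 0) / 2 : ℝ) : ℂ)

/-- The entries of `eDir`. -/
def eps (j k a b : Fin n) : ℂ :=
  1 / 2 * ((if j = a then 1 else 0) * (if k = b then 1 else 0) +
    (if j = b then 1 else 0) * (if k = a then 1 else 0))

theorem toMat_eDir (j k a b : Fin n) : toMat (eDir j k) a b = eps j k a b := by
  simp only [toMat, eDir, eps, Matrix.of_apply, Pi.single_apply, Sym2.eq_iff]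
  by_cases h : j = k
  · subst h
    by_cases h1 : j = a <;> by_cases h2 : j = b <;> simp [h1, h2, eq_comm] <;> grind
  · simp only [if_neg h]
    by_cases h1 : j = a <;> by_cases h2 : k = b <;> by_cases h3 : j = b <;> by_cases h4 : k = a <;>
      simp [h1, h2, h3, h4, eq_comm] <;> grind

theorem eDir_comm (j k : Fin n) : eDir j k = eDir k j := by
  unfold eDir; rw [Sym2.eq_swap]; simp [eq_comm]

theorem dZ_eq (j k : Fin n) (g : SymC n → ℂ) (z : SymC n) :
    dZ j k g z = wirt (-Complex.I) (fderiv ℝ g z) (eDir j k) := by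
  set c : ℝ := (1 + if j = k then 1 else 0) / 2
  have h1 : eDir j k = c • Pi.single s(j, k) (1 : ℂ) := by
    unfold eDir; rw [← Pi.single_smul]; simp [c]
  have h2 : Complex.I • eDir j k = c • Pi.single s(j, k) Complex.I := by
    unfold eDir; rw [← Pi.single_smul, ← Pi.single_smul]; simp [c, mul_comm]
  rw [dZ, dX, dY, wirt, h2, h1, map_smul, map_smul, Complex.real_smul, Complex.real_smul]
  simp only [c]; split_ifs <;> push_cast <;> ring

theorem dZbar_eq (j k : Fin n) (g : SymC n → ℂ) (z : SymC n) :
    dZbar j k g z = wirt Complex.I (fderiv ℝ g z) (eDir j k) := by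
  set c : ℝ := (1 + if j = k then 1 else 0) / 2
  have h1 : eDir j k = c • Pi.single s(j, k) (1 : ℂ) := by
    unfold eDir; rw [← Pi.single_smul]; simp [c]
  have h2 : Complex.I • eDir j k = c • Pi.single s(j, k) Complex.I := by
    unfold eDir; rw [← Pi.single_smul, ← Pi.single_smul]; simp [c, mul_comm]
  rw [dZbar, dX, dY, wirt, h2, h1, map_smul, map_smul, Complex.real_smul, Complex.real_smul]
  simp only [c]; split_ifs <;> push_cast <;> ring

/-- The common form of `∂/∂Z` and `∂/∂Z̄`. -/
def dW (s : ℂ) (j k : Fin n) (g : SymC n → ℂ) (z : SymC n) : ℂ :=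
  wirt s (fderiv ℝ g z) (eDir j k)

theorem dZ_eq_dW : (dZ : Fin n → Fin n → _) = dW (-Complex.I) := by
  funext j k g z; exact dZ_eq j k g z

theorem dZbar_eq_dW : (dZbar : Fin n → Fin n → _) = dW Complex.I := by
  funext j k g z; exact dZbar_eq j k g z

section dW
variable {s : ℂ} {j k : Fin n} {f g : SymC n → ℂ} {z : SymC n}

theorem dW_comm (s : ℂ) (j k : Fin n) (g : SymC n → ℂ) (z : SymC n) :
    dW s j k g z = dW s k j g z := by rw [dW, dW, eDir_comm]

theorem dW_congr (h : f =ᶠ[nhds z] g) : dW s j k f z = dW s j k g z := by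
  rw [dW, dW, h.fderiv_eq]

theorem dW_add (hf : DifferentiableAt ℝ f z) (hg : DifferentiableAt ℝ g z) :
    dW s j k (fun w => f w + g w) z = dW s j k f z + dW s j k g z := by
  simp only [dW, wirt, fderiv_fun_add hf hg, _root_.add_apply]; ring

theorem dW_sub (hf : DifferentiableAt ℝ f z) (hg : DifferentiableAt ℝ g z) :
    dW s j k (fun w => f w - g w) z = dW s j k f z - dW s j k g z := by
  simp only [dW, wirt, fderiv_fun_sub hf hg, _root_.sub_apply]; ring

theorem dW_mul (hf : DifferentiableAt ℝ f z) (hg : DifferentiableAt ℝ g z) :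
    dW s j k (fun w => f w * g w) z = dW s j k f z * g z + f z * dW s j k g z := by
  simp only [dW, wirt, fderiv_fun_mul hf hg, _root_.add_apply,
    _root_.smul_apply, smul_eq_mul]; ring

theorem dW_const (c : ℂ) : dW s j k (fun _ => c) z = 0 := by simp [dW, wirt]

theorem dW_const_mul (c : ℂ) (hf : DifferentiableAt ℝ f z) :
    dW s j k (fun w => c * f w) z = c * dW s j k f z := by
  rw [dW_mul (differentiableAt_const c) hf, dW_const]; ring

theorem dW_sum {ι : Type*} (t : Finset ι) {F : ι → SymC n → ℂ}
    (h : ∀ i ∈ t, DifferentiableAt ℝ (F i) z) :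
    dW s j k (fun w => ∑ i ∈ t, F i w) z = ∑ i ∈ t, dW s j k (F i) z := by
  simp only [dW, wirt, fderiv_fun_sum h, _root_.sum_apply, Finset.mul_sum,
    Finset.sum_add_distrib, mul_add]

end dW

theorem subConj_apply (z : SymC n) (a b : Fin n) :
    subConj z a b = z s(a, b) - conj (z s(a, b)) := by
  simp [subConj, toMat]

theorem contDiff_subConj (a b : Fin n) : ContDiff ℝ ⊤ fun w : SymC n => subConj w a b := by
  simp only [subConj_apply]
  have h : ContDiff ℝ ⊤ fun w : SymC n => w s(a, b) := by fun_prop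
  exact h.sub (Complex.conjCLE.contDiff.comp h)

theorem differentiableAt_subConj (a b : Fin n) (z : SymC n) :
    DifferentiableAt ℝ (fun w => subConj w a b) z :=
  (contDiff_subConj a b).contDiffAt.differentiableAt (by simp)

theorem fderiv_subConj (a b : Fin n) (z v : SymC n) :
    fderiv ℝ (fun w => subConj w a b) z v = toMat v a b - conj (toMat v a b) := by
  have h : HasFDerivAt (fun w : SymC n => subConj w a b)
      ((ContinuousLinearMap.proj (R := ℝ) (φ := fun _ : Sym2 (Fin n) => ℂ) s(a, b)) -
        (Complex.conjCLE : ℂ →L[ℝ] ℂ).comp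
          (ContinuousLinearMap.proj (R := ℝ) (φ := fun _ : Sym2 (Fin n) => ℂ) s(a, b))) z := by
    simp only [subConj_apply]
    exact ((ContinuousLinearMap.proj (R := ℝ) (φ := fun _ : Sym2 (Fin n) => ℂ)
      s(a, b)).hasFDerivAt).sub (((Complex.conjCLE : ℂ →L[ℝ] ℂ).comp
        (ContinuousLinearMap.proj (R := ℝ) (φ := fun _ : Sym2 (Fin n) => ℂ) s(a, b))).hasFDerivAt)
  rw [h.fderiv]; simp [toMat]

theorem conj_eps (j k a b : Fin n) : conj (eps j k a b) = eps j k a b := by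
  unfold eps; split_ifs <;> simp [Complex.conj_ofNat]

theorem dW_subConj (s : ℂ) (j k a b : Fin n) (z : SymC n) :
    dW s j k (fun w => subConj w a b) z = s * Complex.I * eps j k a b := by
  simp only [dW, wirt, fderiv_subConj, toMat_smul, Matrix.smul_apply, toMat_eDir, smul_eq_mul,
    map_mul, conj_eps, Complex.conj_I]
  ring

theorem dZ_subConj (j k a b : Fin n) (z : SymC n) :
    dZ j k (fun w => subConj w a b) z = eps j k a b := by
  rw [dZ_eq_dW, dW_subConj]; simp

theorem dZbar_subConj (j k a b : Fin n) (z : SymC n) :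
    dZbar j k (fun w => subConj w a b) z = -eps j k a b := by
  rw [dZbar_eq_dW, dW_subConj]; simp

/-- Every shift by (n+1)/2 in the Laplacian and in the divergence formula comes from this
contraction, produced when a derivative falls on a factor Z - Z̄. -/
theorem sum_eps (p l : Fin n) :
    ∑ j, eps p j j l = ((n : ℂ) + 1) / 2 * if p = l then 1 else 0 := by
  simp only [eps, ← Finset.mul_sum, Finset.sum_add_distrib]
  by_cases h : p = l
  · subst h; simp; ring
  · simp [h]

/-! ### Powers of `det Y` -/

theorem contDiff_det_imMat : ContDiff ℝ ⊤ fun z : SymC n => (imMat z).det := by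
  simp only [Matrix.det_apply, imMat, Matrix.of_apply]
  refine ContDiff.sum fun σ _ => ContDiff.const_smul _ (contDiff_prod fun i _ => ?_)
  exact Complex.imCLM.contDiff.comp (by fun_prop)

theorem imMat_add_smul (z v : SymC n) (t : ℝ) : imMat (z + t • v) = imMat z + t • imMat v := by
  ext a b; simp [imMat]

theorem hasDerivAt_det_one_add (M : Matrix (Fin n) (Fin n) ℝ) :
    HasDerivAt (fun t : ℝ => (1 + t • M).det) M.trace 0 := by
  have h := (Matrix.det (1 + (Polynomial.X : Polynomial ℝ) • M.map Polynomial.C)).hasDerivAt 0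
  rw [Matrix.derivative_det_one_add_X_smul] at h
  have e (t : ℝ) : (1 + t • M).det =
      Polynomial.eval t (1 + (Polynomial.X : Polynomial ℝ) • M.map Polynomial.C).det := by
    rw [← Polynomial.coe_evalRingHom, RingHom.map_det]
    congr 1
    ext i j
    by_cases h : i = j <;> simp [h] <;> ring
  simpa only [e] using h

theorem fderiv_det_imMat {z : SymC n} (hz : z ∈ upperHalfSpace n) (v : SymC n) :
    fderiv ℝ (fun w : SymC n => (imMat w).det) z v =
      (imMat z).det * ((imMat z)⁻¹ * imMat v).trace := by
  have hd : DifferentiableAt ℝ (fun w : SymC n => (imMat w).det) z :=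
    contDiff_det_imMat.contDiffAt.differentiableAt (by simp)
  rw [← hd.lineDeriv_eq_fderiv]
  have hu : IsUnit (imMat z).det := (det_imMat_pos hz).ne'.isUnit
  refine HasDerivAt.deriv (f := fun t : ℝ => (imMat (z + t • v)).det) ?_
  have e (t : ℝ) : (imMat (z + t • v)).det =
      (imMat z).det * (1 + t • ((imMat z)⁻¹ * imMat v)).det := by
    rw [imMat_add_smul, ← Matrix.det_mul, Matrix.mul_add, Matrix.mul_one, Matrix.mul_smul,
      Matrix.mul_nonsing_inv_cancel_left _ _ hu]
  simp only [e]
  exact (hasDerivAt_det_one_add ((imMat z)⁻¹ * imMat v)).const_mul (imMat z).det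

/-- `det (Y) ^ q` as a complex number. -/
def detY (q : ℝ) (z : SymC n) : ℂ := (((imMat z).det ^ q : ℝ) : ℂ)

theorem contDiffAt_detY (q : ℝ) {z : SymC n} (hz : z ∈ upperHalfSpace n) {m : WithTop ℕ∞} :
    ContDiffAt ℝ m (detY q) z := by
  have h : ContDiffAt ℝ m (fun w : SymC n => (imMat w).det ^ q) z :=
    (contDiff_det_imMat.contDiffAt.of_le le_top).rpow_const_of_ne (det_imMat_pos hz).ne'
  exact Complex.ofRealCLM.contDiff.contDiffAt.comp z h

theorem detY_add (p q : ℝ) {z : SymC n} (hz : z ∈ upperHalfSpace n) :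
    detY (p + q) z = detY p z * detY q z := by
  rw [detY, Real.rpow_add (det_imMat_pos hz)]; push_cast; rfl

theorem detY_zero (z : SymC n) : detY 0 z = 1 := by simp [detY]

theorem fderiv_detY (q : ℝ) {z : SymC n} (hz : z ∈ upperHalfSpace n) (v : SymC n) :
    fderiv ℝ (detY q) z v = q * detY q z * (((imMat z)⁻¹ * imMat v).trace : ℝ) := by
  have hp := det_imMat_pos hz
  have hd : DifferentiableAt ℝ (fun w : SymC n => (imMat w).det) z :=
    contDiff_det_imMat.contDiffAt.differentiableAt (by simp)
  have h1 := (hd.hasFDerivAt.rpow_const (p := q) (Or.inl hp.ne'))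
  have h2 := Complex.ofRealCLM.hasFDerivAt.comp z h1
  have h3 : HasFDerivAt (detY q) _ z := h2
  rw [h3.fderiv]
  simp only [ContinuousLinearMap.comp_apply, _root_.smul_apply, smul_eq_mul,
    fderiv_det_imMat hz, Complex.ofRealCLM_apply, detY]
  rw [Real.rpow_sub_one hp.ne']
  push_cast
  have : ((imMat z).det : ℂ) ≠ 0 := by exact_mod_cast hp.ne'
  field_simp

theorem subConj_inv {z : SymC n} (hz : z ∈ upperHalfSpace n) :
    (subConj z)⁻¹ = (2 * Complex.I)⁻¹ • toC (imMat z)⁻¹ := by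
  apply Matrix.inv_eq_right_inv
  rw [subConj_eq, Matrix.smul_mul, Matrix.mul_smul, smul_smul, ← toC_mul,
    Matrix.mul_nonsing_inv _ (det_imMat_pos hz).ne'.isUnit, toC_one, mul_inv_cancel₀ (by simp),
    one_smul]

theorem subConj_mul_inv {z : SymC n} (hz : z ∈ upperHalfSpace n) :
    subConj z * (subConj z)⁻¹ = 1 := by
  rw [subConj_inv hz, subConj_eq, Matrix.smul_mul, Matrix.mul_smul, smul_smul, ← toC_mul,
    Matrix.mul_nonsing_inv _ (det_imMat_pos hz).ne'.isUnit, toC_one, mul_inv_cancel₀ (by simp),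
    one_smul]

theorem subConj_inv_mul {z : SymC n} (hz : z ∈ upperHalfSpace n) :
    (subConj z)⁻¹ * subConj z = 1 := mul_eq_one_comm.mp (subConj_mul_inv hz)

/-- Jacobi's formula for the derivative of a determinant. The direction `eDir j k` is real, so only
its multiple by i moves Y. -/
theorem dW_detY (s : ℂ) (q : ℝ) (j k : Fin n) {z : SymC n} (hz : z ∈ upperHalfSpace n) :
    dW s j k (detY q) z = s * Complex.I * q * (subConj z)⁻¹ j k * detY q z := by
  have h1 : imMat (eDir j k) = 0 := by
    ext a b
    have := toMat_eDir j k a b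
    simp only [toMat, Matrix.of_apply] at this
    simp only [imMat, Matrix.of_apply, this, Matrix.zero_apply]
    rw [← Complex.conj_eq_iff_im, conj_eps]
  have h2 (a b : Fin n) : ((imMat (Complex.I • eDir j k) a b : ℝ) : ℂ) = eps j k a b := by
    have := toMat_eDir j k a b
    simp only [toMat, Matrix.of_apply] at this
    simp only [imMat, Matrix.of_apply, Pi.smul_apply, this, smul_eq_mul, Complex.I_mul_im]
    exact Complex.conj_eq_iff_re.mp (conj_eps j k a b)
  have h3 : ((((imMat z)⁻¹ * imMat (Complex.I • eDir j k)).trace : ℝ) : ℂ) =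
      ((imMat z)⁻¹ j k : ℝ) := by
    simp only [Matrix.trace, Matrix.diag, Matrix.mul_apply, Complex.ofReal_sum, Complex.ofReal_mul,
      h2, eps, mul_add, Finset.sum_add_distrib]
    have hs : (imMat z)⁻¹ k j = (imMat z)⁻¹ j k := by
      have := Matrix.transpose_nonsing_inv (imMat z)
      rw [imMat_transpose] at this
      exact congrFun (congrFun this j) k
    simp [hs]
    ring
  rw [dW, wirt, fderiv_detY q hz, fderiv_detY q hz, h3, h1, subConj_inv hz]
  simp only [Matrix.trace_zero, Complex.ofReal_zero, mul_zero, zero_add,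
    Matrix.smul_apply, toC_apply, smul_eq_mul]
  field_simp

end SiegelMaass
end

noncomputable section

namespace SiegelMaass

variable {n : ℕ}

/-! ### The Laplacian in divergence form -/

theorem contDiffAt_dW {s : ℂ} {g : SymC n → ℂ} {z : SymC n} (hg : ContDiffAt ℝ 2 g z)
    (j k : Fin n) : ContDiffAt ℝ 1 (fun w => dW s j k g w) z := by
  have h1 : ContDiffAt ℝ 1 (fderiv ℝ g) z := hg.fderiv_right (by norm_num)
  unfold dW wirt
  have h2 (v : SymC n) : ContDiffAt ℝ 1 (fun w => fderiv ℝ g w v) z :=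
    h1.clm_apply contDiffAt_const
  exact contDiffAt_const.mul ((h2 _).add (contDiffAt_const.mul (h2 _)))

theorem differentiableAt_dW {s : ℂ} {g : SymC n → ℂ} {z : SymC n} (hg : ContDiffAt ℝ 2 g z)
    (j k : Fin n) : DifferentiableAt ℝ (fun w => dW s j k g w) z :=
  (contDiffAt_dW hg j k).differentiableAt (by norm_num)

theorem dW_dW_comm {s t : ℂ} {g : SymC n → ℂ} {z : SymC n} (hg : ContDiffAt ℝ 2 g z)
    (j k l m : Fin n) : dW s j k (fun w => dW t l m g w) z = dW t l m (fun w => dW s j k g w) z := by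
  have hsym : IsSymmSndFDerivAt ℝ g z := hg.isSymmSndFDerivAt (by simp)
  have hd : DifferentiableAt ℝ (fderiv ℝ g) z :=
    (hg.fderiv_right (m := 1) (by norm_num)).differentiableAt (by norm_num)
  have key (s t : ℂ) (u v : SymC n) : wirt s (fderiv ℝ (fun w => wirt t (fderiv ℝ g w) v) z) u =
      1 / 4 * (fderiv ℝ (fderiv ℝ g) z u v + t * fderiv ℝ (fderiv ℝ g) z u (Complex.I • v) +
        s * (fderiv ℝ (fderiv ℝ g) z (Complex.I • u) v +
          t * fderiv ℝ (fderiv ℝ g) z (Complex.I • u) (Complex.I • v))) := by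
    have h2 (v : SymC n) : HasFDerivAt (fun w => fderiv ℝ g w v)
        ((fderiv ℝ (fderiv ℝ g) z).flip v) z := by
      simpa using hd.hasFDerivAt.clm_apply (hasFDerivAt_const v z)
    have h3 : HasFDerivAt (fun w => wirt t (fderiv ℝ g w) v) _ z :=
      ((h2 v).add ((h2 (Complex.I • v)).const_mul t)).const_mul (1 / 2 : ℂ)
    rw [h3.fderiv, wirt]
    simp only [_root_.add_apply, _root_.smul_apply, ContinuousLinearMap.flip_apply, smul_eq_mul]
    ring
  have hs (u v : SymC n) : fderiv ℝ (fderiv ℝ g) z u v = fderiv ℝ (fderiv ℝ g) z v u :=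
    hsym.eq u v
  simp only [dW] at *
  rw [key, key, hs (eDir l m), hs (eDir l m), hs (Complex.I • eDir l m),
    hs (Complex.I • eDir l m)]
  ring

/-- `tr (S · ∂/∂Z · S · ∂/∂Z̄)` with the functions `S` not differentiated. -/
def secondOrder (g : SymC n → ℂ) (z : SymC n) : ℂ :=
  ∑ p, ∑ j, ∑ l, ∑ m, subConj z j l * subConj z m p * dZ p j (fun w => dZbar l m g w) z

theorem opK_scalarMat (a : ℝ) (g : SymC n → ℂ) (z : SymC n) (m k : Fin n) :
    opK a (scalarMat g) z m k =
      ∑ p, subConj z m p * dZ p k g z + a * (g z * if m = k then 1 else 0) := by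
  simp only [opK, scalarMat, Matrix.add_apply, Matrix.mul_apply, Matrix.of_apply,
    Matrix.smul_apply, smul_eq_mul, Matrix.one_apply]
  congr 1
  refine Finset.sum_congr rfl fun p _ => ?_
  congr 1
  rw [Finset.sum_eq_single k]
  · simp
  · intro q _ hq; simp [hq, dZ_eq_dW, dW_const]
  · simp

/-- Moving ∂/∂Z̄ past Z - Z̄ in K_α costs -(n+1)/2 times the first order term in ∂/∂Z, which cancels
the shift in Λ_(β-(n+1)/2). The added multiple of α(β-(n+1)/2) removes the terms of order zero. -/
theorem laplacian_eq (α β : ℝ) {g : SymC n → ℂ} {z : SymC n} (hg : ContDiffAt ℝ 2 g z) :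
    laplacian α β g z = -(secondOrder g z + α * ∑ j, ∑ l, subConj z j l * dZbar l j g z
      - β * ∑ j, ∑ l, subConj z j l * dZ l j g z) := by
  have hg1 : DifferentiableAt ℝ g z := hg.differentiableAt (by norm_num)
  have hd (p k : Fin n) : DifferentiableAt ℝ (fun w => dZ p k g w) z := by
    rw [dZ_eq_dW]; exact differentiableAt_dW hg p k
  have h1 (l m j : Fin n) : dZbar l m (fun w => opK α (scalarMat g) w m j) z =
      ∑ p, (-eps l m m p * dZ p j g z + subConj z m p * dZ p j (fun w => dZbar l m g w) z)
        + α * (dZbar l m g z * if m = j then 1 else 0) := by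
    simp only [opK_scalarMat]
    have e1 (p : Fin n) : dZbar l m (fun w => subConj w m p * dZ p j g w) z =
        -eps l m m p * dZ p j g z + subConj z m p * dZ p j (fun w => dZbar l m g w) z := by
      rw [dZbar_eq_dW, dW_mul (differentiableAt_subConj m p z) (hd p j), ← dZbar_eq_dW,
        dZbar_subConj, dZ_eq_dW, dZbar_eq_dW, dW_dW_comm hg]
    rw [dZbar_eq_dW, dW_add, dW_sum, dW_const_mul]
    · simp only [← dZbar_eq_dW, e1]
      congr 2
      split_ifs
      · simp
      · simp [dZbar_eq_dW, dW_const]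
    · fun_prop
    · intro p _; exact (differentiableAt_subConj m p z).mul (hd p j)
    · exact DifferentiableAt.fun_sum fun p _ => (differentiableAt_subConj m p z).mul (hd p j)
    · fun_prop
  have h2 : ∑ j, ∑ l, subConj z j l * ∑ m, dZbar l m (fun w => opK α (scalarMat g) w m j) z =
      -((n + 1) / 2) * ∑ j, ∑ l, subConj z j l * dZ l j g z + secondOrder g z +
        α * ∑ j, ∑ l, subConj z j l * dZbar l j g z := by
    have e2 (l j : Fin n) : ∑ m, dZbar l m (fun w => opK α (scalarMat g) w m j) z =
        -((n + 1) / 2) * dZ l j g z +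
        ∑ m, ∑ p, subConj z m p * dZ p j (fun w => dZbar l m g w) z + α * dZbar l j g z := by
      simp only [h1, Finset.sum_add_distrib]
      congr 2
      · rw [Finset.sum_comm]
        simp only [← Finset.sum_mul, Finset.sum_neg_distrib, sum_eps]
        simp
      · simp
    simp only [e2, mul_add, Finset.sum_add_distrib, Finset.mul_sum]
    refine congrArg₂ (· + ·) (congrArg₂ (· + ·) ?_ ?_) ?_
    · refine Finset.sum_congr rfl fun j _ => Finset.sum_congr rfl fun l _ => by ring
    · rw [secondOrder, Finset.sum_comm]
      conv_rhs => rw [Finset.sum_comm]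
      rw [Finset.sum_comm]
      refine Finset.sum_congr rfl fun j _ => ?_
      conv_rhs => rw [Finset.sum_comm]
      refine Finset.sum_congr rfl fun l _ => ?_
      rw [Finset.sum_comm]
      exact Finset.sum_congr rfl fun p _ => Finset.sum_congr rfl fun m _ => by ring
    · refine Finset.sum_congr rfl fun j _ => Finset.sum_congr rfl fun l _ => by ring
  have h3 : ∑ j, opK α (scalarMat g) z j j =
      ∑ j, ∑ l, subConj z j l * dZ l j g z + α * n * g z := by
    simp only [opK_scalarMat, Finset.sum_add_distrib]
    simp; ring
  have h4 : (scalarMat g z).trace = n * g z := by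
    simp [scalarMat, Matrix.trace_smul, mul_comm]
  rw [laplacian, opOmega, Matrix.trace_add, Matrix.trace_smul, h4, opLambda, Matrix.trace_sub,
    Matrix.trace_smul]
  simp only [Matrix.trace, Matrix.diag, Matrix.mul_apply, Matrix.of_apply, h3, h2, smul_eq_mul]
  push_cast
  ring

/-- `S (∂/∂Z̄ φ) S - β φ S`. -/
def fluxMat (β : ℝ) (g : SymC n → ℂ) (z : SymC n) (j p : Fin n) : ℂ :=
  ∑ l, ∑ m, subConj z j l * (dZbar l m g z * subConj z m p) - β * (g z * subConj z j p)

theorem differentiableAt_fluxMat (β : ℝ) {g : SymC n → ℂ} {z : SymC n} (hg : ContDiffAt ℝ 2 g z)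
    (j p : Fin n) : ContDiffAt ℝ 1 (fun w => fluxMat β g w j p) z := by
  have h1 (a b : Fin n) : ContDiffAt ℝ 1 (fun w : SymC n => subConj w a b) z :=
    (contDiff_subConj a b).contDiffAt.of_le le_top
  have h2 (l m : Fin n) : ContDiffAt ℝ 1 (fun w => dZbar l m g w) z := by
    rw [dZbar_eq_dW]; exact contDiffAt_dW hg l m
  unfold fluxMat
  refine ContDiffAt.sub (ContDiffAt.sum fun l _ => ContDiffAt.sum fun m _ =>
    (h1 j l).mul ((h2 l m).mul (h1 m p))) ?_
  exact contDiffAt_const.mul ((hg.of_le (by norm_num)).mul (h1 j p))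

/-- The weight det(Y)^q contributes q times the trace of (Z - Z̄)⁻¹ against the flux, and each of
the two factors Z - Z̄ contributes (n+1)/2. For q = α - n - 1 the coefficient q + n + 1 is the α of
the Laplacian, and the remaining multiple of g is the bound for the eigenvalue. -/
theorem sum_dZ_detY_mul_fluxMat (q β : ℝ) {g : SymC n → ℂ} {z : SymC n}
    (hz : z ∈ upperHalfSpace n) (hg : ContDiffAt ℝ 2 g z) :
    ∑ p, ∑ j, dZ p j (fun w => detY q w * fluxMat β g w j p) z =
      detY q z * (secondOrder g z + (q + n + 1) * ∑ j, ∑ l, subConj z j l * dZbar l j g z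
        - β * ∑ j, ∑ l, subConj z j l * dZ l j g z - β * n * (q + (n + 1) / 2) * g z) := by
  have hg1 : DifferentiableAt ℝ g z := hg.differentiableAt (by norm_num)
  have hS := fun a b : Fin n => differentiableAt_subConj a b z
  have hQ (l m : Fin n) : DifferentiableAt ℝ (fun w => dZbar l m g w) z := by
    rw [dZbar_eq_dW]; exact differentiableAt_dW hg l m
  have hQS (l m p : Fin n) :
      DifferentiableAt ℝ (fun w => dZbar l m g w * subConj w m p) z := (hQ l m).mul (hS m p)
  have hD : DifferentiableAt ℝ (detY q) z := (contDiffAt_detY q hz (m := 1)).differentiableAt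
    (by norm_num)
  have hR (j p : Fin n) : DifferentiableAt ℝ (fun w => fluxMat β g w j p) z :=
    (differentiableAt_fluxMat β hg j p).differentiableAt (by norm_num)
  have e1 (p j : Fin n) : dZ p j (fun w => fluxMat β g w j p) z =
      ∑ l, ∑ m, (eps p j j l * (dZbar l m g z * subConj z m p) +
        subConj z j l * (dZ p j (fun w => dZbar l m g w) z * subConj z m p +
          dZbar l m g z * eps p j m p)) -
        β * (dZ p j g z * subConj z j p + g z * eps p j j p) := by
    unfold fluxMat
    rw [dZ_eq_dW, dW_sub, dW_const_mul, dW_mul hg1 (hS j p), dW_sum]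
    · congr 1
      · refine Finset.sum_congr rfl fun l _ => ?_
        rw [dW_sum]
        · refine Finset.sum_congr rfl fun m _ => ?_
          rw [dW_mul (hS j l) (hQS l m p), dW_mul (hQ l m) (hS m p), ← dZ_eq_dW,
            dZ_subConj, dZ_subConj]
        · intro m _; exact (hS j l).mul (hQS l m p)
      · rw [← dZ_eq_dW, dZ_subConj]
    · intro l _
      exact DifferentiableAt.fun_sum fun m _ => (hS j l).mul (hQS l m p)
    · exact hg1.mul (hS j p)
    · exact DifferentiableAt.fun_sum fun l _ => DifferentiableAt.fun_sum fun m _ =>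
        (hS j l).mul (hQS l m p)
    · exact (hg1.mul (hS j p)).const_mul _
  have e2 (p j : Fin n) : dZ p j (fun w => detY q w * fluxMat β g w j p) z =
      detY q z * (q * ((subConj z)⁻¹ p j * fluxMat β g z j p) +
        dZ p j (fun w => fluxMat β g w j p) z) := by
    rw [dZ_eq_dW, dW_mul hD (hR j p), dW_detY _ _ _ _ hz, neg_mul, Complex.I_mul_I]
    ring
  simp only [e2, ← Finset.mul_sum, Finset.sum_add_distrib]
  congr 1
  have inv1 (p l : Fin n) : ∑ j, (subConj z)⁻¹ p j * subConj z j l = if p = l then 1 else 0 := by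
    rw [← Matrix.mul_apply, subConj_inv_mul hz, Matrix.one_apply]
  set A := ∑ j, ∑ l, subConj z j l * dZbar l j g z with hA
  have c1 : ∑ p, ∑ j, (subConj z)⁻¹ p j * fluxMat β g z j p = A - β * n * g z := by
    have t1 (p : Fin n) : ∑ j, (subConj z)⁻¹ p j * fluxMat β g z j p =
        ∑ m, dZbar p m g z * subConj z m p - β * g z := by
      simp only [fluxMat, mul_sub, Finset.sum_sub_distrib]
      congr 1
      · simp only [Finset.mul_sum]
        rw [Finset.sum_comm]
        have (l : Fin n) : ∑ j, ∑ m, (subConj z)⁻¹ p j *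
            (subConj z j l * (dZbar l m g z * subConj z m p)) =
            (if p = l then 1 else 0) * ∑ m, dZbar l m g z * subConj z m p := by
          rw [← inv1, Finset.sum_mul]
          refine Finset.sum_congr rfl fun j _ => ?_
          rw [Finset.mul_sum]
          exact Finset.sum_congr rfl fun m _ => by ring
        simp [this]
      · have : ∀ j, (subConj z)⁻¹ p j * (β * (g z * subConj z j p)) =
            β * g z * ((subConj z)⁻¹ p j * subConj z j p) := fun j => by ring
        simp only [this, ← Finset.mul_sum, inv1]; simp
    simp only [t1, Finset.sum_sub_distrib]
    rw [Finset.sum_const, Finset.card_univ, Fintype.card_fin, hA, Finset.sum_comm]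
    congr 1
    · exact Finset.sum_congr rfl fun m _ => Finset.sum_congr rfl fun p _ => by ring
    · simp; ring
  have c2 : ∑ p, ∑ j, dZ p j (fun w => fluxMat β g w j p) z =
      secondOrder g z + (n + 1) * A - β * ∑ j, ∑ l, subConj z j l * dZ l j g z
        - β * n * ((n + 1) / 2) * g z := by
    simp only [e1, Finset.sum_sub_distrib, mul_add, Finset.sum_add_distrib]
    have s1 : ∑ p, ∑ j, ∑ l, ∑ m, eps p j j l * (dZbar l m g z * subConj z m p) =
        ((n : ℂ) + 1) / 2 * A := by
      have (p : Fin n) : ∑ j, ∑ l, ∑ m, eps p j j l * (dZbar l m g z * subConj z m p) =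
          ((n : ℂ) + 1) / 2 * ∑ m, dZbar p m g z * subConj z m p := by
        rw [Finset.sum_comm]
        simp only [← Finset.mul_sum, ← Finset.sum_mul, sum_eps]
        simp
      rw [Finset.sum_congr rfl fun p _ => this p, ← Finset.mul_sum]
      congr 1
      rw [hA, Finset.sum_comm]
      exact Finset.sum_congr rfl fun m _ => Finset.sum_congr rfl fun p _ => by ring
    have s2 : ∑ p, ∑ j, ∑ l, ∑ m, subConj z j l * (dZbar l m g z * eps p j m p) =
        ((n : ℂ) + 1) / 2 * A := by
      rw [Finset.sum_comm, hA, Finset.mul_sum]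
      refine Finset.sum_congr rfl fun j _ => ?_
      rw [Finset.sum_comm, Finset.mul_sum]
      refine Finset.sum_congr rfl fun l _ => ?_
      rw [Finset.sum_comm]
      have e (m p : Fin n) : eps p j m p = eps j p p m := by
        unfold eps; ring
      simp only [e, ← Finset.mul_sum, sum_eps]
      simp
      ring
    have s3 : ∑ p, ∑ j, ∑ l, ∑ m, subConj z j l *
        (dZ p j (fun w => dZbar l m g w) z * subConj z m p) = secondOrder g z := by
      unfold secondOrder
      refine Finset.sum_congr rfl fun p _ => Finset.sum_congr rfl fun j _ =>
        Finset.sum_congr rfl fun l _ => Finset.sum_congr rfl fun m _ => by ring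
    have s4 : ∑ p, ∑ j, (β : ℂ) * (dZ p j g z * subConj z j p) =
        β * ∑ j, ∑ l, subConj z j l * dZ l j g z := by
      rw [Finset.sum_comm]
      simp only [Finset.mul_sum]
      exact Finset.sum_congr rfl fun m _ => Finset.sum_congr rfl fun p _ => by ring
    have s5 : ∑ p : Fin n, ∑ j, (β : ℂ) * (g z * eps p j j p) =
        β * n * ((n + 1) / 2) * g z := by
      simp only [← Finset.mul_sum, sum_eps]; simp; ring
    rw [s1, s2, s3, s4, s5]
    ring
  rw [c1, c2]
  ring

/-- The eigenvalue equation in divergence form. -/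
theorem sum_dZ_detY_mul_fluxMat_of_eigen {α β : ℝ} {l : ℂ} {g : SymC n → ℂ} {z : SymC n}
    (hz : z ∈ upperHalfSpace n) (hg : ContDiffAt ℝ 2 g z)
    (hl : laplacian α β g z + l * g z = 0) :
    ∑ p, ∑ j, dZ p j (fun w => detY (α - n - 1) w * fluxMat β g w j p) z =
      detY (α - n - 1) z * ((l - n * β * (α - (n + 1) / 2)) * g z) := by
  rw [sum_dZ_detY_mul_fluxMat _ _ hz hg]
  rw [laplacian_eq α β hg] at hl
  congr 1
  push_cast
  linear_combination -hl

end SiegelMaass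
end

noncomputable section

namespace SiegelMaass

open scoped ComplexOrder MatrixOrder

variable {n : ℕ}

/-! ### The gradient `∂/∂Z̄` and its invariant norm -/

/-- The symmetric matrix `∂u/∂Z̄`. -/
def grad (u : SymC n → ℂ) (z : SymC n) : Matrix (Fin n) (Fin n) ℂ :=
  Matrix.of fun l m => dZbar l m u z

theorem grad_transpose (u : SymC n → ℂ) (z : SymC n) : (grad u z)ᵀ = grad u z := by
  ext l m; simp only [grad, Matrix.transpose_apply, Matrix.of_apply, dZbar_eq_dW]
  exact dW_comm _ _ _ _ _

theorem grad_congr {u v : SymC n → ℂ} {z : SymC n} (h : u =ᶠ[nhds z] v) : grad u z = grad v z := by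
  ext l m; simp only [grad, Matrix.of_apply, dZbar_eq_dW]; exact dW_congr h

theorem eq_sum_eDir (v : SymC n) : v = ∑ l, ∑ m, toMat v l m • eDir l m := by
  apply toMat_injective
  have hs (F : Fin n → SymC n) : toMat (∑ l, F l) = ∑ l, toMat (F l) := by
    ext a b; simp [toMat, Finset.sum_apply, Matrix.sum_apply]
  ext a b
  simp only [hs, toMat_smul, Matrix.sum_apply, Matrix.smul_apply, toMat_eDir, smul_eq_mul, eps]
  have h : toMat v b a = toMat v a b := congrFun (congrFun (toMat_transpose v) a) b
  simp only [mul_add, Finset.sum_add_distrib]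
  simp [h]
  ring

/-- The part of a real-linear map selected by ∂/∂Z̄ is conjugate linear in the direction. This is
why only conjugates of the derivative of the action occur in the chain rule below. -/
theorem wirt_I_smul (L : SymC n →L[ℝ] ℂ) (c : ℂ) (v : SymC n) :
    wirt Complex.I L (c • v) = conj c * wirt Complex.I L v := by
  have h (c : ℂ) (v : SymC n) : L (c • v) = c.re * L v + c.im * L (Complex.I • v) := by
    have : c • v = c.re • v + c.im • (Complex.I • v) := by
      conv_lhs => rw [← Complex.re_add_im c]
      rw [add_smul, mul_smul]
      rfl
    rw [this, map_add, map_smul, map_smul, Complex.real_smul, Complex.real_smul]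
  have h2 : L (Complex.I • c • v) = -c.im * L v + c.re * L (Complex.I • v) := by
    rw [smul_smul, h]; simp
  rw [wirt, wirt, h2, h]
  have h3 : conj c = c.re - c.im * Complex.I := by
    apply Complex.ext <;> simp
  rw [h3]
  linear_combination (1 / 2 * (c.im : ℂ) * L (Complex.I • v)) * Complex.I_mul_I

theorem wirt_sum {ι : Type*} (s : ℂ) (L : SymC n →L[ℝ] ℂ) (t : Finset ι) (F : ι → SymC n) :
    wirt s L (∑ i ∈ t, F i) = ∑ i ∈ t, wirt s L (F i) := by
  simp only [wirt, Finset.smul_sum, map_sum, Finset.mul_sum, ← Finset.sum_add_distrib]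

theorem wirt_fderiv_eq (u : SymC n → ℂ) (z v : SymC n) :
    wirt Complex.I (fderiv ℝ u z) v = ∑ l, ∑ m, conj (toMat v l m) * grad u z l m := by
  conv_lhs => rw [eq_sum_eDir v]
  simp only [wirt_sum, wirt_I_smul, grad, Matrix.of_apply, dZbar_eq]

/-- Chain rule: the action is holomorphic with derivative V ↦ Uᵀ V U for U = (CZ + D)⁻¹, and ∂/∂Z̄
sees its conjugate transpose. -/
theorem grad_comp_act (γ : SpR n) {u : SymC n → ℂ} {z : SymC n} (hz : z ∈ upperHalfSpace n)
    (hu : DifferentiableAt ℝ u (act γ z)) :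
    grad (fun w => u (act γ w)) z =
      ((denom γ z)⁻¹).map conj * grad u (act γ z) * (((denom γ z)⁻¹).map conj)ᵀ := by
  set U := (denom γ z)⁻¹
  set L : SymC n →L[ℂ] SymC n := LinearMap.toContinuousLinearMap (symCongr U)
  have h1 : fderiv ℝ (fun w => u (act γ w)) z =
      (fderiv ℝ u (act γ z)).comp (L.restrictScalars ℝ) :=
    (hu.hasFDerivAt.comp z (hasFDerivAt_act_real γ hz)).fderiv
  have h2 (l m : Fin n) : grad (fun w => u (act γ w)) z l m =
      wirt Complex.I (fderiv ℝ u (act γ z)) (symCongr U (eDir l m)) := by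
    simp only [grad, Matrix.of_apply, dZbar_eq, h1, wirt, ContinuousLinearMap.comp_apply]
    have : L.restrictScalars ℝ (Complex.I • eDir l m) =
        Complex.I • (symCongr U (eDir l m) : SymC n) := L.map_smul _ _
    rw [this]; rfl
  have hG := grad_transpose u (act γ z)
  set G := grad u (act γ z)
  have h3 (l m p q : Fin n) : conj (toMat (symCongr U (eDir l m)) p q) =
      1 / 2 * (conj (U l p) * conj (U m q) + conj (U m p) * conj (U l q)) := by
    have : toMat (symCongr U (eDir l m)) p q = 1 / 2 * (U l p * U m q + U m p * U l q) := by
      rw [toMat_symCongr]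
      simp only [Matrix.mul_apply, Matrix.transpose_apply, toMat_eDir, eps, Finset.sum_mul,
        mul_add, add_mul, Finset.sum_add_distrib]
      simp
      ring
    rw [this]
    simp [Complex.conj_ofNat]
  ext l m
  rw [h2, wirt_fderiv_eq]
  simp only [h3, Matrix.mul_apply, Matrix.transpose_apply, Matrix.map_apply, Finset.sum_mul]
  have hG' (p q : Fin n) : G q p = G p q := congrFun (congrFun hG p) q
  have e1 : ∑ p, ∑ q, conj (U m p) * G p q * conj (U l q) =
      ∑ p, ∑ q, conj (U l p) * G p q * conj (U m q) := by
    rw [Finset.sum_comm]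
    refine Finset.sum_congr rfl fun p _ => Finset.sum_congr rfl fun q _ => ?_
    rw [hG']; ring
  calc _ = 1 / 2 * (∑ p, ∑ q, conj (U l p) * G p q * conj (U m q)) +
        1 / 2 * (∑ p, ∑ q, conj (U m p) * G p q * conj (U l q)) := by
        simp only [Finset.mul_sum, ← Finset.sum_add_distrib]
        refine Finset.sum_congr rfl fun p _ => Finset.sum_congr rfl fun q _ => by ring
    _ = ∑ p, ∑ q, conj (U l p) * G p q * conj (U m q) := by rw [e1]; ring
    _ = _ := Finset.sum_comm

/-- The invariant hermitian form on the values of `grad`. -/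
def gradForm (z : SymC n) (V W : Matrix (Fin n) (Fin n) ℂ) : ℂ :=
  4 * (toC (imMat z) * V * toC (imMat z) * Wᴴ).trace

/-- The associated quadratic form. -/
def gradSq (z : SymC n) (V : Matrix (Fin n) (Fin n) ℂ) : ℝ := (gradForm z V V).re

/-- The congruences on V and W are moved onto the two copies of Y by cyclicity of the trace, where
they form Im γZ. -/
theorem gradForm_act (γ : SpR n) {z : SymC n} (hz : z ∈ upperHalfSpace n)
    (V W : Matrix (Fin n) (Fin n) ℂ) :
    gradForm z (((denom γ z)⁻¹).map conj * V * (((denom γ z)⁻¹).map conj)ᵀ)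
      (((denom γ z)⁻¹).map conj * W * (((denom γ z)⁻¹).map conj)ᵀ) =
    gradForm (act γ z) V W := by
  have h1 := toC_imMat_act γ hz
  have h2 := toC_imMat_act' γ hz
  set U := (denom γ z)⁻¹
  have e1 : (U.map conj)ᵀ = Uᴴ := by ext; simp
  have e2 : (U.map conj)ᴴ = Uᵀ := by ext; simp
  rw [gradForm, gradForm, Matrix.conjTranspose_mul, Matrix.conjTranspose_mul, e1, e2,
    Matrix.conjTranspose_conjTranspose]
  congr 1
  calc _ = ((toC (imMat z) * U.map conj * V * (Uᴴ * toC (imMat z) * U) * Wᴴ) * Uᵀ).trace := by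
        simp only [Matrix.mul_assoc]
    _ = (Uᵀ * toC (imMat z) * U.map conj * V * (Uᴴ * toC (imMat z) * U) * Wᴴ).trace := by
        rw [Matrix.trace_mul_comm]; simp only [Matrix.mul_assoc]
    _ = _ := by rw [← h1, ← h2]

theorem trace_mul_conjTranspose_eq (P Q : Matrix (Fin n) (Fin n) ℂ) :
    (P * Qᴴ).trace = ∑ i, ∑ j, P i j * conj (Q i j) := by
  rw [Matrix.trace]
  refine Finset.sum_congr rfl fun i _ => ?_
  rw [Matrix.diag_apply, Matrix.mul_apply]
  exact Finset.sum_congr rfl fun j _ => by rw [Matrix.conjTranspose_apply]; rfl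

theorem gradForm_eq_trace {z : SymC n} {A : Matrix (Fin n) (Fin n) ℝ} (e : imMat z = A * Aᵀ)
    (V W : Matrix (Fin n) (Fin n) ℂ) : gradForm z V W =
      4 * (((toC A)ᵀ * V * toC A) * ((toC A)ᵀ * W * toC A)ᴴ).trace := by
  have h1 : ((toC A)ᵀ * W * toC A)ᴴ = (toC A)ᵀ * (Wᴴ * toC A) := by
    rw [Matrix.conjTranspose_mul, Matrix.conjTranspose_mul, toC_conjTranspose, ← toC_transpose,
      toC_conjTranspose, ← toC_transpose, Matrix.transpose_transpose]
  rw [gradForm, e, toC_mul, toC_transpose, h1]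
  generalize toC A = B
  congr 1
  calc _ = (B * (Bᵀ * V * B * (Bᵀ * Wᴴ))).trace := by simp only [Matrix.mul_assoc]
    _ = _ := by rw [Matrix.trace_mul_comm]; simp only [Matrix.mul_assoc]

/-- Writing Y = A Aᵀ turns the form into four times the Frobenius product of AᵀVA and AᵀWA.
Positivity, definiteness and the Cauchy–Schwarz type bound are read off from this. -/
theorem exists_gradForm_eq {z : SymC n} (hz : z ∈ upperHalfSpace n) :
    ∃ A : Matrix (Fin n) (Fin n) ℂ, IsUnit A.det ∧ ∀ V W, gradForm z V W =
      4 * ∑ i, ∑ j, (Aᵀ * V * A) i j * conj ((Aᵀ * W * A) i j) := by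
  obtain ⟨A, hA, e⟩ := exists_eq_mul_transpose hz
  refine ⟨toC A, ?_, fun V W => ?_⟩
  · rw [toC_det]; exact isUnit_iff_ne_zero.mpr (Complex.ofReal_ne_zero.mpr hA.ne_zero)
  · rw [gradForm_eq_trace e, trace_mul_conjTranspose_eq]

theorem gradForm_self {z : SymC n} (hz : z ∈ upperHalfSpace n) (V : Matrix (Fin n) (Fin n) ℂ) :
    gradForm z V V = (gradSq z V : ℂ) := by
  obtain ⟨A, -, h⟩ := exists_gradForm_eq hz
  rw [gradSq, h]
  simp only [Complex.mul_conj]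
  norm_cast

theorem gradSq_nonneg {z : SymC n} (hz : z ∈ upperHalfSpace n) (V : Matrix (Fin n) (Fin n) ℂ) :
    0 ≤ gradSq z V := by
  obtain ⟨A, -, h⟩ := exists_gradForm_eq hz
  rw [gradSq, h]
  simp only [Complex.mul_conj]
  norm_cast
  exact mul_nonneg (by norm_num)
    (Finset.sum_nonneg fun i _ => Finset.sum_nonneg fun j _ => Complex.normSq_nonneg _)

theorem eq_zero_of_gradSq {z : SymC n} (hz : z ∈ upperHalfSpace n)
    {V : Matrix (Fin n) (Fin n) ℂ} (h0 : gradSq z V = 0) : V = 0 := by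
  obtain ⟨A, hA, h⟩ := exists_gradForm_eq hz
  rw [gradSq, h] at h0
  simp only [Complex.mul_conj] at h0
  norm_cast at h0
  have h1 : ∑ i, ∑ j, Complex.normSq ((Aᵀ * V * A) i j) = 0 := by linarith
  have h2 : Aᵀ * V * A = 0 := by
    ext i j
    have h3 := (Finset.sum_eq_zero_iff_of_nonneg
      (fun i _ => Finset.sum_nonneg fun j _ => Complex.normSq_nonneg _)).mp h1 i (Finset.mem_univ i)
    have h4 := (Finset.sum_eq_zero_iff_of_nonneg
      (fun j _ => Complex.normSq_nonneg _)).mp h3 j (Finset.mem_univ j)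
    exact Complex.normSq_eq_zero.mp h4
  have hA' : IsUnit Aᵀ.det := by rwa [Matrix.det_transpose]
  have h3 : Aᵀ⁻¹ * (Aᵀ * V * A) * A⁻¹ = V := by
    rw [Matrix.mul_assoc Aᵀ, Matrix.nonsing_inv_mul_cancel_left _ _ hA',
      Matrix.mul_nonsing_inv_cancel_right _ _ hA]
  rw [← h3, h2]; simp

theorem norm_gradForm_le {z : SymC n} (hz : z ∈ upperHalfSpace n)
    (V W : Matrix (Fin n) (Fin n) ℂ) :
    ‖gradForm z V W‖ ≤ 1 / 2 * (gradSq z V + gradSq z W) := by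
  obtain ⟨A, -, h⟩ := exists_gradForm_eq hz
  have e (V : Matrix (Fin n) (Fin n) ℂ) : gradSq z V =
      4 * ∑ i, ∑ j, ‖(Aᵀ * V * A) i j‖ ^ 2 := by
    rw [gradSq, h]
    simp only [Complex.mul_conj, ← Complex.normSq_eq_norm_sq]
    norm_cast
  rw [h, e, e, norm_mul, ← mul_add, ← Finset.sum_add_distrib]
  have h4 : ‖(4 : ℂ)‖ = 4 := by norm_num
  rw [h4]
  have : ‖∑ i, ∑ j, (Aᵀ * V * A) i j * conj ((Aᵀ * W * A) i j)‖ ≤ 1 / 2 * ∑ i,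
      (∑ j, ‖(Aᵀ * V * A) i j‖ ^ 2 + ∑ j, ‖(Aᵀ * W * A) i j‖ ^ 2) := by
    rw [Finset.mul_sum]
    refine (norm_sum_le _ _).trans (Finset.sum_le_sum fun i _ => (norm_sum_le _ _).trans ?_)
    rw [← Finset.sum_add_distrib, Finset.mul_sum]
    refine Finset.sum_le_sum fun j _ => ?_
    rw [norm_mul, RCLike.norm_conj]
    nlinarith [sq_nonneg (‖(Aᵀ * V * A) i j‖ - ‖(Aᵀ * W * A) i j‖)]
  linarith

theorem gradForm_smul (z : SymC n) (a b : ℂ) (V W : Matrix (Fin n) (Fin n) ℂ) :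
    gradForm z (a • V) (b • W) = a * conj b * gradForm z V W := by
  simp only [gradForm, Matrix.conjTranspose_smul, Matrix.mul_smul, Matrix.smul_mul,
    Matrix.trace_smul, smul_eq_mul]
  simp; ring

theorem gradSq_smul {z : SymC n} (a : ℂ) (V : Matrix (Fin n) (Fin n) ℂ) :
    gradSq z (a • V) = ‖a‖ ^ 2 * gradSq z V := by
  rw [gradSq, gradForm_smul, Complex.mul_conj, Complex.normSq_eq_norm_sq, Complex.re_ofReal_mul,
    gradSq]

/-! ### The form `f = det (Y) ^ β φ` -/

/-- `det (Y) ^ β φ`. -/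
def lift (β : ℝ) (φ : SymC n → ℂ) (z : SymC n) : ℂ := detY β z * φ z

theorem contDiffAt_lift {β : ℝ} {φ : SymC n → ℂ} {z : SymC n} (hz : z ∈ upperHalfSpace n)
    {m : WithTop ℕ∞} (h : ContDiffAt ℝ m φ z) : ContDiffAt ℝ m (lift β φ) z :=
  (contDiffAt_detY β hz).mul h

/-- The logarithmic derivative of det(Y)^β is -β (Z - Z̄)⁻¹, which accounts for the term -β in Λ_β:
that operator is ∂/∂Z̄ conjugated by det(Y)^β. -/
theorem grad_lift {β : ℝ} {φ : SymC n → ℂ} {z : SymC n} (hz : z ∈ upperHalfSpace n)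
    (h : DifferentiableAt ℝ φ z) :
    grad (lift β φ) z = detY β z • (grad φ z - (β * φ z) • (subConj z)⁻¹) := by
  ext l m
  simp only [grad, Matrix.of_apply, dZbar_eq_dW, Matrix.smul_apply, Matrix.sub_apply,
    smul_eq_mul]
  have e : dW Complex.I l m (lift β φ) z = dW Complex.I l m (fun w => detY β w * φ w) z := rfl
  rw [e, dW_mul ((contDiffAt_detY β hz (m := 1)).differentiableAt (by norm_num)) h, dW_detY _ _ _ _ hz,
    Complex.I_mul_I]
  ring

theorem detY_neg_mul (β : ℝ) {z : SymC n} (hz : z ∈ upperHalfSpace n) :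
    detY (-β) z * detY β z = 1 := by
  rw [← detY_add _ _ hz]; simp [detY_zero]

theorem opLambda_scalarMat {β : ℝ} {φ : SymC n → ℂ} {z : SymC n} (hz : z ∈ upperHalfSpace n)
    (h : DifferentiableAt ℝ φ z) :
    opLambda β (scalarMat φ) z = detY (-β) z • (subConj z * grad (lift β φ) z) := by
  rw [grad_lift hz h, Matrix.mul_smul, smul_smul, detY_neg_mul β hz, one_smul, Matrix.mul_sub,
    Matrix.mul_smul, subConj_mul_inv hz, opLambda]
  congr 1
  · congr 1
    ext j k
    simp only [grad, Matrix.of_apply, scalarMat, Matrix.smul_apply, smul_eq_mul]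
    rw [Finset.sum_eq_single k]
    · simp
    · intro q _ hq; simp [hq, dZbar_eq_dW, dW_const]
    · simp
  · simp [scalarMat, smul_smul]

theorem opLambda_eq_zero_iff {β : ℝ} {φ : SymC n → ℂ} {z : SymC n} (hz : z ∈ upperHalfSpace n)
    (h : DifferentiableAt ℝ φ z) :
    opLambda β (scalarMat φ) z = 0 ↔ grad (lift β φ) z = 0 := by
  rw [opLambda_scalarMat hz h, smul_eq_zero_iff_right (left_ne_zero_of_mul_eq_one (detY_neg_mul β hz))]
  constructor
  · intro h0
    have := congrArg ((subConj z)⁻¹ * ·) h0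
    simpa [← Matrix.mul_assoc, subConj_inv_mul hz] using this
  · intro h0; simp [h0]

/-- The same conjugation applied to the flux, so that it becomes a gradient of f. This lets the
product with the conjugate gradient become a square. -/
theorem fluxMat_eq {β : ℝ} {φ : SymC n → ℂ} {z : SymC n} (hz : z ∈ upperHalfSpace n)
    (h : DifferentiableAt ℝ φ z) (j p : Fin n) :
    fluxMat β φ z j p = detY (-β) z * (subConj z * grad (lift β φ) z * subConj z) j p := by
  have : subConj z * grad (lift β φ) z * subConj z =
      detY β z • (subConj z * grad φ z * subConj z - (β * φ z) • subConj z) := by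
    rw [grad_lift hz h, Matrix.mul_smul, Matrix.smul_mul, Matrix.mul_sub, Matrix.sub_mul,
      Matrix.mul_smul, subConj_mul_inv hz, Matrix.smul_mul, Matrix.one_mul]
  rw [this, Matrix.smul_apply, smul_eq_mul, ← mul_assoc, detY_neg_mul β hz, one_mul, fluxMat,
    Matrix.sub_apply, Matrix.smul_apply, smul_eq_mul, mul_assoc (β : ℂ)]
  congr 1
  simp only [Matrix.mul_apply, grad, Matrix.of_apply, Finset.sum_mul]
  rw [Finset.sum_comm]
  exact Finset.sum_congr rfl fun m _ => Finset.sum_congr rfl fun l _ => by ring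

theorem dZ_conj {g : SymC n → ℂ} {z : SymC n} (hg : DifferentiableAt ℝ g z) (j k : Fin n) :
    dZ j k (fun w => conj (g w)) z = conj (dZbar j k g z) := by
  have h : HasFDerivAt (fun w => conj (g w))
      ((Complex.conjCLE : ℂ →L[ℝ] ℂ).comp (fderiv ℝ g z)) z :=
    (Complex.conjCLE : ℂ →L[ℝ] ℂ).hasFDerivAt.comp z hg.hasFDerivAt
  rw [dZ_eq, dZbar_eq, h.fderiv, wirt, wirt]
  simp [Complex.conj_ofNat]

/-- The integrand of the energy identity for the cut-off `χ`. -/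
def energyIdentity (k : ℝ) (μ : ℂ) (f χ : SymC n → ℂ) (z : SymC n) : ℂ :=
  detY k z * (χ z * (μ * (‖f z‖ ^ 2 : ℝ) - gradSq z (grad f z)) -
    conj (f z) * gradForm z (grad f z) (grad χ z))

/-- Product rule for χ f̄ times the weighted flux. As ∂f̄/∂Z is the conjugate of ∂f/∂Z̄,
differentiating f̄ gives -|∂f/∂Z̄|², differentiating χ gives the cross term, and the divergence of
the flux gives μ|f|². The factors 2i from Z - Z̄ square to -4, hence the signs and the 4 in
`gradForm`. -/
theorem sum_dZ_cutoff {α β : ℝ} {l : ℂ} {φ : SymC n → ℂ} {χ : SymC n → ℝ} {z : SymC n}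
    (hz : z ∈ upperHalfSpace n) (hφ : ContDiffAt ℝ 2 φ z)
    (hχ : DifferentiableAt ℝ (fun w => (χ w : ℂ)) z)
    (hl : laplacian α β φ z + l * φ z = 0) :
    ∑ p, ∑ j, dZ p j (fun w => (χ w * conj (lift β φ w)) *
        (detY (α - n - 1) w * fluxMat β φ w j p)) z =
      detY (-n - 1) z * energyIdentity (α - β) (l - n * β * (α - (n + 1) / 2)) (lift β φ)
        (fun w => (χ w : ℂ)) z := by
  have hφ1 : DifferentiableAt ℝ φ z := hφ.differentiableAt (by norm_num)
  have hf : DifferentiableAt ℝ (lift β φ) z :=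
    (contDiffAt_lift hz hφ).differentiableAt (by norm_num)
  have hfc : DifferentiableAt ℝ (fun w => conj (lift β φ w)) z :=
    Complex.conjCLE.differentiableAt.comp z hf
  set f := lift β φ
  set χc : SymC n → ℂ := fun w => (χ w : ℂ)
  have hχc (p j : Fin n) : dZ p j χc z = conj (grad χc z p j) := by
    have := dZ_conj hχ p j
    simpa [χc, grad] using this
  have hR (j p : Fin n) : DifferentiableAt ℝ (fun w => detY (α - n - 1) w * fluxMat β φ w j p) z :=
    ((contDiffAt_detY _ hz).mul (differentiableAt_fluxMat β hφ j p)).differentiableAt (by norm_num)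
  have hχf : DifferentiableAt ℝ (fun w => (χ w : ℂ) * conj (f w)) z := hχ.mul hfc
  have e1 (p j : Fin n) : dZ p j (fun w => (χ w * conj (f w)) *
        (detY (α - n - 1) w * fluxMat β φ w j p)) z =
      (conj (grad χc z p j) * conj (f z) + χ z * conj (grad f z p j)) *
        (detY (α - n - 1) z * fluxMat β φ z j p) +
      (χ z * conj (f z)) * dZ p j (fun w => detY (α - n - 1) w * fluxMat β φ w j p) z := by
    rw [dZ_eq_dW, dW_mul hχf (hR j p), dW_mul hχ hfc, ← dZ_eq_dW, hχc, dZ_conj hf]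
    rfl
  have hY : detY (α - n - 1) z * detY (-β) z = detY (-n - 1) z * detY (α - β) z := by
    rw [← detY_add _ _ hz, ← detY_add _ _ hz]; congr 1; ring
  have hV (V : Matrix (Fin n) (Fin n) ℂ) (hVs : Vᵀ = V) :
      ∑ p, ∑ j, conj (V p j) * (subConj z * grad f z * subConj z) j p =
        -gradForm z (grad f z) V := by
    rw [gradForm, subConj_eq]
    have e : ∑ p, ∑ j, conj (V p j) * (((2 * Complex.I) • toC (imMat z)) * grad f z *
        ((2 * Complex.I) • toC (imMat z))) j p = ((((2 * Complex.I) • toC (imMat z)) * grad f z *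
        ((2 * Complex.I) • toC (imMat z))) * Vᴴ).trace := by
      rw [Matrix.trace, Finset.sum_comm]
      refine Finset.sum_congr rfl fun j _ => ?_
      rw [Matrix.diag_apply, Matrix.mul_apply]
      refine Finset.sum_congr rfl fun p _ => ?_
      rw [Matrix.conjTranspose_apply, mul_comm]
      have : V p j = V j p := congrFun (congrFun hVs j) p
      rw [this]; rfl
    rw [e]
    simp only [Matrix.smul_mul, Matrix.mul_smul, smul_smul, Matrix.trace_smul, smul_eq_mul]
    linear_combination (4 * (toC (imMat z) * grad f z * toC (imMat z) * Vᴴ).trace) *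
      Complex.I_mul_I
  have hdiv := sum_dZ_detY_mul_fluxMat_of_eigen hz hφ hl
  simp only [e1, Finset.sum_add_distrib, ← Finset.mul_sum, hdiv]
  have s1 : ∑ p, ∑ j, (conj (grad χc z p j) * conj (f z) + χ z * conj (grad f z p j)) *
        (detY (α - n - 1) z * fluxMat β φ z j p) =
      detY (-n - 1) z * detY (α - β) z * (conj (f z) * -gradForm z (grad f z) (grad χc z) +
        χ z * -gradForm z (grad f z) (grad f z)) := by
    rw [← hV _ (grad_transpose _ _), ← hV _ (grad_transpose _ _), ← hY]
    simp only [Finset.mul_sum, ← Finset.sum_add_distrib]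
    refine Finset.sum_congr rfl fun p _ => Finset.sum_congr rfl fun j _ => ?_
    rw [fluxMat_eq hz hφ1]
    ring
  have s2 : detY (α - n - 1) z * φ z * conj (f z) =
      detY (-n - 1) z * detY (α - β) z * (‖f z‖ ^ 2 : ℝ) := by
    have h1 : φ z = detY (-β) z * f z := by
      simp only [f, lift]; rw [← mul_assoc, detY_neg_mul β hz, one_mul]
    have h2 : ((‖f z‖ ^ 2 : ℝ) : ℂ) = f z * conj (f z) := by
      rw [Complex.mul_conj, Complex.normSq_eq_norm_sq]
    rw [h2, h1]
    linear_combination f z * conj (f z) * hY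
  rw [s1, energyIdentity, gradForm_self hz]
  linear_combination (χ z * (l - n * β * (α - (n + 1) / 2))) * s2

end SiegelMaass
end

/-! ### The averaged energy identity -/

noncomputable section

namespace SiegelMaass

/-! ### Unfolding over two variables -/

open scoped Pointwise

section Unfolding

variable {G X : Type*} [Group G] [MulAction G X] [MeasurableSpace X] {ν : Measure X} {F : Set X}

/-- For the diagonal action a fundamental domain may be imposed on either coordinate alone.
Comparing the two choices is the exchange of variables below. -/
theorem isFundamentalDomain_prod_univ (hF : IsFundamentalDomain G F ν) :
    IsFundamentalDomain G (F ×ˢ (Set.univ : Set X)) (ν.prod ν) where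
  nullMeasurableSet := hF.nullMeasurableSet.prod nullMeasurableSet_univ
  ae_covers := by
    have := Measure.quasiMeasurePreserving_fst (μ := ν) (ν := ν) |>.ae hF.ae_covers
    filter_upwards [this] with p ⟨g, hg⟩
    exact ⟨g, by simpa using hg⟩
  aedisjoint := by
    have := hF.aedisjoint
    intro g h hgh
    have h1 := this hgh
    have e (g : G) : g • (F ×ˢ (Set.univ : Set X)) = Prod.fst ⁻¹' (g • F) := by
      ext p; simp [Set.mem_smul_set_iff_inv_smul_mem]
    simp only [Function.onFun, e]
    exact h1.preimage Measure.quasiMeasurePreserving_fst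

theorem isFundamentalDomain_univ_prod (hF : IsFundamentalDomain G F ν) :
    IsFundamentalDomain G ((Set.univ : Set X) ×ˢ F) (ν.prod ν) where
  nullMeasurableSet := nullMeasurableSet_univ.prod hF.nullMeasurableSet
  ae_covers := by
    have := Measure.quasiMeasurePreserving_snd (μ := ν) (ν := ν) |>.ae hF.ae_covers
    filter_upwards [this] with p ⟨g, hg⟩
    exact ⟨g, by simpa using hg⟩
  aedisjoint := by
    have := hF.aedisjoint
    intro g h hgh
    have h1 := this hgh
    have e (g : G) : g • ((Set.univ : Set X) ×ˢ F) = Prod.snd ⁻¹' (g • F) := by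
      ext p; simp [Set.mem_smul_set_iff_inv_smul_mem]
    simp only [Function.onFun, e]
    exact h1.preimage Measure.quasiMeasurePreserving_snd

variable [Countable G] [SigmaFinite ν] [MeasurableConstSMul G X] [SMulInvariantMeasure G X ν]

instance measurableConstSMul_prod : MeasurableConstSMul G (X × X) where
  measurable_const_smul g :=
    ((measurable_const_smul g).comp measurable_fst).prodMk
      ((measurable_const_smul g).comp measurable_snd)

instance smulInvariantMeasure_prod : SMulInvariantMeasure G (X × X) (ν.prod ν) where
  measure_preimage_smul g s hs := by
    have h := MeasureTheory.measurePreserving_smul g ν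
    exact (h.prod h).measure_preimage hs.nullMeasurableSet

/-- Both sides integrate the same invariant function over two fundamental domains F × X and X × F of
the diagonal action. -/
theorem lintegral_unfold_swap (hF : IsFundamentalDomain G F ν) {A : X → X → ENNReal}
    (hA : Measurable (Function.uncurry A)) (hinv : ∀ (g : G) z w, A (g • z) (g • w) = A z w) :
    ∫⁻ z in F, ∫⁻ w, A z w ∂ν ∂ν = ∫⁻ w in F, ∫⁻ z, A z w ∂ν ∂ν := by
  have h1 := (isFundamentalDomain_prod_univ hF).setLIntegral_eq
    (isFundamentalDomain_univ_prod hF) (Function.uncurry A) (fun g p => hinv g p.1 p.2)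
  rw [← Measure.prod_restrict, ← Measure.prod_restrict, Measure.restrict_univ] at h1
  rw [lintegral_prod _ hA.aemeasurable, lintegral_prod_symm _ hA.aemeasurable] at h1
  exact h1

theorem integral_unfold_swap (hF : IsFundamentalDomain G F ν) {A : X → X → ℂ}
    (hA : Measurable (Function.uncurry A)) (hinv : ∀ (g : G) z w, A (g • z) (g • w) = A z w)
    (hfin : ∫⁻ z in F, ∫⁻ w, ‖A z w‖ₑ ∂ν ∂ν < ⊤) :
    ∫ z in F, ∫ w, A z w ∂ν ∂ν = ∫ w in F, ∫ z, A z w ∂ν ∂ν := by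
  have h1 := (isFundamentalDomain_prod_univ hF).setIntegral_eq
    (isFundamentalDomain_univ_prod hF) (f := Function.uncurry A) (fun g p => hinv g p.1 p.2)
  rw [← Measure.prod_restrict, ← Measure.prod_restrict, Measure.restrict_univ] at h1
  have i1 : Integrable (Function.uncurry A) ((ν.restrict F).prod ν) := by
    refine ⟨hA.aestronglyMeasurable, ?_⟩
    rw [HasFiniteIntegral, lintegral_prod _ hA.enorm.aemeasurable]
    exact hfin
  have i2 : Integrable (Function.uncurry A) (ν.prod (ν.restrict F)) := by
    refine ⟨hA.aestronglyMeasurable, ?_⟩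
    rw [HasFiniteIntegral, lintegral_prod_symm _ hA.enorm.aemeasurable]
    have := lintegral_unfold_swap hF (A := fun z w => ‖A z w‖ₑ) hA.enorm
      (fun g z w => by rw [hinv])
    exact this ▸ hfin
  rw [integral_prod _ i1, integral_prod_symm _ i2] at h1
  exact h1

/-- Averaging a localized energy identity over the cut-off: if
`∫ κ(z,w) (μ Φ(z) - E(z)) dz = ∫ B(z,w) dz` for every `w`, where the error term is controlled by
`κ E` and `N Φ` and `∫ B(z,w) dw = 0`, then `μ ∫ Φ = ∫ E` over a fundamental domain. -/
theorem energy_balance (hF : IsFundamentalDomain G F ν) {Φ E : X → ℝ} {κ N : X → X → ℝ}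
    {B : X → X → ℂ} {μ : ℂ} {c c' : ℝ} (hc : 0 < c)
    (hΦ : Measurable Φ) (hE : Measurable E) (hκ : Measurable (Function.uncurry κ))
    (hN : Measurable (Function.uncurry N)) (hB : Measurable (Function.uncurry B))
    (hΦ0 : ∀ z, 0 ≤ Φ z) (hE0 : ∀ z, 0 ≤ E z) (hκ0 : ∀ z w, 0 ≤ κ z w) (hN0 : ∀ z w, 0 ≤ N z w)
    (iΦ : ∀ (g : G) z, Φ (g • z) = Φ z) (iE : ∀ (g : G) z, E (g • z) = E z)
    (iκ : ∀ (g : G) z w, κ (g • z) (g • w) = κ z w)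
    (iN : ∀ (g : G) z w, N (g • z) (g • w) = N z w)
    (iB : ∀ (g : G) z w, B (g • z) (g • w) = B z w)
    (tκ : ∀ z, ∫⁻ w, ENNReal.ofReal (κ z w) ∂ν = ENNReal.ofReal c)
    (tN : ∀ z, ∫⁻ w, ENNReal.ofReal (N z w) ∂ν ≤ ENNReal.ofReal c')
    (tB : ∀ z, ∫ w, B z w ∂ν = 0)
    (bB : ∀ z w, ‖B z w‖ ≤ 1 / 2 * (κ z w * E z) + 2 * (N z w * Φ z))
    (fΦ : ∀ w, Integrable (fun z => κ z w * Φ z) ν)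
    (fE : ∀ w, Integrable (fun z => κ z w * E z) ν)
    (fN : ∀ w, Integrable (fun z => N z w * Φ z) ν)
    (hid : ∀ w, ∫ z, (κ z w * (μ * Φ z - E z) - B z w : ℂ) ∂ν = 0)
    (fin : ∫⁻ z in F, ENNReal.ofReal (Φ z) ∂ν < ⊤) :
    IntegrableOn E F ν ∧ μ * (∫ z in F, Φ z ∂ν : ℝ) = (∫ z in F, E z ∂ν : ℝ) := by
  have mB (w : X) : Measurable fun z => B z w := hB.comp (measurable_id.prodMk measurable_const)
  have fB (w : X) : Integrable (fun z => B z w) ν :=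
    (((fE w).const_mul (1 / 2)).add ((fN w).const_mul 2)).mono' (mB w).aestronglyMeasurable
      (.of_forall fun z => bB z w)
  have m2 : Measurable fun p : X × X => κ p.1 p.2 := hκ
  have mN2 : Measurable fun p : X × X => N p.1 p.2 := hN
  have mB2 : Measurable fun p : X × X => B p.1 p.2 := hB
  have m1 (u : X → ℝ) (hu : Measurable u) : Measurable fun p : X × X => u p.1 :=
    hu.comp measurable_fst
  -- Caccioppoli estimate: half of the local energy in the bound for `B` is absorbed on the left,
  -- which doubles the remaining constants.
  have cacc (w : X) : ∫ z, κ z w * E z ∂ν ≤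
      2 * ‖μ‖ * ∫ z, κ z w * Φ z ∂ν + 4 * ∫ z, N z w * Φ z ∂ν := by
    have e : (fun z => (κ z w * (μ * Φ z - E z) - B z w : ℂ)) =
        fun z => (μ * (κ z w * Φ z : ℝ) - (κ z w * E z : ℝ)) - B z w := by
      funext z; push_cast; ring
    have h1 := hid w
    have i1 : Integrable (fun z => μ * (κ z w * Φ z : ℝ) - (κ z w * E z : ℝ) : X → ℂ) ν :=
      ((fΦ w).ofReal.const_mul μ).sub (fE w).ofReal
    have i2 : Integrable (fun z => ((κ z w * Φ z : ℝ) : ℂ)) ν := (fΦ w).ofReal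
    have i3 : Integrable (fun z => ((κ z w * E z : ℝ) : ℂ)) ν := (fE w).ofReal
    rw [e, integral_sub i1 (fB w), integral_sub (i2.const_mul μ) i3, integral_const_mul,
      integral_complex_ofReal, integral_complex_ofReal] at h1
    have h2 : ((∫ z, κ z w * E z ∂ν : ℝ) : ℂ) =
        μ * (∫ z, κ z w * Φ z ∂ν : ℝ) - ∫ z, B z w ∂ν := by linear_combination -h1
    have h3 := congrArg norm h2
    have p1 : 0 ≤ ∫ z, κ z w * E z ∂ν := integral_nonneg fun z => mul_nonneg (hκ0 z w) (hE0 z)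
    have p2 : 0 ≤ ∫ z, κ z w * Φ z ∂ν := integral_nonneg fun z => mul_nonneg (hκ0 z w) (hΦ0 z)
    rw [Complex.norm_of_nonneg p1] at h3
    have h4 := norm_sub_le (μ * ((∫ z, κ z w * Φ z ∂ν : ℝ) : ℂ)) (∫ z, B z w ∂ν)
    rw [norm_mul, Complex.norm_of_nonneg p2] at h4
    have h5 : ‖∫ z, B z w ∂ν‖ ≤ 1 / 2 * ∫ z, κ z w * E z ∂ν + 2 * ∫ z, N z w * Φ z ∂ν := by
      rw [← integral_const_mul, ← integral_const_mul,
        ← integral_add ((fE w).const_mul _) ((fN w).const_mul _)]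
      exact norm_integral_le_of_norm_le (((fE w).const_mul _).add ((fN w).const_mul _))
        (.of_forall fun z => bB z w)
    linarith
  have cacc' (w : X) : ∫⁻ z, ENNReal.ofReal (κ z w * E z) ∂ν ≤
      ENNReal.ofReal (2 * ‖μ‖) * ∫⁻ z, ENNReal.ofReal (κ z w * Φ z) ∂ν +
        4 * ∫⁻ z, ENNReal.ofReal (N z w * Φ z) ∂ν := by
    have q1 (z : X) : 0 ≤ κ z w * E z := mul_nonneg (hκ0 z w) (hE0 z)
    have q2 (z : X) : 0 ≤ κ z w * Φ z := mul_nonneg (hκ0 z w) (hΦ0 z)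
    have q3 (z : X) : 0 ≤ N z w * Φ z := mul_nonneg (hN0 z w) (hΦ0 z)
    rw [← ofReal_integral_eq_lintegral_ofReal (fE w) (.of_forall q1),
      ← ofReal_integral_eq_lintegral_ofReal (fΦ w) (.of_forall q2),
      ← ofReal_integral_eq_lintegral_ofReal (fN w) (.of_forall q3)]
    have h4 : (4 : ENNReal) = ENNReal.ofReal 4 := by norm_num
    rw [h4, ← ENNReal.ofReal_mul (by positivity), ← ENNReal.ofReal_mul (by positivity),
      ← ENNReal.ofReal_add (mul_nonneg (by positivity) (integral_nonneg q2))
        (mul_nonneg (by positivity) (integral_nonneg q3))]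
    exact ENNReal.ofReal_le_ofReal (cacc w)
  -- After the exchange the kernel is integrated over all w, which leaves its total mass as a
  -- factor.
  have unf (u : X → ℝ) (hu : Measurable u) (iu : ∀ (g : G) z, u (g • z) = u z) (M : X → X → ℝ)
      (hM : Measurable (Function.uncurry M)) (hM0 : ∀ z w, 0 ≤ M z w)
      (iM : ∀ (g : G) z w, M (g • z) (g • w) = M z w) :
      ∫⁻ w in F, ∫⁻ z, ENNReal.ofReal (M z w * u z) ∂ν ∂ν =
        ∫⁻ z in F, (∫⁻ w, ENNReal.ofReal (M z w) ∂ν) * ENNReal.ofReal (u z) ∂ν := by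
    have mM : Measurable fun p : X × X => M p.1 p.2 := hM
    rw [← lintegral_unfold_swap hF (A := fun z w => ENNReal.ofReal (M z w * u z))]
    · refine lintegral_congr fun z => ?_
      simp only [ENNReal.ofReal_mul (hM0 z _)]
      rw [lintegral_mul_const]
      exact (mM.comp (measurable_const.prodMk measurable_id)).ennreal_ofReal
    · exact (mM.mul (m1 u hu)).ennreal_ofReal
    · intro g z w; rw [iM, iu]
  -- The local estimates integrated over w in `F` bound the total energy by the norm. This comes
  -- before the identity itself, since Fubini for the signed integrand needs finite energy.
  have kE : ENNReal.ofReal c * ∫⁻ z in F, ENNReal.ofReal (E z) ∂ν < ⊤ := by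
    have h1 := unf E hE iE κ hκ hκ0 iκ
    have h2 := unf Φ hΦ iΦ κ hκ hκ0 iκ
    have h3 := unf Φ hΦ iΦ N hN hN0 iN
    simp only [tκ] at h1 h2
    rw [lintegral_const_mul _ hE.ennreal_ofReal] at h1
    rw [lintegral_const_mul _ hΦ.ennreal_ofReal] at h2
    rw [← h1]
    have h4 : ∫⁻ w in F, ∫⁻ z, ENNReal.ofReal (N z w * Φ z) ∂ν ∂ν < ⊤ := by
      rw [h3]
      refine (lintegral_mono fun z => mul_le_mul_left (tN z) _).trans_lt ?_
      rw [lintegral_const_mul _ hΦ.ennreal_ofReal]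
      exact ENNReal.mul_lt_top ENNReal.ofReal_lt_top fin
    have h5 : ∫⁻ w in F, ∫⁻ z, ENNReal.ofReal (κ z w * Φ z) ∂ν ∂ν < ⊤ := by
      rw [h2]; exact ENNReal.mul_lt_top ENNReal.ofReal_lt_top fin
    refine (lintegral_mono fun w => cacc' w).trans_lt ?_
    have mm : Measurable fun w => ∫⁻ z, ENNReal.ofReal (κ z w * Φ z) ∂ν :=
      Measurable.lintegral_prod_left' (m2.mul (m1 Φ hΦ)).ennreal_ofReal
    rw [lintegral_add_left (mm.const_mul _), lintegral_const_mul' _ _ ENNReal.ofReal_ne_top,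
      lintegral_const_mul' _ _ (by norm_num)]
    exact ENNReal.add_lt_top.mpr ⟨ENNReal.mul_lt_top ENNReal.ofReal_lt_top h5,
      ENNReal.mul_lt_top (by norm_num) h4⟩
  have finE : ∫⁻ z in F, ENNReal.ofReal (E z) ∂ν < ⊤ := by
    by_contra h
    rw [not_lt_top_iff] at h
    rw [h, ENNReal.mul_top (by simpa using hc)] at kE
    exact lt_irrefl _ kE
  have intE : IntegrableOn E F ν := by
    refine ⟨hE.aestronglyMeasurable, ?_⟩
    rw [hasFiniteIntegral_iff_ofReal (.of_forall hE0)]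
    exact finE
  have intΦ : IntegrableOn Φ F ν := by
    refine ⟨hΦ.aestronglyMeasurable, ?_⟩
    rw [hasFiniteIntegral_iff_ofReal (.of_forall hΦ0)]
    exact fin
  refine ⟨intE, ?_⟩
  set A : X → X → ℂ := fun z w => κ z w * (μ * Φ z - E z) - B z w with hA
  have mA : Measurable (Function.uncurry A) := by
    refine Measurable.sub (Measurable.mul (Complex.measurable_ofReal.comp m2) (Measurable.sub ?_ ?_))
      mB2
    · exact measurable_const.mul (Complex.measurable_ofReal.comp (m1 Φ hΦ))
    · exact Complex.measurable_ofReal.comp (m1 E hE)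
  have bA (z w : X) : ‖A z w‖ ≤ κ z w * (‖μ‖ * Φ z + 2 * E z) + N z w * (2 * Φ z) := by
    have h1 : ‖(κ z w : ℂ) * (μ * Φ z - E z)‖ ≤ κ z w * (‖μ‖ * Φ z + E z) := by
      rw [norm_mul, Complex.norm_of_nonneg (hκ0 z w)]
      refine mul_le_mul_of_nonneg_left ((norm_sub_le _ _).trans ?_) (hκ0 z w)
      rw [norm_mul, Complex.norm_of_nonneg (hΦ0 z), Complex.norm_of_nonneg (hE0 z)]
    have h2 := (norm_sub_le ((κ z w : ℂ) * (μ * Φ z - E z)) (B z w)).trans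
      (add_le_add h1 (bB z w))
    refine h2.trans ?_
    nlinarith [mul_nonneg (hκ0 z w) (hE0 z)]
  have finA : ∫⁻ z in F, ∫⁻ w, ‖A z w‖ₑ ∂ν ∂ν < ⊤ := by
    have h1 (z : X) : ∫⁻ w, ‖A z w‖ₑ ∂ν ≤
        ENNReal.ofReal c * ENNReal.ofReal (‖μ‖ * Φ z + 2 * E z) +
          ENNReal.ofReal c' * ENNReal.ofReal (2 * Φ z) := by
      have h2 (w : X) : ‖A z w‖ₑ ≤ ENNReal.ofReal (κ z w) * ENNReal.ofReal (‖μ‖ * Φ z + 2 * E z) +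
          ENNReal.ofReal (N z w) * ENNReal.ofReal (2 * Φ z) := by
        rw [← ENNReal.ofReal_mul (hκ0 z w), ← ENNReal.ofReal_mul (hN0 z w), ← ofReal_norm,
          ← ENNReal.ofReal_add]
        · exact ENNReal.ofReal_le_ofReal (bA z w)
        · have := hΦ0 z; have := hE0 z; have := hκ0 z w; positivity
        · have := hΦ0 z; have := hN0 z w; positivity
      refine (lintegral_mono h2).trans ?_
      have m3 : Measurable fun w => ENNReal.ofReal (κ z w) :=
        (m2.comp (measurable_const.prodMk measurable_id)).ennreal_ofReal
      have m4 : Measurable fun w => ENNReal.ofReal (N z w) :=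
        (mN2.comp (measurable_const.prodMk measurable_id)).ennreal_ofReal
      rw [lintegral_add_left (m3.mul_const _), lintegral_mul_const _ m3, lintegral_mul_const _ m4,
        tκ]
      gcongr
      exact tN z
    refine (lintegral_mono h1).trans_lt ?_
    have m5 : Measurable fun z => ENNReal.ofReal (‖μ‖ * Φ z + 2 * E z) :=
      ((hΦ.const_mul _).add (hE.const_mul _)).ennreal_ofReal
    rw [lintegral_add_left (m5.const_mul _), lintegral_const_mul _ m5,
      lintegral_const_mul _ (hΦ.const_mul _).ennreal_ofReal]
    refine ENNReal.add_lt_top.mpr ⟨ENNReal.mul_lt_top ENNReal.ofReal_lt_top ?_,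
      ENNReal.mul_lt_top ENNReal.ofReal_lt_top ?_⟩
    · have i1 := (intΦ.const_mul ‖μ‖).add (intE.const_mul 2)
      exact (hasFiniteIntegral_iff_ofReal (.of_forall fun z => by
        have := hΦ0 z; have := hE0 z; positivity)).mp i1.2
    · have i1 := (intΦ.const_mul 2)
      exact (hasFiniteIntegral_iff_ofReal (.of_forall fun z => by
        have := hΦ0 z; positivity)).mp i1.2
  have hsw := integral_unfold_swap hF mA (fun g z w => by simp only [hA, iκ, iΦ, iE, iB]) finA
  -- One order of integration vanishes by the local identities; in the other the inner integral is
  -- evaluated by the total masses of κ and B.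
  have r0 : ∫ w in F, ∫ z, A z w ∂ν ∂ν = 0 := by simp only [hA, hid, integral_zero]
  have r1 (z : X) : ∫ w, A z w ∂ν = c * (μ * Φ z - E z) := by
    have m3 : Measurable fun w => κ z w := m2.comp (measurable_const.prodMk measurable_id)
    have m4 : Measurable fun w => N z w := mN2.comp (measurable_const.prodMk measurable_id)
    have m5 : Measurable fun w => B z w := mB2.comp (measurable_const.prodMk measurable_id)
    have i3 : Integrable (fun w => κ z w) ν := by
      refine ⟨m3.aestronglyMeasurable, ?_⟩
      rw [hasFiniteIntegral_iff_ofReal (.of_forall fun w => hκ0 z w), tκ]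
      exact ENNReal.ofReal_lt_top
    have i4 : Integrable (fun w => N z w) ν := by
      refine ⟨m4.aestronglyMeasurable, ?_⟩
      rw [hasFiniteIntegral_iff_ofReal (.of_forall fun w => hN0 z w)]
      exact (tN z).trans_lt ENNReal.ofReal_lt_top
    have i5 : Integrable (fun w => B z w) ν :=
      (((i3.mul_const (E z)).const_mul (1 / 2)).add ((i4.mul_const (Φ z)).const_mul 2)).mono'
        m5.aestronglyMeasurable (.of_forall fun w => bB z w)
    have e3 : ∫ w, κ z w ∂ν = c := by
      rw [integral_eq_lintegral_of_nonneg_ae (.of_forall fun w => hκ0 z w)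
        m3.aestronglyMeasurable, tκ, ENNReal.toReal_ofReal hc.le]
    have i6 : Integrable (fun w => (κ z w : ℂ) * (μ * Φ z - E z)) ν := i3.ofReal.mul_const _
    simp only [hA]
    rw [integral_sub i6 i5, tB, sub_zero, integral_mul_const,
      integral_complex_ofReal, e3]
  simp only [r1] at hsw
  have i2 : Integrable (fun z => (Φ z : ℂ)) (ν.restrict F) := intΦ.ofReal
  have i3 : Integrable (fun z => (E z : ℂ)) (ν.restrict F) := intE.ofReal
  rw [r0, integral_const_mul, integral_sub (i2.const_mul μ) i3,
    integral_const_mul, integral_complex_ofReal, integral_complex_ofReal] at hsw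
  have hc' : (c : ℂ) ≠ 0 := by exact_mod_cast hc.ne'
  exact sub_eq_zero.mp ((mul_eq_zero.mp hsw).resolve_left hc')

end Unfolding

end SiegelMaass
end

noncomputable section

namespace SiegelMaass

open scoped Topology

variable {n : ℕ}

/-! ### Integration by parts -/

theorem integral_fderiv_apply_eq_zero {G : SymC n → ℂ} (hG : ContDiff ℝ 1 G)
    (hc : HasCompactSupport G) (v : SymC n) : ∫ z, fderiv ℝ G z v = 0 := by
  have h1 : Continuous fun z => fderiv ℝ G z v :=
    (hG.continuous_fderiv (by norm_num)).clm_apply continuous_const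
  have h2 : HasCompactSupport fun z => fderiv ℝ G z v := hc.fderiv_apply ℝ v
  have h3 := integral_mul_fderiv_eq_neg_fderiv_mul_of_integrable (μ := (volume : Measure (SymC n)))
    (f := fun _ => (1 : ℂ)) (g := G) (v := v) (by simp)
    (by simpa using h1.integrable_of_hasCompactSupport h2)
    (by simpa using hG.continuous.integrable_of_hasCompactSupport hc)
    (fun x _ => by fun_prop) (fun x _ => hG.differentiable (by norm_num) x)
  simpa using h3

theorem continuous_dW {s : ℂ} {j k : Fin n} {G : SymC n → ℂ} (hG : ContDiff ℝ 1 G) :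
    Continuous (dW s j k G) := by
  have h1 (v : SymC n) : Continuous fun z => fderiv ℝ G z v :=
    (hG.continuous_fderiv (by norm_num)).clm_apply continuous_const
  unfold dW wirt
  exact continuous_const.mul ((h1 _).add (continuous_const.mul (h1 _)))

theorem hasCompactSupport_dW {s : ℂ} {j k : Fin n} {G : SymC n → ℂ} (hc : HasCompactSupport G) :
    HasCompactSupport (dW s j k G) := by
  have h2 (v : SymC n) : HasCompactSupport fun z => fderiv ℝ G z v := hc.fderiv_apply ℝ v
  have h3 : HasCompactSupport ((fun z => fderiv ℝ G z (eDir j k)) +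
      (fun _ => s) * fun z => fderiv ℝ G z (Complex.I • eDir j k)) :=
    (h2 _).add (HasCompactSupport.mul_left (h2 _))
  exact HasCompactSupport.mul_left (f := fun _ => (1 / 2 : ℂ)) h3

theorem integral_dW_eq_zero {s : ℂ} {j k : Fin n} {G : SymC n → ℂ} (hG : ContDiff ℝ 1 G)
    (hc : HasCompactSupport G) : ∫ z, dW s j k G z = 0 := by
  have h1 (v : SymC n) : Integrable fun z => fderiv ℝ G z v :=
    ((hG.continuous_fderiv (by norm_num)).clm_apply
      continuous_const).integrable_of_hasCompactSupport (hc.fderiv_apply ℝ v)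
  unfold dW wirt
  rw [integral_const_mul, integral_add (h1 _) ((h1 _).const_mul s), integral_const_mul,
    integral_fderiv_apply_eq_zero hG hc, integral_fderiv_apply_eq_zero hG hc]
  simp

theorem integral_halfMeasure (u : SymC n → ℂ) :
    ∫ z : Half n, u z ∂halfMeasure n = ∫ z in upperHalfSpace n, detY (-n - 1) z * u z := by
  have hH := measurableSet_upperHalfSpace (n := n)
  rw [← (MeasurableEmbedding.subtype_coe hH).integral_map (μ := halfMeasure n) u,
    map_halfMeasure, siegelMeasure, integral_withDensity_eq_integral_toReal_smul₀]
  · refine setIntegral_congr_fun hH fun z hz => ?_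
    have hp := det_imMat_pos hz
    have e : (-n - 1 : ℝ) = -((n + 1 : ℕ) : ℝ) := by push_cast; ring
    rw [ENNReal.toReal_ofReal (by positivity), Complex.real_smul, detY, e, Real.rpow_neg hp.le,
      Real.rpow_natCast]
  · exact ((measurable_det_imMat.pow_const _).inv).ennreal_ofReal.aemeasurable
  · exact .of_forall fun z => ENNReal.ofReal_lt_top

/-- Functions which are regular on the half-space, times a cut-off. -/
theorem contDiff_cutoff_mul {χ : SymC n → ℝ} {u : SymC n → ℂ} (hχ : ContDiff ℝ 1 χ)
    (hs : tsupport χ ⊆ upperHalfSpace n) (hu : ∀ z ∈ upperHalfSpace n, ContDiffAt ℝ 1 u z) :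
    ContDiff ℝ 1 fun z => (χ z : ℂ) * u z := by
  rw [contDiff_iff_contDiffAt]
  intro z
  by_cases hz : z ∈ tsupport χ
  · exact (Complex.ofRealCLM.contDiff.contDiffAt.comp z hχ.contDiffAt).mul (hu z (hs hz))
  · have h1 : (fun z => (χ z : ℂ) * u z) =ᶠ[𝓝 z] fun _ => 0 := by
      filter_upwards [notMem_tsupport_iff_eventuallyEq.mp hz] with w hw
      simp [hw]
    exact contDiffAt_const.congr_of_eventuallyEq h1

/-- The density det(Y)^(-n-1) of the invariant measure is the factor split off in `sum_dZ_cutoff`,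
so the integrand is a sum of Euclidean derivatives of compactly supported functions. -/
theorem integral_energyIdentity {α β : ℝ} {l : ℂ} {φ : SymC n → ℂ} {χ : SymC n → ℝ}
    (hφ : ∀ z ∈ upperHalfSpace n, ContDiffAt ℝ 2 φ z) (hχ : ContDiff ℝ 1 χ)
    (hc : HasCompactSupport χ) (hs : tsupport χ ⊆ upperHalfSpace n)
    (hl : ∀ z ∈ upperHalfSpace n, laplacian α β φ z + l * φ z = 0) :
    ∫ z : Half n, energyIdentity (α - β) (l - n * β * (α - (n + 1) / 2)) (lift β φ)
      (fun w => (χ w : ℂ)) z ∂halfMeasure n = 0 := by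
  set G : Fin n → Fin n → SymC n → ℂ := fun p j w => (χ w * conj (lift β φ w)) *
        (detY (α - n - 1) w * fluxMat β φ w j p) with hG
  have e (p j : Fin n) : G p j = fun w => (χ w : ℂ) * (conj (lift β φ w) *
        (detY (α - n - 1) w * fluxMat β φ w j p)) := by
    funext w; simp only [hG]; ring
  have hGd (p j : Fin n) : ContDiff ℝ 1 (G p j) := by
    rw [e]
    refine contDiff_cutoff_mul hχ hs fun z hz => ?_
    have h1 : ContDiffAt ℝ 1 (lift β φ) z :=
      (contDiffAt_lift hz (hφ z hz)).of_le (by norm_num)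
    exact (Complex.conjCLE.contDiff.contDiffAt.comp z h1).mul
      ((contDiffAt_detY _ hz).mul (differentiableAt_fluxMat β (hφ z hz) j p))
  have hts (p j : Fin n) : tsupport (G p j) ⊆ tsupport χ := by
    rw [e]
    refine closure_mono fun z hz => ?_
    rw [Function.mem_support] at hz ⊢
    intro h0; simp [h0] at hz
  have hGc (p j : Fin n) : HasCompactSupport (G p j) :=
    hc.of_isClosed_subset (isClosed_tsupport _) (hts p j)
  rw [integral_halfMeasure]
  have h1 : ∫ z in upperHalfSpace n, ∑ p, ∑ j, dZ p j (G p j) z = 0 := by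
    rw [dZ_eq_dW, setIntegral_eq_integral_of_forall_compl_eq_zero]
    · have hi (p j : Fin n) : Integrable (dW (-Complex.I) p j (G p j)) :=
        (continuous_dW (hGd p j)).integrable_of_hasCompactSupport (hasCompactSupport_dW (hGc p j))
      rw [integral_finsetSum _ fun p _ => integrable_finsetSum _ fun j _ => hi p j]
      refine Finset.sum_eq_zero fun p _ => ?_
      rw [integral_finsetSum _ fun j _ => hi p j]
      exact Finset.sum_eq_zero fun j _ => integral_dW_eq_zero (hGd p j) (hGc p j)
    · intro z hz
      refine Finset.sum_eq_zero fun p _ => Finset.sum_eq_zero fun j _ => ?_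
      have h2 : z ∉ tsupport (G p j) := fun h => hz (hs (hts p j h))
      rw [dW_congr (notMem_tsupport_iff_eventuallyEq.mp h2)]
      exact dW_const 0
  rw [← h1]
  refine setIntegral_congr_fun measurableSet_upperHalfSpace fun z hz => ?_
  refine (sum_dZ_cutoff hz (hφ z hz) ?_ (hl z hz)).symm
  exact (Complex.ofRealCLM.contDiff.comp hχ).differentiable (by norm_num) z

/-! ### Compact sets in the half-space -/

instance : IsFiniteMeasureOnCompacts (halfMeasure n) where
  lt_top_of_isCompact K hK := by
    have hH := measurableSet_upperHalfSpace (n := n)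
    have hK' : IsCompact (Subtype.val '' K) := hK.image continuous_subtype_val
    have hsub : Subtype.val '' K ⊆ upperHalfSpace n := by rintro _ ⟨z, -, rfl⟩; exact z.2
    rw [halfMeasure, (MeasurableEmbedding.subtype_coe hH).comap_apply, siegelMeasure,
      withDensity_apply _ hK'.measurableSet, Measure.restrict_restrict hK'.measurableSet,
      Set.inter_eq_left.mpr hsub]
    have hcont : ContinuousOn (fun z : SymC n => ((imMat z).det ^ (n + 1))⁻¹)
        (Subtype.val '' K) := by
      have := contDiff_det_imMat (n := n) |>.continuous
      exact ContinuousOn.inv₀ (this.pow (n + 1)).continuousOn fun z hz => (pow_pos (det_imMat_pos (hsub hz)) _).ne'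
    exact IntegrableOn.setLIntegral_lt_top (hcont.integrableOn_compact hK')

instance : LocallyCompactSpace (Half n) := (isOpen_upperHalfSpace n).locallyCompactSpace

instance : ContinuousConstSMul (SpR n) (Half n) := ⟨continuous_smul_half⟩

instance : SigmaFinite (halfMeasure n) := inferInstance

theorem continuous_of_contDiffAt {E : Type*} [NormedAddCommGroup E] [NormedSpace ℝ E]
    {u : SymC n → E}
    (hu : ∀ z ∈ upperHalfSpace n, ContinuousAt u z) : Continuous fun z : Half n => u z :=
  continuous_iff_continuousAt.mpr fun z => (hu z z.2).comp continuous_subtype_val.continuousAt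

theorem isCompact_preimage_coe {C : Set (SymC n)} (hC : IsCompact C)
    (hs : C ⊆ upperHalfSpace n) : IsCompact (Subtype.val ⁻¹' C : Set (Half n)) := by
  rw [Subtype.isCompact_iff, Subtype.image_preimage_coe, Set.inter_eq_right.mpr hs]
  exact hC

end SiegelMaass
end

noncomputable section

namespace SiegelMaass

open scoped Topology

variable {n : ℕ}

/-! ### An invariant cut-off -/

section ContDiffMatrix

variable {E : Type*} [NormedAddCommGroup E] [NormedSpace ℝ E] {m : WithTop ℕ∞} {x : E}
  {ι : Type*} [Fintype ι] {M N : E → Matrix ι ι ℝ}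

theorem contDiffAt_matrix_mul (hM : ∀ i j, ContDiffAt ℝ m (fun x => M x i j) x)
    (hN : ∀ i j, ContDiffAt ℝ m (fun x => N x i j) x) (i j : ι) :
    ContDiffAt ℝ m (fun x => (M x * N x) i j) x := by
  simp only [Matrix.mul_apply]
  exact ContDiffAt.sum fun k _ => (hM i k).mul (hN k j)

variable [DecidableEq ι]

theorem contDiffAt_matrix_det (hM : ∀ i j, ContDiffAt ℝ m (fun x => M x i j) x) :
    ContDiffAt ℝ m (fun x => (M x).det) x := by
  simp only [Matrix.det_apply]
  exact ContDiffAt.sum fun σ _ => ContDiffAt.const_smul _ (contDiffAt_prod fun i _ => hM _ _)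

theorem contDiffAt_matrix_inv (hM : ∀ i j, ContDiffAt ℝ m (fun x => M x i j) x)
    (h0 : (M x).det ≠ 0) (i j : ι) : ContDiffAt ℝ m (fun x => (M x)⁻¹ i j) x := by
  simp only [Matrix.inv_def, Ring.inverse_eq_inv', Matrix.smul_apply, smul_eq_mul,
    Matrix.adjugate_apply]
  refine ((contDiffAt_matrix_det hM).inv h0).mul (contDiffAt_matrix_det fun a b => ?_)
  simp only [Matrix.updateRow_apply]
  split_ifs
  · exact contDiffAt_const
  · exact hM a b

end ContDiffMatrix

theorem contDiffAt_gram {z : SymC n} (hz : z ∈ upperHalfSpace n) {m : WithTop ℕ∞}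
    (i j : Fin n ⊕ Fin n) : ContDiffAt ℝ m (fun z => gram z i j) z := by
  have h1 (a b : Fin n) : ContDiffAt ℝ m (fun z : SymC n => imMat z a b) z := by
    have : ContDiff ℝ m fun z : SymC n => z s(a, b) := by fun_prop
    exact (Complex.imCLM.contDiff.comp this).contDiffAt
  have h2 (a b : Fin n) : ContDiffAt ℝ m (fun z : SymC n => reMat z a b) z := by
    have : ContDiff ℝ m fun z : SymC n => z s(a, b) := by fun_prop
    exact (Complex.reCLM.contDiff.comp this).contDiffAt
  have h3 := contDiffAt_matrix_inv h1 (det_imMat_pos hz).ne'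
  have h4 := contDiffAt_matrix_mul h2 h3
  rcases i with i | i <;> rcases j with j | j
  · exact (contDiffAt_matrix_mul h4 h2 i j).add (h1 i j)
  · exact h4 i j
  · exact contDiffAt_matrix_mul h3 h2 i j
  · exact h3 i j

theorem contDiffAt_pairing {z w : SymC n} (hz : z ∈ upperHalfSpace n) (hw : w ∈ upperHalfSpace n)
    {m : WithTop ℕ∞} :
    ContDiffAt ℝ m (fun p : SymC n × SymC n => pairing p.1 p.2) (z, w) := by
  have h1 (i j) : ContDiffAt ℝ m (fun p : SymC n × SymC n => gram p.1 i j) (z, w) :=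
    ContDiffAt.comp (z, w) (contDiffAt_gram hz i j) contDiffAt_fst
  have h2 (i j) : ContDiffAt ℝ m (fun p : SymC n × SymC n => gram p.2 i j) (z, w) :=
    ContDiffAt.comp (z, w) (contDiffAt_gram hw i j) contDiffAt_snd
  have hc (A : Matrix (Fin n ⊕ Fin n) (Fin n ⊕ Fin n) ℝ) (i j) :
      ContDiffAt ℝ m (fun _ : SymC n × SymC n => A i j) (z, w) := contDiffAt_const
  simp only [pairing, Matrix.trace, Matrix.diag_apply]
  exact ContDiffAt.sum fun i _ => contDiffAt_matrix_mul
    (contDiffAt_matrix_mul (contDiffAt_matrix_mul h1 (hc _)) h2) (hc _) i i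

theorem pairing_self {z : SymC n} (hz : z ∈ upperHalfSpace n) : pairing z z = 2 * n := by
  obtain ⟨γ, rfl⟩ := exists_act_basePt hz
  rw [pairing_act γ basePt_mem basePt_mem, pairing_basePt, imMat_basePt, reMat_basePt]
  simp
  ring

/-- A smooth function of `z`, equal to `1` near `w` and supported in a compact part of the
half-space, which is invariant under the diagonal action. -/
def cutoff (w z : SymC n) : ℝ :=
  (upperHalfSpace n).indicator (fun z => Real.smoothTransition (2 * n + 2 - pairing z w)) z

theorem cutoff_of_mem (w : SymC n) {z : SymC n} (hz : z ∈ upperHalfSpace n) :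
    cutoff w z = Real.smoothTransition (2 * n + 2 - pairing z w) := Set.indicator_of_mem hz _

theorem cutoff_self {z : SymC n} (hz : z ∈ upperHalfSpace n) : cutoff z z = 1 := by
  rw [cutoff_of_mem z hz, pairing_self hz]
  exact Real.smoothTransition.one_of_one_le (by norm_num)

theorem cutoff_comm {z w : SymC n} (hz : z ∈ upperHalfSpace n) (hw : w ∈ upperHalfSpace n) :
    cutoff w z = cutoff z w := by
  rw [cutoff_of_mem w hz, cutoff_of_mem z hw, pairing_comm]

theorem cutoff_act (γ : SpR n) {z w : SymC n} (hz : z ∈ upperHalfSpace n)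
    (hw : w ∈ upperHalfSpace n) : cutoff (act γ w) (act γ z) = cutoff w z := by
  rw [cutoff_of_mem _ (act_mem γ hz), cutoff_of_mem _ hz, pairing_act γ hz hw]

theorem exists_compact_cutoff {w : SymC n} (hw : w ∈ upperHalfSpace n) :
    ∃ C : Set (SymC n), IsCompact C ∧ C ⊆ upperHalfSpace n ∧ ∀ z, z ∉ C → cutoff w z = 0 := by
  obtain ⟨C, hC, hs, h⟩ := exists_compact_of_pairing_le hw (2 * n + 2)
  refine ⟨C, hC, hs, fun z hz => ?_⟩
  by_cases hzH : z ∈ upperHalfSpace n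
  · rw [cutoff_of_mem w hzH]
    refine Real.smoothTransition.zero_of_nonpos ?_
    by_contra h0
    exact hz (h z hzH (by linarith))
  · exact Set.indicator_of_notMem hzH _

theorem tsupport_cutoff {w : SymC n} (hw : w ∈ upperHalfSpace n) :
    HasCompactSupport (cutoff w) ∧ tsupport (cutoff w) ⊆ upperHalfSpace n := by
  obtain ⟨C, hC, hs, h⟩ := exists_compact_cutoff hw
  have h1 : tsupport (cutoff w) ⊆ C :=
    closure_minimal (fun z hz => by_contra fun h0 => hz (h z h0)) hC.isClosed
  exact ⟨hC.of_isClosed_subset (isClosed_tsupport _) h1, h1.trans hs⟩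

theorem contDiffAt_cutoff_prod {z w : SymC n} (hz : z ∈ upperHalfSpace n)
    (hw : w ∈ upperHalfSpace n) {m : ℕ∞} :
    ContDiffAt ℝ m (fun p : SymC n × SymC n => cutoff p.2 p.1) (z, w) := by
  have h1 : ContDiffAt ℝ m (fun p : SymC n × SymC n =>
      Real.smoothTransition (2 * n + 2 - pairing p.1 p.2)) (z, w) :=
    Real.smoothTransition.contDiff.contDiffAt.comp (z, w)
      (contDiffAt_const.sub (contDiffAt_pairing hz hw))
  refine h1.congr_of_eventuallyEq ?_
  have h2 : ∀ᶠ p : SymC n × SymC n in 𝓝 (z, w), p.1 ∈ upperHalfSpace n :=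
    continuous_fst.continuousAt.eventually ((isOpen_upperHalfSpace n).mem_nhds hz)
  filter_upwards [h2] with p hp
  exact cutoff_of_mem _ hp

theorem contDiff_cutoff {w : SymC n} (hw : w ∈ upperHalfSpace n) {m : ℕ∞} :
    ContDiff ℝ m (cutoff w) := by
  rw [contDiff_iff_contDiffAt]
  intro z
  by_cases hz : z ∈ upperHalfSpace n
  · exact ContDiffAt.comp (g := fun p : SymC n × SymC n => cutoff p.2 p.1)
      (f := fun z => (z, w)) z (contDiffAt_cutoff_prod hz hw) (contDiffAt_id.prodMk contDiffAt_const)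
  · exact contDiffAt_const.congr_of_eventuallyEq
      (notMem_tsupport_iff_eventuallyEq.mp fun h => hz ((tsupport_cutoff hw).2 h))

/-- The gradient of the cut-off. -/
def gradCutoff (w z : SymC n) : Matrix (Fin n) (Fin n) ℂ := grad (fun z => (cutoff w z : ℂ)) z

theorem differentiableAt_cutoff {w : SymC n} (hw : w ∈ upperHalfSpace n) (z : SymC n) :
    DifferentiableAt ℝ (fun z => (cutoff w z : ℂ)) z :=
  (Complex.ofRealCLM.contDiff.comp (contDiff_cutoff hw (m := 1))).differentiable (by norm_num) z

theorem gradCutoff_act (γ : SpR n) {z w : SymC n} (hz : z ∈ upperHalfSpace n)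
    (hw : w ∈ upperHalfSpace n) : gradCutoff w z =
      ((denom γ z)⁻¹).map conj * gradCutoff (act γ w) (act γ z) *
        (((denom γ z)⁻¹).map conj)ᵀ := by
  rw [gradCutoff, gradCutoff, ← grad_comp_act γ hz (differentiableAt_cutoff (act_mem γ hw) _)]
  refine grad_congr ?_
  filter_upwards [(isOpen_upperHalfSpace n).mem_nhds hz] with y hy
  rw [cutoff_act γ hy hw]

theorem gradCutoff_of_notMem {w z : SymC n} (h : z ∉ tsupport (cutoff w)) :
    gradCutoff w z = 0 := by
  have h1 : (fun z => (cutoff w z : ℂ)) =ᶠ[𝓝 z] fun _ => 0 := by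
    filter_upwards [notMem_tsupport_iff_eventuallyEq.mp h] with w hw
    simp [hw]
  rw [gradCutoff, grad_congr h1]
  ext l m
  simp only [grad, Matrix.of_apply, dZbar_eq_dW, Matrix.zero_apply]
  exact dW_const 0

/-- Fubini on pairs of points needs joint measurability. The gradient in z is a partial derivative
of a jointly smooth function of (z, w), hence jointly continuous. -/
theorem continuous_gradCutoff (l m : Fin n) :
    Continuous fun p : Half n × Half n => gradCutoff (p.2 : SymC n) p.1 l m := by
  have key (v : SymC n) : Continuous fun p : Half n × Half n =>
      fderiv ℝ (fun z => (cutoff (p.2 : SymC n) z : ℂ)) p.1 v := by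
    set K : SymC n × SymC n → ℂ := fun p => (cutoff p.2 p.1 : ℂ) with hK
    have hKd (p : Half n × Half n) : ContDiffAt ℝ 1 K (p.1, p.2) :=
      Complex.ofRealCLM.contDiff.contDiffAt.comp _ (contDiffAt_cutoff_prod p.1.2 p.2.2 (m := 1))
    have e (p : Half n × Half n) : fderiv ℝ (fun z => (cutoff (p.2 : SymC n) z : ℂ)) p.1 v =
        fderiv ℝ K (p.1, p.2) (v, 0) := by
      have h1 := ((hKd p).differentiableAt (by norm_num)).hasFDerivAt
      have h2 := HasFDerivAt.comp (g := K) (f := fun z : SymC n => (z, (p.2 : SymC n)))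
        (p.1 : SymC n) h1 (hasFDerivAt_prodMk_left (p.1 : SymC n) (p.2 : SymC n))
      have h3 := h2.fderiv
      have h4 : (K ∘ fun z : SymC n => (z, (p.2 : SymC n))) =
          fun z => (cutoff (p.2 : SymC n) z : ℂ) := rfl
      rw [h4] at h3
      rw [h3]
      simp
    simp only [e]
    rw [continuous_iff_continuousAt]
    intro p
    have h5 : ContinuousAt (fun q => fderiv ℝ K q (v, 0)) ((p.1 : SymC n), (p.2 : SymC n)) :=
      (((hKd p).fderiv_right (m := 0) (by norm_num)).continuousAt).clm_apply continuousAt_const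
    exact h5.comp (f := fun p : Half n × Half n => ((p.1 : SymC n), (p.2 : SymC n)))
      (by fun_prop)
  simp only [gradCutoff, grad, Matrix.of_apply, dZbar_eq, wirt]
  exact continuous_const.mul ((key _).add (continuous_const.mul (key _)))

theorem continuous_cutoff_prod :
    Continuous fun p : Half n × Half n => cutoff (p.2 : SymC n) p.1 := by
  rw [continuous_iff_continuousAt]
  intro p
  exact (contDiffAt_cutoff_prod p.1.2 p.2.2 (m := 0)).continuousAt.comp
    (f := fun p : Half n × Half n => ((p.1 : SymC n), (p.2 : SymC n))) (by fun_prop)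

/-- The square is taken as cut-off because its gradient keeps one factor of the cut-off, which makes
the cross term absorbable in the localized energy. -/
theorem grad_cutoff_sq {w : SymC n} (hw : w ∈ upperHalfSpace n) (z : SymC n) :
    grad (fun z => ((cutoff w z ^ 2 : ℝ) : ℂ)) z = (2 * cutoff w z : ℂ) • gradCutoff w z := by
  have e : (fun z => ((cutoff w z ^ 2 : ℝ) : ℂ)) = fun z => (cutoff w z : ℂ) * cutoff w z := by
    funext z; push_cast; ring
  have h := differentiableAt_cutoff hw z
  ext l m
  simp only [e, gradCutoff, grad, Matrix.of_apply, dZbar_eq_dW, Matrix.smul_apply, smul_eq_mul]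
  rw [dW_mul h h]
  ring

/-- The part of the energy identity which is linear in the gradient of the squared cut-off. -/
def crossTerm (k : ℝ) (f : SymC n → ℂ) (z w : SymC n) : ℂ :=
  detY k z * (conj (f z) * gradForm z (grad f z) ((2 * cutoff w z : ℂ) • gradCutoff w z))

/-- The cross term is the product of κ∂f and 2f∂κ with κ the unsquared cut-off. The
arithmetic–geometric mean inequality puts exactly 1/2 on the energy, less than the 1 needed for
absorption. -/
theorem norm_crossTerm_le (k : ℝ) (f : SymC n → ℂ) {z : SymC n} (hz : z ∈ upperHalfSpace n)
    (w : SymC n) : ‖crossTerm k f z w‖ ≤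
      1 / 2 * (cutoff w z ^ 2 * ((imMat z).det ^ k * gradSq z (grad f z))) +
        2 * (gradSq z (gradCutoff w z) * ((imMat z).det ^ k * ‖f z‖ ^ 2)) := by
  set κ := cutoff w z
  have h1 : conj (f z) * gradForm z (grad f z) ((2 * κ : ℂ) • gradCutoff w z) =
      gradForm z ((κ : ℂ) • grad f z) ((2 * f z) • gradCutoff w z) := by
    have e : grad f z = (1 : ℂ) • grad f z := (one_smul _ _).symm
    conv_lhs => rw [e]
    rw [gradForm_smul, gradForm_smul]
    simp only [map_mul, Complex.conj_ofReal, Complex.conj_ofNat]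
    ring
  have hd : 0 ≤ (imMat z).det ^ k := Real.rpow_nonneg (det_imMat_pos hz).le _
  have h2 := norm_gradForm_le hz ((κ : ℂ) • grad f z) ((2 * f z) • gradCutoff w z)
  rw [gradSq_smul, gradSq_smul, norm_mul, Complex.norm_real, Real.norm_eq_abs, sq_abs] at h2
  rw [crossTerm, h1, norm_mul, detY, Complex.norm_of_nonneg hd]
  refine (mul_le_mul_of_nonneg_left h2 hd).trans (le_of_eq ?_)
  norm_num
  ring

theorem energyIdentity_cutoff_sq (k : ℝ) (μ : ℂ) (f : SymC n → ℂ) (z : SymC n) {w : SymC n}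
    (hw : w ∈ upperHalfSpace n) :
    energyIdentity k μ f (fun z => ((cutoff w z ^ 2 : ℝ) : ℂ)) z =
      (cutoff w z ^ 2 : ℝ) * (μ * ((imMat z).det ^ k * ‖f z‖ ^ 2 : ℝ) -
        ((imMat z).det ^ k * gradSq z (grad f z) : ℝ)) - crossTerm k f z w := by
  rw [energyIdentity, grad_cutoff_sq hw, crossTerm, detY]
  push_cast
  ring

/-- With C Z + D = i at the fixed point, the chain rule gives gradients of opposite sign for the
cut-offs centred at w and at its reflection. The cut-offs themselves agree at z. -/
theorem crossTerm_symmetry {k : ℝ} {f : SymC n → ℂ} {z : SymC n} (hz : z ∈ upperHalfSpace n)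
    {σ : SpR n} (h1 : act σ z = z) (h2 : denom σ z = Complex.I • 1) {w : SymC n}
    (hw : w ∈ upperHalfSpace n) : crossTerm k f z (act σ w) = -crossTerm k f z w := by
  have h3 := gradCutoff_act σ hz hw
  have h4 := cutoff_act σ hz hw
  have h5 : ((denom σ z)⁻¹).map conj = Complex.I • (1 : Matrix (Fin n) (Fin n) ℂ) := by
    have : (denom σ z)⁻¹ = (-Complex.I) • (1 : Matrix (Fin n) (Fin n) ℂ) := by
      apply Matrix.inv_eq_right_inv
      rw [h2]
      simp [smul_smul]
    rw [this]
    ext i j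
    by_cases h : i = j <;> simp [h]
  rw [h1] at h3 h4
  rw [h5] at h3
  have h6 : gradCutoff w z = -gradCutoff (act σ w) z := by
    rw [h3]
    simp [smul_smul]
  rw [crossTerm, crossTerm, h4, h6, smul_neg, gradForm, gradForm, Matrix.conjTranspose_neg,
    Matrix.mul_neg, Matrix.trace_neg]
  ring

end SiegelMaass
end

noncomputable section

namespace SiegelMaass

open scoped Topology

variable {n : ℕ}

/-! ### Holomorphy and the automorphy factor -/

theorem grad_eq_zero_of_differentiableAt {u : SymC n → ℂ} {z : SymC n}
    (hu : DifferentiableAt ℂ u z) : grad u z = 0 := by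
  ext l m
  simp only [grad, Matrix.of_apply, dZbar_eq, wirt, Matrix.zero_apply,
    hu.fderiv_restrictScalars ℝ, ContinuousLinearMap.coe_restrictScalars', map_smul, smul_eq_mul]
  linear_combination (1 / 2 * fderiv ℂ u z (eDir l m)) * Complex.I_mul_I

/-- The vanishing gradient is the system of Cauchy–Riemann equations: it makes the real derivative
commute with multiplication by i, hence complex linear. -/
theorem differentiableAt_of_grad_eq_zero {u : SymC n → ℂ} {z : SymC n}
    (hu : DifferentiableAt ℝ u z) (h : grad u z = 0) : DifferentiableAt ℂ u z := by
  set T := fderiv ℝ u z with hT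
  have hI (v : SymC n) : T (Complex.I • v) = Complex.I * T v := by
    have h1 := wirt_fderiv_eq u z v
    rw [h, wirt, ← hT] at h1
    simp only [Matrix.zero_apply, mul_zero, Finset.sum_const_zero] at h1
    linear_combination (-2 * Complex.I) * h1 + T (Complex.I • v) * Complex.I_mul_I
  have hc (c : ℂ) (v : SymC n) : T (c • v) = c * T v := by
    have e : c • v = c.re • v + c.im • (Complex.I • v) := by
      conv_lhs => rw [← Complex.re_add_im c]
      rw [add_smul, mul_smul]
      rfl
    rw [e, map_add, map_smul, map_smul, Complex.real_smul, Complex.real_smul, hI]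
    conv_rhs => rw [← Complex.re_add_im c]
    ring
  let T' : SymC n →L[ℂ] ℂ := ⟨⟨⟨T, T.map_add⟩, hc⟩, T.cont⟩
  have h2 : HasFDerivAt u T' z := by
    have h3 : HasFDerivAt u (T'.restrictScalars ℝ) z := hu.hasFDerivAt
    exact .of_isLittleO h3.isLittleO
  exact h2.differentiableAt

theorem differentiable_det_denom (γ : SpR n) : Differentiable ℂ fun z => (denom γ z).det := by
  simp only [Matrix.det_apply, denom, toMat, Matrix.add_apply, Matrix.mul_apply, Matrix.of_apply]
  fun_prop

/-- Only continuity of the branch is given. Near z it differs from its value at z by less than π, so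
there it is that value plus the principal logarithm of a ratio of determinants close to 1. -/
theorem differentiableAt_log (L : LogBranch n) (γ : SpR n) {z : SymC n}
    (hz : z ∈ upperHalfSpace n) : DifferentiableAt ℂ (L.log γ) z := by
  have hd := det_denom_ne_zero γ hz
  have hH := (isOpen_upperHalfSpace n).mem_nhds hz
  have hcont : ContinuousAt (L.log γ) z := (L.continuousOn_log γ).continuousAt hH
  have h1 : ContinuousAt (fun w => L.log γ w - L.log γ z) z := hcont.sub continuousAt_const
  have h2 : ∀ᶠ w in 𝓝 z, ‖L.log γ w - L.log γ z‖ < Real.pi := by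
    have := h1.norm
    refine this.eventually_lt continuousAt_const ?_
    simpa using Real.pi_pos
  have h3 : L.log γ =ᶠ[𝓝 z] fun w =>
      L.log γ z + Complex.log ((denom γ w).det / (denom γ z).det) := by
    filter_upwards [h2, hH] with w hw hwH
    rw [← L.exp_log γ w hwH, ← L.exp_log γ z hz, ← Complex.exp_sub, Complex.log_exp]
    · ring
    · have := (Complex.abs_im_le_norm (L.log γ w - L.log γ z)).trans_lt hw
      exact (abs_lt.mp this).1
    · have := (Complex.abs_im_le_norm (L.log γ w - L.log γ z)).trans_lt hw
      exact (abs_lt.mp this).2.le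
  refine DifferentiableAt.congr_of_eventuallyEq ?_ h3
  refine (differentiableAt_const _).add (DifferentiableAt.clog ?_ ?_)
  · have := differentiable_det_denom γ z
    simp only [div_eq_mul_inv]
    exact this.mul_const _
  · rw [div_self hd]; exact Complex.one_mem_slitPlane

theorem differentiableAt_detPow (L : LogBranch n) (γ : SpR n) (s : ℝ) {z : SymC n}
    (hz : z ∈ upperHalfSpace n) : DifferentiableAt ℂ (L.detPow γ s) z :=
  ((differentiableAt_const (s : ℂ)).mul (differentiableAt_log L γ hz)).cexp

theorem norm_detPow (L : LogBranch n) (γ : SpR n) (s : ℝ) {z : SymC n}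
    (hz : z ∈ upperHalfSpace n) : ‖L.detPow γ s z‖ = ‖(denom γ z).det‖ ^ s := by
  rw [LogBranch.detPow, Complex.norm_exp, ← L.exp_log γ z hz, Complex.norm_exp, ← Real.exp_mul,
    Complex.re_ofReal_mul, mul_comm]

theorem det_imMat_act_rpow (γ : SpR n) (s : ℝ) {z : SymC n} (hz : z ∈ upperHalfSpace n) :
    (imMat (act γ z)).det ^ s * ‖(denom γ z).det‖ ^ (2 * s) = (imMat z).det ^ s := by
  have hd : 0 < ‖(denom γ z).det‖ := norm_pos_iff.mpr (det_denom_ne_zero γ hz)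
  rw [det_imMat_act γ hz, Real.div_rpow (det_imMat_pos hz).le (by positivity),
    Real.rpow_mul hd.le, Real.rpow_two]
  field_simp

/-- Im γZ contributes |det(CZ + D)|^(-2β), which turns the conjugate power of exponent β into the
holomorphic one of exponent -β. -/
theorem lift_transform {L : LogBranch n} {γ : SpR n} {α β : ℝ} {φ : SymC n → ℂ} {z : SymC n}
    (hz : z ∈ upperHalfSpace n)
    (h : φ (act γ z) = L.detPow γ α z * L.detConjPow γ β z * φ z) :
    lift β φ (act γ z) = L.detPow γ (α - β) z * lift β φ z := by
  have h1 := det_imMat_act_rpow γ β hz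
  have e : L.detPow γ α z * L.detConjPow γ β z =
      L.detPow γ (α - β) z * ((‖(denom γ z).det‖ ^ (2 * β) : ℝ) : ℂ) := by
    rw [← L.exp_log γ z hz, LogBranch.detPow, LogBranch.detConjPow, LogBranch.detPow,
      Complex.norm_exp, ← Real.exp_mul, Complex.ofReal_exp, ← Complex.exp_add, ← Complex.exp_add]
    congr 1
    have h : (((L.log γ z).re : ℝ) : ℂ) = (L.log γ z + conj (L.log γ z)) / 2 := by
      rw [Complex.add_conj]; push_cast; ring
    push_cast
    rw [h]
    ring
  rw [lift, lift, h, e, detY, detY, ← h1]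
  push_cast
  ring

/-! ### Invariant functions attached to `f` -/

section Invariance

variable {k : ℝ} {f : SymC n → ℂ} {γ : SpR n} {L : LogBranch n} {z : SymC n}

theorem norm_sq_act (hz : z ∈ upperHalfSpace n) (h : f (act γ z) = L.detPow γ k z * f z) :
    (imMat (act γ z)).det ^ k * ‖f (act γ z)‖ ^ 2 = (imMat z).det ^ k * ‖f z‖ ^ 2 := by
  have hd : 0 < ‖(denom γ z).det‖ := norm_pos_iff.mpr (det_denom_ne_zero γ hz)
  rw [h, norm_mul, norm_detPow L γ k hz, ← det_imMat_act_rpow γ k hz, mul_comm 2 k,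
    Real.rpow_mul hd.le, Real.rpow_two]
  ring

/-- The automorphy factor is holomorphic, so ∂/∂Z̄ passes through it without an extra term. This is
the reason for working with f rather than φ. -/
theorem grad_act (hz : z ∈ upperHalfSpace n) (hf : ∀ z ∈ upperHalfSpace n, DifferentiableAt ℝ f z)
    (h : ∀ z ∈ upperHalfSpace n, f (act γ z) = L.detPow γ k z * f z) :
    ((denom γ z)⁻¹).map conj * grad f (act γ z) * (((denom γ z)⁻¹).map conj)ᵀ =
      L.detPow γ k z • grad f z := by
  rw [← grad_comp_act γ hz (hf _ (act_mem γ hz))]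
  have h1 : (fun w => f (act γ w)) =ᶠ[𝓝 z] fun w => L.detPow γ k w * f w := by
    filter_upwards [(isOpen_upperHalfSpace n).mem_nhds hz] with w hw using h w hw
  have hJ := differentiableAt_detPow L γ k hz
  have h2 := grad_eq_zero_of_differentiableAt hJ
  rw [grad_congr h1]
  ext l m
  have h3 := congrFun (congrFun h2 l) m
  simp only [grad, Matrix.of_apply, dZbar_eq_dW, Matrix.smul_apply, smul_eq_mul,
    Matrix.zero_apply] at h3 ⊢
  rw [dW_mul (hJ.restrictScalars ℝ) (hf z hz)]
  change dW Complex.I l m (L.detPow γ k) z * _ + _ = _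
  rw [h3]
  ring

theorem gradSq_act (hz : z ∈ upperHalfSpace n)
    (hf : ∀ z ∈ upperHalfSpace n, DifferentiableAt ℝ f z)
    (h : ∀ z ∈ upperHalfSpace n, f (act γ z) = L.detPow γ k z * f z) :
    (imMat (act γ z)).det ^ k * gradSq (act γ z) (grad f (act γ z)) =
      (imMat z).det ^ k * gradSq z (grad f z) := by
  have hd : 0 < ‖(denom γ z).det‖ := norm_pos_iff.mpr (det_denom_ne_zero γ hz)
  have h1 : gradSq (act γ z) (grad f (act γ z)) =
      ‖L.detPow γ k z‖ ^ 2 * gradSq z (grad f z) := by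
    rw [← gradSq_smul, ← grad_act hz hf h, gradSq, gradSq, gradForm_act γ hz]
  rw [h1, norm_detPow L γ k hz, ← det_imMat_act_rpow γ k hz, mul_comm 2 k, Real.rpow_mul hd.le,
    Real.rpow_two]
  ring

/-- One automorphy factor comes from ∂f/∂Z̄ and its conjugate from f̄; their product is cancelled by
det(Y)^k. -/
theorem crossTerm_act (hz : z ∈ upperHalfSpace n)
    (hf : ∀ z ∈ upperHalfSpace n, DifferentiableAt ℝ f z)
    (h : ∀ z ∈ upperHalfSpace n, f (act γ z) = L.detPow γ k z * f z) {w : SymC n}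
    (hw : w ∈ upperHalfSpace n) :
    crossTerm k f (act γ z) (act γ w) = crossTerm k f z w := by
  have hd : 0 < ‖(denom γ z).det‖ := norm_pos_iff.mpr (det_denom_ne_zero γ hz)
  set U := ((denom γ z)⁻¹).map conj with hU
  have e : U * ((2 * cutoff w z : ℂ) • gradCutoff (act γ w) (act γ z)) * Uᵀ =
      (2 * cutoff w z : ℂ) • gradCutoff w z := by
    rw [Matrix.mul_smul, Matrix.smul_mul, gradCutoff_act γ hz hw]
  have h1 : gradForm (act γ z) (grad f (act γ z))
      ((2 * cutoff w z : ℂ) • gradCutoff (act γ w) (act γ z)) =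
      L.detPow γ k z * gradForm z (grad f z) ((2 * cutoff w z : ℂ) • gradCutoff w z) := by
    rw [← gradForm_act γ hz, ← hU, grad_act hz hf h, e]
    have := gradForm_smul z (L.detPow γ k z) 1 (grad f z) ((2 * cutoff w z : ℂ) • gradCutoff w z)
    simpa using this
  have h2 : detY k (act γ z) * (conj (L.detPow γ k z) * L.detPow γ k z) = detY k z := by
    rw [mul_comm (conj _), Complex.mul_conj, Complex.normSq_eq_norm_sq, norm_detPow L γ k hz,
      detY, detY, ← det_imMat_act_rpow γ k hz, mul_comm 2 k, Real.rpow_mul hd.le, Real.rpow_two]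
    push_cast
    ring
  rw [crossTerm, crossTerm, cutoff_act γ hz hw, h1, h z hz, map_mul, ← h2]
  ring

end Invariance

theorem gradSq_gradCutoff_act (γ : SpR n) {z w : SymC n} (hz : z ∈ upperHalfSpace n)
    (hw : w ∈ upperHalfSpace n) : gradSq (act γ z) (gradCutoff (act γ w) (act γ z)) =
      gradSq z (gradCutoff w z) := by
  rw [gradSq, gradSq, ← gradForm_act γ hz, ← gradCutoff_act γ hz hw]

/-! ### Continuity and integrability -/

theorem continuous_gradForm {X : Type*} [TopologicalSpace X] {a : X → SymC n}
    {V W : X → Matrix (Fin n) (Fin n) ℂ} (ha : Continuous a) (hV : Continuous V)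
    (hW : Continuous W) : Continuous fun x => gradForm (a x) (V x) (W x) := by
  have h1 : Continuous fun x => toC (imMat (a x)) :=
    (continuous_imMat.comp ha).matrix_map Complex.continuous_ofReal
  unfold gradForm
  exact continuous_const.mul (((h1.matrix_mul hV).matrix_mul h1).matrix_mul
    hW.matrix_conjTranspose).matrix_trace

theorem continuous_gradSq {X : Type*} [TopologicalSpace X] {a : X → SymC n}
    {V : X → Matrix (Fin n) (Fin n) ℂ} (ha : Continuous a) (hV : Continuous V) :
    Continuous fun x => gradSq (a x) (V x) :=
  Complex.continuous_re.comp (continuous_gradForm ha hV hV)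

theorem continuous_grad {f : SymC n → ℂ} (hf : ∀ z ∈ upperHalfSpace n, ContDiffAt ℝ 2 f z) :
    Continuous fun z : Half n => grad f z := by
  refine continuous_matrix fun l m => ?_
  simp only [grad, Matrix.of_apply, dZbar_eq_dW]
  exact continuous_of_contDiffAt fun z hz => (contDiffAt_dW (hf z hz) l m).continuousAt

theorem continuous_detY (k : ℝ) : Continuous fun z : Half n => (imMat (z : SymC n)).det ^ k := by
  have h := contDiff_det_imMat (n := n) |>.continuous.comp
    (continuous_subtype_val (p := fun z => z ∈ upperHalfSpace n))
  exact h.rpow_const fun z => Or.inl (det_imMat_pos z.2).ne'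

theorem continuous_gradCutoff' :
    Continuous fun p : Half n × Half n => gradCutoff (p.2 : SymC n) p.1 :=
  continuous_matrix continuous_gradCutoff

theorem integrable_of_compact {E : Type*} [NormedAddCommGroup E] {u : Half n → E}
    (hu : Continuous u) {C : Set (SymC n)} (hC : IsCompact C) (hs : C ⊆ upperHalfSpace n)
    (h : ∀ z : Half n, (z : SymC n) ∉ C → u z = 0) : Integrable u (halfMeasure n) := by
  refine hu.integrable_of_hasCompactSupport ?_
  exact HasCompactSupport.intro (isCompact_preimage_coe hC hs) fun z hz => h z hz

instance : (halfMeasure n).IsOpenPosMeasure where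
  open_pos U hU hne := by
    have hH := measurableSet_upperHalfSpace (n := n)
    have hV : IsOpen (Subtype.val '' U) := (isOpen_upperHalfSpace n).isOpenMap_subtype_val U hU
    have hsub : Subtype.val '' U ⊆ upperHalfSpace n := by rintro _ ⟨z, -, rfl⟩; exact z.2
    rw [halfMeasure, (MeasurableEmbedding.subtype_coe hH).comap_apply, siegelMeasure,
      withDensity_apply _ hV.measurableSet, Measure.restrict_restrict hV.measurableSet,
      Set.inter_eq_left.mpr hsub]
    refine (setLIntegral_pos_iff ?_).mpr ?_ |>.ne'
    · exact ((measurable_det_imMat.pow_const _).inv).ennreal_ofReal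
    · have : (Function.support fun z : SymC n =>
          ENNReal.ofReal (((imMat z).det ^ (n + 1))⁻¹)) ∩ Subtype.val '' U = Subtype.val '' U := by
        refine Set.inter_eq_right.mpr fun z hz => ?_
        have := det_imMat_pos (hsub hz)
        rw [Function.mem_support]
        exact (ENNReal.ofReal_pos.mpr (by positivity)).ne'
      rw [this]
      exact hV.measure_pos _ (hne.image _)

/-- By transitivity and invariance of the measure, an invariant kernel has the same total mass at
every point. -/
theorem lintegral_eq_basePt {M : Half n → Half n → ENNReal}
    (hM : ∀ z, Measurable (M z)) (h : ∀ (γ : SpR n) z w, M (γ • z) (γ • w) = M z w) (z : Half n) :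
    ∫⁻ w, M z w ∂halfMeasure n = ∫⁻ w, M ⟨basePt n, basePt_mem⟩ w ∂halfMeasure n := by
  obtain ⟨γ, hγ⟩ := exists_act_basePt z.2
  have e : z = γ • (⟨basePt n, basePt_mem⟩ : Half n) := Subtype.ext hγ.symm
  rw [e, ← (measurePreserving_smul γ).lintegral_comp (hM _)]
  simp only [h]

end SiegelMaass
end

noncomputable section

namespace SiegelMaass

open scoped Topology

variable {n : ℕ}

/-! ### The group of transformations -/

theorem countable_SpZ : Countable (SpZ n) := by
  have : Countable (Matrix (Fin n ⊕ Fin n) (Fin n ⊕ Fin n) ℤ) :=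
    inferInstanceAs (Countable (Fin n ⊕ Fin n → Fin n ⊕ Fin n → ℤ))
  have h : ((SpZ n : Subgroup (SpR n)) : Set (SpR n)) ⊆
      Subtype.val ⁻¹' Set.range fun M : Matrix (Fin n ⊕ Fin n) (Fin n ⊕ Fin n) ℤ =>
        M.map (Int.castRingHom ℝ) := by
    rintro γ ⟨M, -, h⟩
    exact ⟨M, h⟩
  exact (((Set.countable_range _).preimage Subtype.val_injective).mono h).to_subtype

theorem countable_of_commensurable {Γ : Subgroup (SpR n)}
    (hΓ : Subgroup.Commensurable Γ (SpZ n)) : Countable Γ := by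
  have := countable_SpZ (n := n)
  set H := (SpZ n).subgroupOf Γ
  have hi : H.index ≠ 0 := hΓ.2
  have : H.FiniteIndex := ⟨hi⟩
  have : Countable H := by
    have hinj : Function.Injective fun x : H => (⟨x.1.1, x.2⟩ : SpZ n) := by
      intro x y h
      exact Subtype.ext (Subtype.ext (congrArg (fun t : SpZ n => t.1) h))
    exact hinj.countable
  exact (Subgroup.groupEquivQuotientProdSubgroup (s := H)).injective.countable

/-- The group of transformations of the half-space induced by `Γ`. -/
def transGroup (Γ : Subgroup (SpR n)) : Subgroup (Equiv.Perm (Half n)) :=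
  Γ.map (MulAction.toPermHom (SpR n) (Half n))

theorem exists_smul_eq {Γ : Subgroup (SpR n)} (g : transGroup Γ) :
    ∃ γ ∈ Γ, ∀ z : Half n, g • z = γ • z := by
  obtain ⟨g, γ, hγ, rfl⟩ := g
  exact ⟨γ, hγ, fun z => rfl⟩

/-- The transformation induced by an element of `Γ`. -/
def toTrans {Γ : Subgroup (SpR n)} {γ : SpR n} (hγ : γ ∈ Γ) : transGroup Γ :=
  ⟨MulAction.toPermHom (SpR n) (Half n) γ, γ, hγ, rfl⟩

instance (Γ : Subgroup (SpR n)) : MeasurableConstSMul (transGroup Γ) (Half n) where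
  measurable_const_smul g := by
    obtain ⟨γ, -, h⟩ := exists_smul_eq g
    have : (fun z : Half n => g • z) = fun z => γ • z := funext h
    change Measurable fun z : Half n => g • z
    rw [this]
    exact (continuous_smul_half γ).measurable

instance (Γ : Subgroup (SpR n)) : SMulInvariantMeasure (transGroup Γ) (Half n) (halfMeasure n) where
  measure_preimage_smul g s hs := by
    obtain ⟨γ, -, h⟩ := exists_smul_eq g
    have : (fun z : Half n => g • z) = fun z => γ • z := funext h
    rw [this]
    exact (measurePreserving_smul γ).measure_preimage hs.nullMeasurableSet

theorem countable_transGroup {Γ : Subgroup (SpR n)} [Countable Γ] : Countable (transGroup Γ) := by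
  have : Function.Surjective fun γ : Γ => toTrans γ.2 := by
    rintro ⟨g, γ, hγ, rfl⟩
    exact ⟨⟨γ, hγ⟩, rfl⟩
  exact this.countable

-- The group used here is the image of Γ in the permutations of ℍ_n: elements such as -1 act
-- trivially, and a domain F could not be disjoint from its own translate by them.
open scoped Pointwise in
theorem IsFundDomain.isFundamentalDomain {Γ : Subgroup (SpR n)} [Countable Γ] {F : Set (SymC n)}
    (hF : IsFundDomain Γ F) :
    IsFundamentalDomain (transGroup Γ) (Subtype.val ⁻¹' F : Set (Half n)) (halfMeasure n) := by
  have := countable_transGroup (Γ := Γ)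
  have hH := measurableSet_upperHalfSpace (n := n)
  refine IsFundamentalDomain.mk'' (hF.measurableSet.preimage measurable_subtype_coe).nullMeasurableSet
    ?_ ?_ ?_
  · refine .of_forall fun z => ?_
    obtain ⟨γ, hγ, h⟩ := hF.covers z z.2
    exact ⟨toTrans hγ, h⟩
  · intro g hg
    obtain ⟨γ, hγ, h⟩ := exists_smul_eq g
    have hne : ∃ z ∈ upperHalfSpace n, act γ z ≠ z := by
      by_contra hcon
      push Not at hcon
      refine hg (Subtype.ext (Equiv.ext fun z => ?_))
      exact (h z).trans (Subtype.ext (hcon z z.2))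
    have h0 := hF.disjoint γ hγ hne
    rw [AEDisjoint, halfMeasure, (MeasurableEmbedding.subtype_coe hH).comap_apply]
    refine measure_mono_null ?_ h0
    rintro _ ⟨z, ⟨⟨y, hy, rfl⟩, hz⟩, rfl⟩
    refine ⟨hz, y, hy, ?_⟩
    exact (congrArg Subtype.val (h y)).symm
  · intro g
    exact (MeasureTheory.measurePreserving_smul g (halfMeasure n)).quasiMeasurePreserving

theorem lintegral_fundDomain (u : SymC n → ENNReal) {F : Set (SymC n)} (hF : MeasurableSet F) :
    ∫⁻ z in (Subtype.val ⁻¹' F : Set (Half n)), u z ∂halfMeasure n =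
      ∫⁻ z in F, u z ∂siegelMeasure n := by
  rw [← lintegral_indicator (hF.preimage measurable_subtype_coe), ← lintegral_indicator hF,
    ← lintegral_halfMeasure]
  rfl

/-! ### The energy balance -/

section Balance

variable {Γ : Subgroup (SpR n)} {L : LogBranch n} {α β : ℝ} {φ : SymC n → ℂ} {l : ℂ}

/-- `det (Y) ^ k |f| ^ 2`. -/
def density (k : ℝ) (f : SymC n → ℂ) (z : Half n) : ℝ :=
  (imMat (z : SymC n)).det ^ k * ‖f z‖ ^ 2

/-- `det (Y) ^ k |∂f/∂Z̄| ^ 2`. -/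
def energy (k : ℝ) (f : SymC n → ℂ) (z : Half n) : ℝ :=
  (imMat (z : SymC n)).det ^ k * gradSq (z : SymC n) (grad f z)

theorem density_nonneg (k : ℝ) (f : SymC n → ℂ) (z : Half n) : 0 ≤ density k f z :=
  mul_nonneg (Real.rpow_nonneg (det_imMat_pos z.2).le _) (by positivity)

theorem energy_nonneg (k : ℝ) (f : SymC n → ℂ) (z : Half n) : 0 ≤ energy k f z :=
  mul_nonneg (Real.rpow_nonneg (det_imMat_pos z.2).le _) (gradSq_nonneg z.2 _)

theorem density_lift (z : Half n) : density (α - β) (lift β φ) z =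
    (imMat (z : SymC n)).det ^ (α + β) * ‖φ z‖ ^ 2 := by
  have hp := det_imMat_pos z.2
  rw [density, lift, norm_mul, detY, Complex.norm_of_nonneg (Real.rpow_nonneg hp.le _), mul_pow,
    ← Real.rpow_natCast, ← Real.rpow_mul hp.le, ← mul_assoc, ← Real.rpow_add hp]
  congr 2
  push_cast
  ring

theorem continuous_density (k : ℝ) {f : SymC n → ℂ}
    (hf : ∀ z ∈ upperHalfSpace n, ContinuousAt f z) : Continuous (density k f) :=
  (continuous_detY k).mul ((continuous_of_contDiffAt hf).norm.pow 2)

theorem continuous_energy (k : ℝ) {f : SymC n → ℂ}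
    (hf : ∀ z ∈ upperHalfSpace n, ContDiffAt ℝ 2 f z) : Continuous (energy k f) :=
  (continuous_detY k).mul (continuous_gradSq continuous_subtype_val (continuous_grad hf))

/-- The averaging argument applied with κ = η², N = |∂η/∂Z̄|² and B the cross term. The cut-off is
symmetric in its two points and compactly supported, so these kernels are integrable in either
variable, with masses computed at i. -/
theorem energy_balance_lift [Countable Γ] (hφ : MemV L Γ α β φ)
    (hl : ∀ z ∈ upperHalfSpace n, laplacian α β φ z + l * φ z = 0) {F : Set (SymC n)}
    (hF : IsFundDomain Γ F) (hfin : normSqOver α β φ F < ⊤) :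
    IntegrableOn (energy (α - β) (lift β φ)) (Subtype.val ⁻¹' F) (halfMeasure n) ∧
      (l - n * β * (α - (n + 1) / 2)) *
        (∫ z in Subtype.val ⁻¹' F, density (α - β) (lift β φ) z ∂halfMeasure n : ℝ) =
      (∫ z in Subtype.val ⁻¹' F, energy (α - β) (lift β φ) z ∂halfMeasure n : ℝ) := by
  have := countable_transGroup (Γ := Γ)
  have hφ2 : ∀ z ∈ upperHalfSpace n, ContDiffAt ℝ 2 φ z := fun z hz => (hφ.analytic z hz).contDiffAt
  set f := lift β φ with hf
  set k := α - β with hk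
  have hf2 : ∀ z ∈ upperHalfSpace n, ContDiffAt ℝ 2 f z := fun z hz =>
    contDiffAt_lift hz (hφ2 z hz)
  have hfd : ∀ z ∈ upperHalfSpace n, DifferentiableAt ℝ f z := fun z hz =>
    (hf2 z hz).differentiableAt (by norm_num)
  have hft : ∀ γ ∈ Γ, ∀ z ∈ upperHalfSpace n, f (act γ z) = L.detPow γ k z * f z :=
    fun γ hγ z hz => lift_transform hz (hφ.transform γ hγ z hz)
  have cΦ : Continuous (density k f) := continuous_density k fun z hz => (hf2 z hz).continuousAt
  have cE : Continuous (energy k f) := continuous_energy k hf2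
  set κ : Half n → Half n → ℝ := fun z w => cutoff (w : SymC n) z ^ 2 with hκ
  set N : Half n → Half n → ℝ := fun z w => gradSq (z : SymC n) (gradCutoff (w : SymC n) z) with hN
  set B : Half n → Half n → ℂ := fun z w => crossTerm k f z w with hB
  have cκ : Continuous fun p : Half n × Half n => κ p.1 p.2 := continuous_cutoff_prod.pow 2
  have cN : Continuous fun p : Half n × Half n => N p.1 p.2 :=
    continuous_gradSq (continuous_subtype_val.comp continuous_fst) continuous_gradCutoff'
  have cB : Continuous fun p : Half n × Half n => B p.1 p.2 := by
    have c1 : Continuous fun p : Half n × Half n => f p.1 :=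
      (continuous_of_contDiffAt fun z hz => (hf2 z hz).continuousAt).comp continuous_fst
    have c2 : Continuous fun p : Half n × Half n => detY k (p.1 : SymC n) :=
      Complex.continuous_ofReal.comp ((continuous_detY k).comp continuous_fst)
    have c3 : Continuous fun p : Half n × Half n =>
        (2 * cutoff (p.2 : SymC n) p.1 : ℂ) • gradCutoff (p.2 : SymC n) p.1 :=
      (continuous_const.mul (Complex.continuous_ofReal.comp continuous_cutoff_prod)).smul
        continuous_gradCutoff'
    exact c2.mul ((Complex.continuous_conj.comp c1).mul (continuous_gradForm
      (continuous_subtype_val.comp continuous_fst) ((continuous_grad hf2).comp continuous_fst) c3))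
  have κ_zero (w z : Half n) (hz : (z : SymC n) ∉ tsupport (cutoff (w : SymC n))) : κ z w = 0 := by
    simp [hκ, image_eq_zero_of_notMem_tsupport hz]
  have N_zero (w z : Half n) (hz : (z : SymC n) ∉ tsupport (cutoff (w : SymC n))) : N z w = 0 := by
    simp [hN, gradCutoff_of_notMem hz, gradSq, gradForm]
  have iκ (γ : SpR n) (z w : Half n) : κ (γ • z) (γ • w) = κ z w := by
    simp only [hκ, coe_smul, cutoff_act γ z.2 w.2]
  have iN (γ : SpR n) (z w : Half n) : N (γ • z) (γ • w) = N z w :=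
    gradSq_gradCutoff_act γ z.2 w.2
  have sec {E : Type} [TopologicalSpace E] {M : Half n → Half n → E}
      (h : Continuous fun p : Half n × Half n => M p.1 p.2) (w : Half n) :
      Continuous fun z => M z w := h.comp (continuous_id.prodMk continuous_const)
  have sec' {E : Type} [TopologicalSpace E] {M : Half n → Half n → E}
      (h : Continuous fun p : Half n × Half n => M p.1 p.2) (z : Half n) :
      Continuous fun w => M z w := h.comp (continuous_const.prodMk continuous_id)
  set o : Half n := ⟨basePt n, basePt_mem⟩ with ho
  have κ_comm (z w : Half n) : κ z w = κ w z := by simp only [hκ, cutoff_comm z.2 w.2]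
  have intκ : Integrable (κ o) (halfMeasure n) :=
    integrable_of_compact (sec' cκ o) (tsupport_cutoff o.2).1 (tsupport_cutoff o.2).2
      fun w hw => by rw [κ_comm]; exact κ_zero o w hw
  -- Here the centre w varies while the gradient is taken at `o`. Outside the compact set the strict
  -- inequality for the pairing persists for points near `o`, so the cut-off vanishes on a whole
  -- neighbourhood and its gradient is zero.
  have intN : Integrable (N o) (halfMeasure n) := by
    obtain ⟨C, hC, hs, hm⟩ := exists_compact_of_pairing_le (n := n) o.2 (2 * n + 2)
    refine integrable_of_compact (sec' cN o) hC hs fun w hw => N_zero w o ?_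
    rw [notMem_tsupport_iff_eventuallyEq]
    have h1 : 2 * n + 2 < pairing (o : SymC n) w := by
      by_contra hcon
      exact hw (hm w w.2 (by rw [pairing_comm]; linarith))
    have h2 : ContinuousAt (fun z : SymC n => pairing z w) o :=
      ContinuousAt.comp (g := fun p : SymC n × SymC n => pairing p.1 p.2)
        (f := fun z : SymC n => (z, (w : SymC n)))
        (contDiffAt_pairing o.2 w.2 (m := 0)).continuousAt (by fun_prop)
    filter_upwards [h2.eventually_const_lt h1,
      (isOpen_upperHalfSpace n).mem_nhds o.2] with z hz hzH
    rw [cutoff_of_mem _ hzH]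
    exact Real.smoothTransition.zero_of_nonpos (by linarith)
  have κ0 (z w : Half n) : 0 ≤ κ z w := sq_nonneg _
  have N0 (z w : Half n) : 0 ≤ N z w := gradSq_nonneg z.2 _
  have hc : 0 < ∫ w, κ o w ∂halfMeasure n := by
    rw [integral_pos_iff_support_of_nonneg (κ0 o) intκ]
    refine (sec' cκ o).isOpen_support.measure_pos _ ⟨o, ?_⟩
    simp [hκ, cutoff_self o.2]
  refine energy_balance (G := transGroup Γ) (ν := halfMeasure n) (κ := κ) (N := N) (B := B)
    (c := ∫ w, κ o w ∂halfMeasure n) (c' := ∫ w, N o w ∂halfMeasure n)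
    (μ := l - n * β * (α - (n + 1) / 2))
    hF.isFundamentalDomain hc cΦ.measurable cE.measurable cκ.measurable cN.measurable cB.measurable
    (density_nonneg k f) (energy_nonneg k f) κ0 N0 ?_ ?_ ?_ ?_ ?_ ?_ ?_ ?_ ?_ ?_ ?_ ?_ ?_ ?_
  · intro g z
    obtain ⟨γ, hγ, h⟩ := exists_smul_eq g
    rw [h]
    exact norm_sq_act z.2 (hft γ hγ z z.2)
  · intro g z
    obtain ⟨γ, hγ, h⟩ := exists_smul_eq g
    rw [h]
    exact gradSq_act z.2 hfd (hft γ hγ)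
  · intro g z w
    obtain ⟨γ, hγ, h⟩ := exists_smul_eq g
    rw [h, h, iκ]
  · intro g z w
    obtain ⟨γ, hγ, h⟩ := exists_smul_eq g
    rw [h, h, iN]
  · intro g z w
    obtain ⟨γ, hγ, h⟩ := exists_smul_eq g
    rw [h, h]
    exact crossTerm_act z.2 hfd (hft γ hγ) w.2
  · intro z
    rw [lintegral_eq_basePt (fun z => (sec' cκ z).measurable.ennreal_ofReal)
      (fun γ z w => by rw [iκ]), ofReal_integral_eq_lintegral_ofReal intκ (.of_forall (κ0 o))]
  · intro z
    rw [lintegral_eq_basePt (fun z => (sec' cN z).measurable.ennreal_ofReal)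
      (fun γ z w => by rw [iN]), ofReal_integral_eq_lintegral_ofReal intN (.of_forall (N0 o))]
  · intro z
    obtain ⟨σ, h1, h2⟩ := exists_symmetry z.2
    have h3 := (measurePreserving_smul σ).integral_comp
      (Homeomorph.smul σ : Half n ≃ₜ Half n).measurableEmbedding (B z)
    have h4 (w : Half n) : B z (σ • w) = -B z w := crossTerm_symmetry z.2 h1 h2 w.2
    simp only [h4, integral_neg] at h3
    -- The substitution w ↦ σw preserves the measure and changes the sign, so the integral equals
    -- its negative.
    have h5 : (2 : ℂ) * ∫ w, B z w ∂halfMeasure n = 0 := by linear_combination -h3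
    simpa using h5
  · exact fun z w => norm_crossTerm_le k f z.2 w
  · exact fun w => integrable_of_compact ((sec cκ w).mul cΦ) (tsupport_cutoff w.2).1
      (tsupport_cutoff w.2).2 fun z hz => by rw [κ_zero w z hz, zero_mul]
  · exact fun w => integrable_of_compact ((sec cκ w).mul cE) (tsupport_cutoff w.2).1
      (tsupport_cutoff w.2).2 fun z hz => by rw [κ_zero w z hz, zero_mul]
  · exact fun w => integrable_of_compact ((sec cN w).mul cΦ) (tsupport_cutoff w.2).1
      (tsupport_cutoff w.2).2 fun z hz => by rw [N_zero w z hz, zero_mul]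
  · intro w
    have hts := tsupport_cutoff w.2
    have hsub : tsupport (fun z => cutoff (w : SymC n) z ^ 2) ⊆ tsupport (cutoff (w : SymC n)) := by
      refine closure_mono fun z hz => ?_
      rw [Function.mem_support] at hz ⊢
      exact fun h0 => hz (by simp [h0])
    have h1 := integral_energyIdentity (χ := fun z => cutoff (w : SymC n) z ^ 2) hφ2
      ((contDiff_cutoff w.2 (m := 1)).pow 2)
      (hts.1.of_isClosed_subset (isClosed_tsupport _) hsub) (hsub.trans hts.2) hl
    rw [← h1]
    refine integral_congr_ae (.of_forall fun z => ?_)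
    exact (energyIdentity_cutoff_sq k _ f z w.2).symm
  · have h1 := lintegral_fundDomain (fun z => ENNReal.ofReal ((imMat z).det ^ (α + β) * ‖φ z‖ ^ 2))
      hF.measurableSet
    simp only [density_lift, hf, hk]
    rw [h1]
    exact hfin

end Balance

end SiegelMaass
end

noncomputable section

namespace SiegelMaass

variable {n : ℕ}

/-! ### The eigenvalue -/

section Eigenvalue

variable {Γ : Subgroup (SpR n)} {L : LogBranch n} {α β : ℝ} {φ : SymC n → ℂ} {l : ℂ}

open scoped Pointwise in
/-- A continuous invariant nonnegative function with vanishing integral over a fundamental domain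
is zero. -/
theorem eq_zero_of_setIntegral_eq_zero [Countable Γ] {F : Set (SymC n)} (hF : IsFundDomain Γ F)
    {u : Half n → ℝ} (hu : Continuous u) (hu0 : ∀ z, 0 ≤ u z)
    (hi : ∀ γ ∈ Γ, ∀ z : Half n, u (γ • z) = u z)
    (hint : IntegrableOn u (Subtype.val ⁻¹' F) (halfMeasure n))
    (h : ∫ z in Subtype.val ⁻¹' F, u z ∂halfMeasure n = 0) : u = 0 := by
  have := countable_transGroup (Γ := Γ)
  have hFD := hF.isFundamentalDomain
  have h1 := (setIntegral_eq_zero_iff_of_nonneg_ae (.of_forall hu0) hint).mp h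
  have h2 : halfMeasure n {z | u z ≠ 0} = 0 := by
    refine hFD.measure_zero_of_invariant _ (fun g => ?_) ?_
    · obtain ⟨γ, hγ, hg⟩ := exists_smul_eq g⁻¹
      ext z
      rw [Set.mem_smul_set_iff_inv_smul_mem, Set.mem_ofPred_eq, hg, hi γ hγ]
      rfl
    · have hm : MeasurableSet {z : Half n | u z ≠ 0} := (isOpen_ne_fun hu continuous_const).measurableSet
      rw [← Measure.restrict_apply hm]
      exact h1
  exact (hu.ae_eq_iff_eq (halfMeasure n) continuous_const).mp h2

theorem integrableOn_density (hφ : MemV L Γ α β φ) {F : Set (SymC n)}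
    (hF : IsFundDomain Γ F) (hfin : normSqOver α β φ F < ⊤) :
    IntegrableOn (density (α - β) (lift β φ)) (Subtype.val ⁻¹' F) (halfMeasure n) := by
  have hφ2 : ∀ z ∈ upperHalfSpace n, ContDiffAt ℝ 2 φ z := fun z hz => (hφ.analytic z hz).contDiffAt
  refine ⟨(continuous_density _ fun z hz =>
    (contDiffAt_lift hz (hφ2 z hz)).continuousAt).aestronglyMeasurable, ?_⟩
  rw [hasFiniteIntegral_iff_ofReal (.of_forall (density_nonneg _ _))]
  simp only [density_lift]
  rw [lintegral_fundDomain (fun z => ENNReal.ofReal ((imMat z).det ^ (α + β) * ‖φ z‖ ^ 2))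
    hF.measurableSet]
  exact hfin

theorem lift_eq_zero_iff {z : SymC n} (hz : z ∈ upperHalfSpace n) : lift β φ z = 0 ↔ φ z = 0 := by
  rw [lift, mul_eq_zero, or_iff_right]
  exact right_ne_zero_of_mul_eq_one (detY_neg_mul β hz)

theorem lift_eq_of_eq {f : SymC n → ℂ} {z : SymC n} (hz : z ∈ upperHalfSpace n)
    (h : φ z = (((imMat z).det ^ (-β) : ℝ) : ℂ) * f z) : lift β φ z = f z := by
  rw [lift, h]
  change detY β z * (detY (-β) z * f z) = f z
  rw [← mul_assoc, mul_comm (detY β z), detY_neg_mul β hz, one_mul]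

/-- For an eigenform, `∫ det (Y) ^ k |∂f/∂Z̄| ^ 2 = μ ∫ det (Y) ^ k |f| ^ 2` with a positive integral
on the right. -/
theorem exists_energy_ratio (hΓ : Subgroup.Commensurable Γ (SpZ n)) (hφ : MemH L Γ α β φ)
    (hl : IsEigenform α β φ l) : ∃ p q : ℝ, 0 < p ∧ 0 ≤ q ∧
      (l - n * β * (α - (n + 1) / 2)) * p = q ∧
      (q = 0 ↔ ∀ z ∈ upperHalfSpace n, grad (lift β φ) z = 0) := by
  have := countable_of_commensurable hΓ
  obtain ⟨F, hF, hfin⟩ := hφ.norm_lt_top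
  have hφ2 : ∀ z ∈ upperHalfSpace n, ContDiffAt ℝ 2 φ z := fun z hz => (hφ.analytic z hz).contDiffAt
  have hf2 : ∀ z ∈ upperHalfSpace n, ContDiffAt ℝ 2 (lift β φ) z := fun z hz =>
    contDiffAt_lift hz (hφ2 z hz)
  have hfd : ∀ z ∈ upperHalfSpace n, DifferentiableAt ℝ (lift β φ) z := fun z hz =>
    (hf2 z hz).differentiableAt (by norm_num)
  have hft : ∀ γ ∈ Γ, ∀ z ∈ upperHalfSpace n,
      lift β φ (act γ z) = L.detPow γ (α - β) z * lift β φ z :=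
    fun γ hγ z hz => lift_transform hz (hφ.transform γ hγ z hz)
  obtain ⟨h1, h2⟩ := energy_balance_lift hφ.toMemV hl.2 hF hfin
  have hint := integrableOn_density hφ.toMemV hF hfin
  refine ⟨_, _, ?_, integral_nonneg (energy_nonneg _ _), h2, ?_, ?_⟩
  · refine lt_of_le_of_ne (integral_nonneg (density_nonneg _ _)) fun h0 => ?_
    have h3 := eq_zero_of_setIntegral_eq_zero hF
      (continuous_density _ fun z hz => (hf2 z hz).continuousAt) (density_nonneg _ _)
      (fun γ hγ z => norm_sq_act z.2 (hft γ hγ z z.2)) hint h0.symm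
    obtain ⟨z, hz, hne⟩ := hl.1
    have h4 := congrFun h3 ⟨z, hz⟩
    have hp := Real.rpow_pos_of_pos (det_imMat_pos hz) (α - β)
    simp only [density, Pi.zero_apply, mul_eq_zero, hp.ne', false_or] at h4
    exact hne ((lift_eq_zero_iff hz).mp (by simpa using h4))
  · intro h0 z hz
    have h3 := eq_zero_of_setIntegral_eq_zero hF (continuous_energy _ hf2) (energy_nonneg _ _)
      (fun γ hγ z => gradSq_act z.2 hfd (hft γ hγ)) h1 h0
    have h4 := congrFun h3 ⟨z, hz⟩
    have hp := Real.rpow_pos_of_pos (det_imMat_pos hz) (α - β)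
    simp only [energy, Pi.zero_apply, mul_eq_zero, hp.ne', false_or] at h4
    exact eq_zero_of_gradSq hz h4
  · intro h0
    have h3 : energy (α - β) (lift β φ) = 0 := by
      funext z
      simp [energy, h0 z z.2, gradSq, gradForm]
    simp [h3]

theorem eigenvalue_real_and_ge (hΓ : Subgroup.Commensurable Γ (SpZ n)) (hφ : MemH L Γ α β φ)
    (hl : IsEigenform α β φ l) : l.im = 0 ∧ n * β * (α - (n + 1) / 2) ≤ l.re := by
  obtain ⟨p, q, hp, hq, h, -⟩ := exists_energy_ratio hΓ hφ hl
  have hp' : (p : ℂ) ≠ 0 := by exact_mod_cast hp.ne'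
  have h1 : l = ((n * β * (α - (n + 1) / 2) + q / p : ℝ) : ℂ) := by
    push_cast
    field_simp
    linear_combination 2 * h
  rw [h1]
  refine ⟨Complex.ofReal_im _, ?_⟩
  rw [Complex.ofReal_re]
  have := div_nonneg hq hp.le
  linarith

theorem eigenvalue_eq_iff (hΓ : Subgroup.Commensurable Γ (SpZ n)) (hφ : MemH L Γ α β φ)
    (hl : IsEigenform α β φ l) : l = ((n * β * (α - (n + 1) / 2) : ℝ) : ℂ) ↔
      ∀ z ∈ upperHalfSpace n, grad (lift β φ) z = 0 := by
  obtain ⟨p, q, hp, hq, h, hiff⟩ := exists_energy_ratio hΓ hφ hl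
  have hp' : (p : ℂ) ≠ 0 := by exact_mod_cast hp.ne'
  rw [← hiff]
  have e : ((n * β * (α - (n + 1) / 2) : ℝ) : ℂ) = n * β * (α - (n + 1) / 2) := by push_cast; ring
  rw [e, ← sub_eq_zero]
  constructor
  · intro h0
    rw [h0, zero_mul] at h
    exact_mod_cast h.symm
  · rintro rfl
    exact (mul_eq_zero.mp (h.trans (by simp))).resolve_right hp'

theorem grad_lift_eq_zero_iff_opLambda (hφ : MemV L Γ α β φ) :
    (∀ z ∈ upperHalfSpace n, grad (lift β φ) z = 0) ↔
      ∀ z ∈ upperHalfSpace n, opLambda β (scalarMat φ) z = 0 :=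
  forall₂_congr fun z hz => (opLambda_eq_zero_iff hz
    (((hφ.analytic z hz).contDiffAt (n := 1)).differentiableAt (by norm_num))).symm

theorem grad_lift_eq_zero_iff_holomorphic (hφ : MemV L Γ α β φ) :
    (∀ z ∈ upperHalfSpace n, grad (lift β φ) z = 0) ↔
      ∃ f : SymC n → ℂ, IsHolomorphicAutomorphic L Γ (α - β) f ∧
        ∀ z ∈ upperHalfSpace n, φ z = (((imMat z).det ^ (-β) : ℝ) : ℂ) * f z := by
  constructor
  · intro h
    refine ⟨lift β φ, ⟨fun z hz => ?_, fun γ hγ z hz =>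
      lift_transform hz (hφ.transform γ hγ z hz)⟩, fun z hz => ?_⟩
    · exact (differentiableAt_of_grad_eq_zero ((contDiffAt_lift hz
        ((hφ.analytic z hz).contDiffAt (n := 1))).differentiableAt (by norm_num))
        (h z hz)).differentiableWithinAt
    · change φ z = detY (-β) z * (detY β z * φ z)
      rw [← mul_assoc, detY_neg_mul β hz, one_mul]
  · rintro ⟨f, hf, h⟩ z hz
    have h1 : lift β φ =ᶠ[nhds z] f := by
      filter_upwards [(isOpen_upperHalfSpace n).mem_nhds hz] with w hw
      exact lift_eq_of_eq hw (h w hw)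
    rw [grad_congr h1]
    exact grad_eq_zero_of_differentiableAt
      (hf.holomorphic.differentiableAt ((isOpen_upperHalfSpace n).mem_nhds hz))

end Eigenvalue

end SiegelMaass
end

/-! ### Counting integral symplectic matrices with bounded conjugates -/

noncomputable section

namespace SiegelMaass

variable {n : ℕ}

/-! ### Packing -/

section Packing

variable {ι : Type*} [Fintype ι]

theorem card_mul_le_of_pairwiseDisjoint {α : Type*} {s : Finset α} {Q : α → Set (ι → ℝ)}
    {T : Set (ι → ℝ)} {v V : ℝ} (hV : 0 ≤ V) (hm : ∀ a ∈ s, MeasurableSet (Q a))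
    (hd : (s : Set α).PairwiseDisjoint Q) (hq : ∀ a ∈ s, volume (Q a) = ENNReal.ofReal v)
    (hT : ∀ a ∈ s, Q a ⊆ T) (hvol : volume T ≤ ENNReal.ofReal V) : s.card * v ≤ V := by
  have h1 : volume (⋃ a ∈ s, Q a) = s.card * ENNReal.ofReal v := by
    rw [measure_biUnion_finset hd hm, Finset.sum_congr rfl hq]
    simp
  have h2 : volume (⋃ a ∈ s, Q a) ≤ ENNReal.ofReal V :=
    (measure_mono (Set.iUnion₂_subset hT)).trans hvol
  rw [h1, ← ENNReal.ofReal_natCast, ← ENNReal.ofReal_mul (by positivity)] at h2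
  exact (ENNReal.ofReal_le_ofReal_iff hV).mp h2

/-- The half-open unit cubes at the integral points are disjoint and lie in the preimage of a ball
of radius K + c, whose volume is known. -/
theorem card_le_of_norm_apply_le {P : (ι → ℝ) →ₗ[ℝ] (ι → ℝ)} (hP : LinearMap.det P ≠ 0) {c K : ℝ}
    (hc0 : 0 ≤ c) (hK : 0 ≤ K) (hc : ∀ u : ι → ℝ, (∀ i, |u i| ≤ 1) → ‖P u‖ ≤ c)
    (s : Finset (ι → ℤ)) (hs : ∀ v ∈ s, ‖P fun i => (v i : ℝ)‖ ≤ K) :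
    (s.card : ℝ) ≤ |(LinearMap.det P)⁻¹| * (2 * (K + c)) ^ Fintype.card ι := by
  have h := card_mul_le_of_pairwiseDisjoint (s := s)
    (Q := fun v => Set.univ.pi fun i => Set.Ico (v i : ℝ) (v i + 1))
    (T := P ⁻¹' Metric.closedBall 0 (K + c)) (v := 1)
    (V := |(LinearMap.det P)⁻¹| * (2 * (K + c)) ^ Fintype.card ι) (by positivity)
    (fun v _ => MeasurableSet.univ_pi fun i => measurableSet_Ico) ?_ ?_ ?_ ?_
  · simpa using h
  · intro v _ w _ hne
    refine Set.disjoint_left.mpr fun x hx hy => hne (funext fun i => ?_)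
    have h1 := hx i (Set.mem_univ i)
    have h2 := hy i (Set.mem_univ i)
    rw [← Int.floor_eq_iff.mpr ⟨h1.1, h1.2⟩, Int.floor_eq_iff.mpr ⟨h2.1, h2.2⟩]
  · intro v _
    rw [Real.volume_pi_Ico]
    simp
  · intro v hv x hx
    have e : x = (fun i => (v i : ℝ)) + (x - fun i => (v i : ℝ)) := by abel
    rw [Set.mem_preimage, mem_closedBall_zero_iff, e, map_add]
    refine (norm_add_le _ _).trans (add_le_add (hs v hv) (hc _ fun i => ?_))
    have h1 := hx i (Set.mem_univ i)
    rw [Pi.sub_apply, abs_le]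
    constructor <;> linarith [h1.1, h1.2]
  · rw [Measure.addHaar_preimage_linearMap _ hP, Real.volume_pi_closedBall _ (by positivity),
      ENNReal.ofReal_mul (by positivity)]

/-- Balls of radius δ/2 around the points are disjoint and lie in a ball whose radius is a fixed
multiple of δ, so δ drops out of the bound. -/
theorem card_le_of_separated (s : Finset (ι → ℝ)) {δ K : ℝ} (hδ : 0 < δ) (hK : 0 ≤ K)
    (hsep : ∀ x ∈ s, ∀ y ∈ s, x ≠ y → δ ≤ ‖x - y‖) (hs : ∀ x ∈ s, ‖x‖ ≤ K * δ) :
    (s.card : ℝ) ≤ (2 * K + 1) ^ Fintype.card ι := by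
  have h := card_mul_le_of_pairwiseDisjoint (s := s) (Q := fun x => Metric.ball x (δ / 2))
    (T := Metric.closedBall 0 ((K + 1 / 2) * δ)) (v := δ ^ Fintype.card ι)
    (V := (2 * ((K + 1 / 2) * δ)) ^ Fintype.card ι) (by positivity)
    (fun v _ => measurableSet_ball) ?_ ?_ ?_ ?_
  · have e : (2 * ((K + 1 / 2) * δ)) ^ Fintype.card ι =
        (2 * K + 1) ^ Fintype.card ι * δ ^ Fintype.card ι := by rw [← mul_pow]; ring
    rw [e] at h
    exact le_of_mul_le_mul_right h (by positivity)
  · intro x hx y hy hne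
    refine Metric.ball_disjoint_ball ?_
    rw [dist_eq_norm]
    linarith [hsep x hx y hy hne]
  · intro x _
    rw [Real.volume_pi_ball _ (by positivity)]
    congr 2
    ring
  · intro x hx y hy
    rw [mem_closedBall_zero_iff]
    rw [mem_ball_iff_norm] at hy
    have : y = x + (y - x) := by abel
    rw [this]
    refine (norm_add_le _ _).trans ?_
    linarith [hs x hx]
  · rw [Real.volume_pi_closedBall _ (by positivity)]

theorem card_le_mul_of_fiber {α β : Type*} [DecidableEq β] (s : Finset α) (f : α → β) {x y : ℝ}
    (hx : 0 ≤ x) (h1 : ∀ b, ((s.filter (f · = b)).card : ℝ) ≤ x)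
    (h2 : ((s.image f).card : ℝ) ≤ y) : (s.card : ℝ) ≤ y * x := by
  rw [Finset.card_eq_sum_card_image f s]
  push_cast
  refine (Finset.sum_le_card_nsmul _ _ x fun b _ => h1 b).trans ?_
  rw [nsmul_eq_mul]
  exact mul_le_mul_of_nonneg_right h2 hx

end Packing

/-! ### Counting integral matrices -/

theorem abs_mul_apply_le {l m o : Type*} [Fintype m] {M : Matrix l m ℝ} {N : Matrix m o ℝ}
    {a b : ℝ} (ha : 0 ≤ a) (hM : ∀ i j, |M i j| ≤ a) (hN : ∀ i j, |N i j| ≤ b) (i : l) (j : o) :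
    |(M * N) i j| ≤ Fintype.card m * (a * b) := by
  rw [Matrix.mul_apply]
  refine (Finset.abs_sum_le_sum_abs _ _).trans ?_
  rw [← nsmul_eq_mul, Fintype.card, ← Finset.sum_const]
  refine Finset.sum_le_sum fun k _ => ?_
  rw [abs_mul]
  exact mul_le_mul (hM i k) (hN k j) (abs_nonneg _) ha

theorem norm_mulVec_le {m o : Type*} [Fintype m] [Fintype o] {M : Matrix m o ℝ} {a : ℝ}
    (hM : ∀ i j, |M i j| ≤ a) (ha : 0 ≤ a) (v : o → ℝ) :
    ‖M *ᵥ v‖ ≤ Fintype.card o * (a * ‖v‖) := by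
  rw [pi_norm_le_iff_of_nonneg (by positivity)]
  intro i
  rw [Matrix.mulVec, dotProduct, Real.norm_eq_abs]
  refine (Finset.abs_sum_le_sum_abs _ _).trans ?_
  rw [← nsmul_eq_mul, Fintype.card, ← Finset.sum_const]
  refine Finset.sum_le_sum fun k _ => ?_
  rw [abs_mul]
  exact mul_le_mul (hM i k) (norm_le_pi_norm v k) (abs_nonneg _) ha

theorem exists_card_intMatrix_le (n : ℕ) (K : ℝ) : ∃ C : ℝ, 0 ≤ C ∧
    ∀ u : Finset (Matrix (Fin n) (Fin n) ℤ), (∀ M ∈ u, ∀ i j, |((M i j : ℤ) : ℝ)| ≤ K) →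
      (u.card : ℝ) ≤ C := by
  let T : Finset (Matrix (Fin n) (Fin n) ℤ) := (Fintype.piFinset fun _ : Fin n =>
    Fintype.piFinset fun _ : Fin n => Finset.Icc (-⌈K⌉) ⌈K⌉ : Finset (Fin n → Fin n → ℤ))
  refine ⟨T.card, by positivity, fun u hu => ?_⟩
  have : u ⊆ T := by
    intro M hM
    refine Fintype.mem_piFinset.mpr fun i => Fintype.mem_piFinset.mpr fun j => ?_
    have h := abs_le.mp ((hu M hM i j).trans (Int.le_ceil K))
    rw [Finset.mem_Icc]
    exact ⟨by exact_mod_cast h.1, by exact_mod_cast h.2⟩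
  exact_mod_cast Finset.card_le_card this

/-- The map V ↦ A⁻¹ V A⁻ᵀ on symmetric matrices has determinant det(A)^(-(n+1)); a bound on A⁻¹
bounds the image of the unit cube independently of A. -/
theorem exists_card_symMat_le (n : ℕ) {c₀ K : ℝ} (hc₀ : 0 ≤ c₀) (hK : 0 ≤ K) : ∃ C : ℝ, 0 ≤ C ∧
    ∀ A : Matrix (Fin n) (Fin n) ℝ, IsUnit A.det → (∀ i j, |A⁻¹ i j| ≤ c₀) →
    ∀ u : Finset (Sym2 (Fin n) → ℤ),
      (∀ v ∈ u, ∀ i j, |(A⁻¹ * symMat (fun p => (v p : ℝ)) * (Aᵀ)⁻¹) i j| ≤ K) →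
      (u.card : ℝ) ≤ C * |A.det| ^ (n + 1) := by
  set c : ℝ := n * (n * (c₀ * 1) * c₀) with hc
  refine ⟨(2 * (K + c)) ^ Fintype.card (Sym2 (Fin n)), by positivity, fun A hA hA0 u hu => ?_⟩
  have hT : ((Aᵀ)⁻¹)ᵀ = A⁻¹ := by rw [Matrix.transpose_nonsing_inv, Matrix.transpose_transpose]
  have hA1 (i j : Fin n) : |(Aᵀ)⁻¹ i j| ≤ c₀ := by
    have := hA0 j i
    rwa [← hT] at this
  have hdet : LinearMap.det (symCongr (Aᵀ)⁻¹) = (A.det)⁻¹ ^ (n + 1) := by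
    rw [det_symCongr, Matrix.det_nonsing_inv, Ring.inverse_eq_inv', Matrix.det_transpose]
  have entry {w : Sym2 (Fin n) → ℝ} {b : ℝ} (hb : 0 ≤ b)
      (h : ∀ i j, |(A⁻¹ * symMat w * (Aᵀ)⁻¹) i j| ≤ b) : ‖symCongr (Aᵀ)⁻¹ w‖ ≤ b := by
    rw [pi_norm_le_iff_of_nonneg hb]
    intro p
    have h1 := h p.inf p.sup
    have h2 : (symCongr (Aᵀ)⁻¹ w) p = (((Aᵀ)⁻¹)ᵀ * symMat w * (Aᵀ)⁻¹) p.inf p.sup := rfl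
    rw [h2, hT]
    exact h1
  have h := card_le_of_norm_apply_le (P := symCongr (Aᵀ)⁻¹) (c := c) (K := K)
    (by rw [hdet]; exact pow_ne_zero _ (inv_ne_zero hA.ne_zero)) (by positivity) hK ?_ u ?_
  · rw [hdet, ← inv_pow, inv_inv, abs_pow, mul_comm] at h
    exact h
  · intro w hw
    refine entry (by positivity) fun i j => ?_
    have h1 := abs_mul_apply_le (b := 1) hc₀ hA0 (fun i j => hw s(i, j)) (N := symMat w)
    have h2 := abs_mul_apply_le (by positivity) h1 hA1 i j
    simpa [hc] using h2
  · exact fun v hv => entry hK (hu v hv)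

/-- An almost shortest nonzero vector of the lattice `A⁻¹ ℤⁿ`. -/
theorem exists_almost_shortest (hn : 1 ≤ n) {A : Matrix (Fin n) (Fin n) ℝ} (hA : IsUnit A.det) :
    ∃ (m : Fin n → ℤ) (δ : ℝ), m ≠ 0 ∧ 0 < δ ∧ ‖A⁻¹ *ᵥ fun i => (m i : ℝ)‖ ≤ 2 * δ ∧
      ∀ w : Fin n → ℤ, w ≠ 0 → δ ≤ ‖A⁻¹ *ᵥ fun i => (w i : ℝ)‖ := by
  have hlow : ∃ ε : ℝ, 0 < ε ∧ ∀ w : Fin n → ℤ, w ≠ 0 → ε ≤ ‖A⁻¹ *ᵥ fun i => (w i : ℝ)‖ := by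
    set T := LinearMap.toContinuousLinearMap (Matrix.toLin' A)
    refine ⟨(‖T‖ + 1)⁻¹, by positivity, fun w hw => ?_⟩
    have h1 := T.le_opNorm (A⁻¹ *ᵥ fun i => (w i : ℝ))
    have h2 : T (A⁻¹ *ᵥ fun i => (w i : ℝ)) = fun i => (w i : ℝ) := by
      change Matrix.toLin' A _ = _
      rw [Matrix.toLin'_apply, Matrix.mulVec_mulVec, Matrix.mul_nonsing_inv _ hA,
        Matrix.one_mulVec]
    rw [h2] at h1
    obtain ⟨i, hi⟩ := Function.ne_iff.mp hw
    have h3 : (1 : ℝ) ≤ ‖fun i => (w i : ℝ)‖ := by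
      refine le_trans ?_ (norm_le_pi_norm (fun i => (w i : ℝ)) i)
      rw [Real.norm_eq_abs]
      exact_mod_cast Int.one_le_abs hi
    rw [inv_le_iff_one_le_mul₀ (by positivity)]
    nlinarith [norm_nonneg (A⁻¹ *ᵥ fun i => (w i : ℝ))]
  obtain ⟨ε, hε, hlow⟩ := hlow
  set S : Set ℝ := (fun w : Fin n → ℤ => ‖A⁻¹ *ᵥ fun i => (w i : ℝ)‖) '' {w | w ≠ 0} with hS
  have hne : S.Nonempty := ⟨_, Pi.single ⟨0, hn⟩ 1, by simp, rfl⟩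
  have hbdd : BddBelow S := ⟨ε, by rintro _ ⟨w, hw, rfl⟩; exact hlow w hw⟩
  have hpos : 0 < sInf S :=
    hε.trans_le (le_csInf hne (by rintro _ ⟨w, hw, rfl⟩; exact hlow w hw))
  obtain ⟨_, ⟨m, hm, rfl⟩, hlt⟩ := exists_lt_of_csInf_lt hne (by linarith : sInf S < 2 * sInf S)
  exact ⟨m, sInf S, hm, hpos, hlt.le, fun w hw => csInf_le hbdd ⟨w, hw, rfl⟩⟩

/-- Counting the n rows of D separately would give |det A|^n. One factor is saved because D acts on
the lattice A⁻¹ℤⁿ through the bounded matrix Eᵀ: an almost shortest vector m goes to a vector of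
comparable length, and only boundedly many lattice vectors are that short. -/
theorem exists_card_conj_le (hn : 1 ≤ n) {c₀ K : ℝ} (hc₀ : 0 ≤ c₀) (hK : 0 ≤ K) : ∃ C : ℝ, 0 ≤ C ∧
    ∀ A : Matrix (Fin n) (Fin n) ℝ, IsUnit A.det → (∀ i j, |A⁻¹ i j| ≤ c₀) →
    ∀ u : Finset (Matrix (Fin n) (Fin n) ℤ),
      (∀ D ∈ u, ∃ E : Matrix (Fin n) (Fin n) ℝ, (∀ i j, |E i j| ≤ K) ∧
        D.map ((↑) : ℤ → ℝ) * (Aᵀ)⁻¹ = (Aᵀ)⁻¹ * E) →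
      (u.card : ℝ) ≤ C * |A.det| ^ (n - 1) := by
  classical
  set C₁ : ℝ := (2 * (n * (c₀ * K) + n * (c₀ * 1))) ^ n with hC₁
  set C₂ : ℝ := (2 * (2 * (n * K)) + 1) ^ n with hC₂
  refine ⟨C₂ * C₁ ^ (n - 1), by positivity, fun A hA hA0 u hu => ?_⟩
  have hT : ((Aᵀ)⁻¹)ᵀ = A⁻¹ := by rw [Matrix.transpose_nonsing_inv, Matrix.transpose_transpose]
  have hA1 (i j : Fin n) : |(Aᵀ)⁻¹ i j| ≤ c₀ := by
    have := hA0 j i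
    rwa [← hT] at this
  obtain ⟨m, δ, hm, hδ, hmδ, hδ'⟩ := exists_almost_shortest hn hA
  obtain ⟨j, hj⟩ := Function.ne_iff.mp hm
  set W : Finset (Fin n → ℤ) := u.biUnion fun D => Finset.univ.image fun i => D i with hW
  set V : Finset (Fin n → ℤ) := u.image fun D => m ᵥ* D with hV
  have hvec (w : Fin n → ℝ) : A⁻¹ *ᵥ w = w ᵥ* (Aᵀ)⁻¹ := by rw [← hT, Matrix.mulVec_transpose]
  -- Each row of D becomes bounded after applying A⁻¹, so the possible rows are counted by a volume
  -- proportional to |det A|.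
  have hWc : (W.card : ℝ) ≤ |A.det| * C₁ := by
    have hdet : LinearMap.det (Matrix.toLin' A⁻¹) = (A.det)⁻¹ := by
      rw [LinearMap.det_toLin', Matrix.det_nonsing_inv, Ring.inverse_eq_inv']
    have h := card_le_of_norm_apply_le (P := Matrix.toLin' A⁻¹) (c := n * (c₀ * 1))
      (K := n * (c₀ * K)) (by rw [hdet]; exact inv_ne_zero hA.ne_zero) (by positivity)
      (by positivity) ?_ W ?_
    · rw [hdet, inv_inv, Fintype.card_fin] at h
      exact h
    · intro w hw
      rw [Matrix.toLin'_apply]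
      refine (norm_mulVec_le hA0 hc₀ w).trans ?_
      rw [Fintype.card_fin]
      gcongr
      exact (pi_norm_le_iff_of_nonneg zero_le_one).mpr hw
    · intro v hv
      simp only [hW, Finset.mem_biUnion, Finset.mem_image, Finset.mem_univ, true_and] at hv
      obtain ⟨D, hD, i, rfl⟩ := hv
      obtain ⟨E, hE, e⟩ := hu D hD
      rw [Matrix.toLin'_apply, hvec, pi_norm_le_iff_of_nonneg (by positivity)]
      intro k
      have h1 : ((fun l => ((D i l : ℤ) : ℝ)) ᵥ* (Aᵀ)⁻¹) k =
          (D.map ((↑) : ℤ → ℝ) * (Aᵀ)⁻¹) i k := rfl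
      rw [h1, e]
      have := abs_mul_apply_le hc₀ hA1 hE i k
      rwa [Fintype.card_fin] at this
  have hinj : Function.Injective fun w : Fin n → ℤ => A⁻¹ *ᵥ fun i => (w i : ℝ) := by
    intro w w' h
    have h1 := congrArg (A *ᵥ ·) h
    simp only [Matrix.mulVec_mulVec, Matrix.mul_nonsing_inv _ hA, Matrix.one_mulVec] at h1
    funext i
    exact_mod_cast congrFun h1 i
  -- The vectors A⁻¹(mD) have norm at most a fixed multiple of δ, and distinct ones differ by at
  -- least δ.
  have hVc : (V.card : ℝ) ≤ C₂ := by
    rw [← Finset.card_image_of_injective V hinj]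
    have h := card_le_of_separated (V.image fun w : Fin n → ℤ => A⁻¹ *ᵥ fun i => (w i : ℝ))
      (K := 2 * (n * K)) hδ (by positivity) ?_ ?_
    · rwa [Fintype.card_fin] at h
    · intro x hx y hy hxy
      obtain ⟨v, -, rfl⟩ := Finset.mem_image.mp hx
      obtain ⟨w, -, rfl⟩ := Finset.mem_image.mp hy
      rw [← Matrix.mulVec_sub]
      have h1 := hδ' (v - w) (sub_ne_zero.mpr fun h => hxy (by rw [h]))
      convert h1 using 3
      funext i
      simp
    · intro x hx
      obtain ⟨v, hv, rfl⟩ := Finset.mem_image.mp hx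
      obtain ⟨D, hD, rfl⟩ := Finset.mem_image.mp hv
      obtain ⟨E, hE, e⟩ := hu D hD
      have h1 : (fun i => (((m ᵥ* D) i : ℤ) : ℝ)) = (fun i => (m i : ℝ)) ᵥ* D.map ((↑) : ℤ → ℝ) := by
        funext i
        simp [Matrix.vecMul, dotProduct]
      rw [hvec, h1, Matrix.vecMul_vecMul, e, ← Matrix.vecMul_vecMul, ← hvec,
        ← Matrix.mulVec_transpose]
      refine (norm_mulVec_le (fun i j => hE j i) hK _).trans ?_
      rw [Fintype.card_fin]
      calc (n : ℝ) * (K * ‖A⁻¹ *ᵥ fun i => (m i : ℝ)‖) ≤ n * (K * (2 * δ)) := by gcongr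
        _ = _ := by ring
  -- Since `m j` is nonzero, row `j` of D is recovered from m D and the other n - 1 rows.
  have hcard : u.card ≤ V.card * W.card ^ (n - 1) := by
    have h1 : u.card ≤ (V ×ˢ Fintype.piFinset fun _ : {i : Fin n // i ≠ j} => W).card := by
      refine Finset.card_le_card_of_injOn (fun D => (m ᵥ* D, fun i => D i)) ?_ ?_
      · intro D hD
        refine Finset.mem_coe.mpr (Finset.mem_product.mpr
          ⟨Finset.mem_image_of_mem _ hD, Fintype.mem_piFinset.mpr fun i => ?_⟩)
        exact Finset.mem_biUnion.mpr ⟨D, hD, Finset.mem_image_of_mem _ (Finset.mem_univ _)⟩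
      · intro D _ D' _ h
        simp only [Prod.mk.injEq] at h
        obtain ⟨h2, h3⟩ := h
        have hrow (i : Fin n) (hi : i ≠ j) : D i = D' i := congrFun h3 ⟨i, hi⟩
        ext i k
        by_cases hi : i = j
        · subst hi
          have h4 := congrFun h2 k
          simp only [Matrix.vecMul, dotProduct] at h4
          rw [← Finset.add_sum_erase _ _ (Finset.mem_univ i),
            ← Finset.add_sum_erase _ _ (Finset.mem_univ i)] at h4
          have h5 : ∑ l ∈ Finset.univ.erase i, m l * D l k =
              ∑ l ∈ Finset.univ.erase i, m l * D' l k :=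
            Finset.sum_congr rfl fun l hl => by rw [hrow l (Finset.ne_of_mem_erase hl)]
          rw [h5] at h4
          exact mul_left_cancel₀ hj (add_right_cancel h4)
        · rw [hrow i hi]
    refine h1.trans (le_of_eq ?_)
    rw [Finset.card_product, Fintype.card_piFinset]
    simp [Fintype.card_subtype_compl]
  calc (u.card : ℝ) ≤ V.card * (W.card : ℝ) ^ (n - 1) := by exact_mod_cast hcard
    _ ≤ C₂ * (|A.det| * C₁) ^ (n - 1) := by gcongr
    _ = _ := by rw [mul_pow]; ring

end SiegelMaass
end

noncomputable section

namespace SiegelMaass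

variable {n : ℕ}

/-! ### Counting elements of `Sp_n(ℤ)` -/

theorem exists_int_of_mem_SpZ {γ : SpR n} (h : γ ∈ SpZ n) (i j : Fin n ⊕ Fin n) :
    ((⌊γ.1 i j⌋ : ℤ) : ℝ) = γ.1 i j := by
  obtain ⟨M, -, hM⟩ := h
  rw [← hM]
  simp

theorem inv_eq_fromBlocks (γ : SpR n) :
    (γ⁻¹).1 = fromBlocks (blockD γ)ᵀ (-(blockB γ)ᵀ) (-(blockC γ)ᵀ) (blockA γ)ᵀ := by
  rw [SymplecticGroup.coe_inv, ← fromBlocks_block γ]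
  simp [J, fromBlocks_transpose, fromBlocks_multiply, fromBlocks_neg, blockA, blockB, blockC, blockD]

theorem abs_inv_apply_le {γ : SpR n} {K : ℝ} (h : ∀ i j, |γ.1 i j| ≤ K) (i j : Fin n ⊕ Fin n) :
    |(γ⁻¹).1 i j| ≤ K := by
  rw [inv_eq_fromBlocks]
  rcases i with i | i <;> rcases j with j | j
  · exact h (.inr j) (.inr i)
  · have := h (.inl j) (.inr i)
    simpa [blockB, toBlocks₁₂] using this
  · have := h (.inr j) (.inl i)
    simpa [blockC, toBlocks₂₁] using this
  · exact h (.inl j) (.inl i)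

theorem blocks_one : blockA (1 : SpR n) = 1 ∧ blockB (1 : SpR n) = 0 ∧
    blockC (1 : SpR n) = 0 ∧ blockD (1 : SpR n) = 1 := by
  refine ⟨?_, ?_, ?_, ?_⟩ <;> ext i j <;>
    simp [blockA, blockB, blockC, blockD, toBlocks₁₁, toBlocks₁₂, toBlocks₂₁, toBlocks₂₂,
      Matrix.one_apply]

/-- Two symplectic matrices with the same lower blocks differ by a translation. -/
theorem blocks_mul_inv_of_eq {η η₀ : SpR n} (hC : blockC η = blockC η₀)
    (hD : blockD η = blockD η₀) :
    blockA (η * η₀⁻¹) = 1 ∧ (blockB (η * η₀⁻¹))ᵀ = blockB (η * η₀⁻¹) ∧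
      blockC (η * η₀⁻¹) = 0 ∧ blockD (η * η₀⁻¹) = 1 := by
  have h1 := blockA_mul η η₀⁻¹
  have h2 := blockA_mul η₀ η₀⁻¹
  rw [mul_inv_cancel] at h2
  have hc : blockC (η * η₀⁻¹) = 0 := by
    rw [h1.2.2.1, hC, hD, ← h2.2.2.1]; exact blocks_one.2.2.1
  have hd : blockD (η * η₀⁻¹) = 1 := by
    rw [h1.2.2.2, hC, hD, ← h2.2.2.2]; exact blocks_one.2.2.2
  obtain ⟨-, h3, h4⟩ := block_relations (η * η₀⁻¹)
  rw [hc, hd] at h4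
  rw [hd] at h3
  refine ⟨?_, by simpa using h3, hc, hd⟩
  have := congrArg Matrix.transpose h4
  simpa using this

/-- The exponent is 2n = 0 + (n - 1) + (n + 1): boundedly many blocks C, then |det A|^(n-1) blocks D
for given C, then |det A|^(n+1) elements for given C and D, which differ by integral translations.
-/
theorem exists_card_SpZ_le (hn : 1 ≤ n) {c₀ K : ℝ} (hc₀ : 0 ≤ c₀) (hK : 0 ≤ K) :
    ∃ C : ℝ, 0 ≤ C ∧
    ∀ (A X : Matrix (Fin n) (Fin n) ℝ) (hA : IsUnit A.det) (hX : Xᵀ = X),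
      (∀ i j, |A⁻¹ i j| ≤ c₀) → ∀ s : Finset (SpR n),
      (∀ η ∈ s, η ∈ SpZ n ∧
        ∀ i j, |((affineSp A X hA hX)⁻¹ * η * affineSp A X hA hX).1 i j| ≤ K) →
      (s.card : ℝ) ≤ C * |A.det| ^ (2 * n) := by
  classical
  obtain ⟨C₁, hC₁, h₁⟩ := exists_card_intMatrix_le n (n * (n * (c₀ * K) * c₀))
  obtain ⟨C₂, hC₂, h₂⟩ := exists_card_conj_le hn hc₀ (K := K + K) (by positivity)
  obtain ⟨C₃, hC₃, h₃⟩ := exists_card_symMat_le n hc₀ (K := (n + n) * (K * K)) (by positivity)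
  refine ⟨C₁ * (C₂ * C₃), by positivity, fun A X hA hX hA0 s hs => ?_⟩
  set τ := affineSp A X hA hX with hτ
  have hT : ((Aᵀ)⁻¹)ᵀ = A⁻¹ := by rw [Matrix.transpose_nonsing_inv, Matrix.transpose_transpose]
  have hA1 (i j : Fin n) : |(Aᵀ)⁻¹ i j| ≤ c₀ := by
    have := hA0 j i
    rwa [← hT] at this
  have hA' : IsUnit Aᵀ.det := by rwa [Matrix.det_transpose]
  have tA : blockA τ = A := by simp [hτ, affineSp, blockA]
  have tB : blockB τ = X * (Aᵀ)⁻¹ := by simp [hτ, affineSp, blockB]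
  have tC : blockC τ = 0 := by simp [hτ, affineSp, blockC]
  have tD : blockD τ = (Aᵀ)⁻¹ := by simp [hτ, affineSp, blockD]
  set ρ : SpR n → SpR n := fun η => τ⁻¹ * η * τ with hρ
  have hmul (η : SpR n) : η * τ = τ * ρ η := by simp only [hρ]; group
  have cC (η : SpR n) : blockC η * A = (Aᵀ)⁻¹ * blockC (ρ η) := by
    have e1 := (blockA_mul η τ).2.2.1
    have e2 := (blockA_mul τ (ρ η)).2.2.1
    rw [← hmul, e1, tC, tD, tA] at e2
    simpa using e2
  have cD (η : SpR n) : blockC η * (X * (Aᵀ)⁻¹) + blockD η * (Aᵀ)⁻¹ =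
      (Aᵀ)⁻¹ * blockD (ρ η) := by
    have e1 := (blockA_mul η τ).2.2.2
    have e2 := (blockA_mul τ (ρ η)).2.2.2
    rw [← hmul, e1, tC, tD, tB] at e2
    simpa using e2
  set fC : SpR n → Matrix (Fin n) (Fin n) ℤ := fun η => (blockC η).map Int.floor with hfC
  set fD : SpR n → Matrix (Fin n) (Fin n) ℤ := fun η => (blockD η).map Int.floor with hfD
  have eC {η : SpR n} (h : η ∈ SpZ n) : (fC η).map ((↑) : ℤ → ℝ) = blockC η := by
    ext i j; exact exists_int_of_mem_SpZ h _ _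
  have eD {η : SpR n} (h : η ∈ SpZ n) : (fD η).map ((↑) : ℤ → ℝ) = blockD η := by
    ext i j; exact exists_int_of_mem_SpZ h _ _
  have ha := abs_nonneg A.det
  -- The quotient of two elements with the same C and D is a translation. Conjugation by τ turns its
  -- block B into A⁻¹ B A⁻ᵀ, an entry block of a product of two matrices bounded by K, whence (n +
  -- n) K².
  have fib2 (b d : Matrix (Fin n) (Fin n) ℤ) :
      ((((s.filter (fC · = b)).filter (fD · = d)).card : ℕ) : ℝ) ≤ C₃ * |A.det| ^ (n + 1) := by
    set t := (s.filter (fC · = b)).filter (fD · = d) with ht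
    rcases t.eq_empty_or_nonempty with h0 | ⟨η₀, hη₀⟩
    · rw [h0]; simp only [Finset.card_empty, Nat.cast_zero]; positivity
    have mem {η : SpR n} (h : η ∈ t) : η ∈ s ∧ fC η = b ∧ fD η = d := by
      simpa [ht, and_assoc] using h
    have bl {η : SpR n} (h : η ∈ t) := blocks_mul_inv_of_eq (η := η) (η₀ := η₀)
      (by rw [← eC (hs η (mem h).1).1, ← eC (hs η₀ (mem hη₀).1).1, (mem h).2.1, (mem hη₀).2.1])
      (by rw [← eD (hs η (mem h).1).1, ← eD (hs η₀ (mem hη₀).1).1, (mem h).2.2, (mem hη₀).2.2])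
    set g : SpR n → Sym2 (Fin n) → ℤ := fun η p => ⌊blockB (η * η₀⁻¹) p.inf p.sup⌋ with hg
    have gB {η : SpR n} (h : η ∈ t) :
        symMat (fun p => (g η p : ℝ)) = blockB (η * η₀⁻¹) := by
      have hZ : η * η₀⁻¹ ∈ SpZ n :=
        mul_mem (hs η (mem h).1).1 (inv_mem (hs η₀ (mem hη₀).1).1)
      have hi (i j : Fin n) : ((⌊blockB (η * η₀⁻¹) i j⌋ : ℤ) : ℝ) = blockB (η * η₀⁻¹) i j :=
        exists_int_of_mem_SpZ hZ _ _
      ext i j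
      simp only [symMat, Matrix.of_apply, hg, hi]
      rcases le_total i j with hij | hij
      · simp [hij]
      · simpa [hij] using congrFun (congrFun (bl h).2.1 i) j
    have hinj : Set.InjOn g t := by
      intro η h η' h' e
      have h1 : η * η₀⁻¹ = η' * η₀⁻¹ := by
        refine Subtype.ext ?_
        rw [← fromBlocks_block (η * η₀⁻¹), ← fromBlocks_block (η' * η₀⁻¹), ← gB h, ← gB h',
          (bl h).1, (bl h').1, (bl h).2.2.1, (bl h').2.2.1, (bl h).2.2.2, (bl h').2.2.2, e]
      exact mul_right_cancel h1
    rw [← Finset.card_image_of_injOn hinj]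
    refine h₃ A hA hA0 _ fun v hv i j => ?_
    obtain ⟨η, h, rfl⟩ := Finset.mem_image.mp hv
    rw [gB h]
    set θ := η * η₀⁻¹ with hθ
    have hω : ρ θ = ρ η * (ρ η₀)⁻¹ := by simp only [hρ, hθ]; group
    have e1 := blockA_mul θ τ
    have e2 := blockA_mul τ (ρ θ)
    rw [← hmul] at e2
    have e3 : blockD (ρ θ) = 1 := by
      have e4 := e2.2.2.2
      rw [e1.2.2.2, tC, tD, (bl h).2.2.1, (bl h).2.2.2] at e4
      simp only [Matrix.zero_mul, zero_add, Matrix.one_mul] at e4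
      have e5 := congrArg (Aᵀ * ·) e4
      simp only [← Matrix.mul_assoc, Matrix.mul_nonsing_inv _ hA', Matrix.one_mul] at e5
      exact e5.symm
    have e6 : A⁻¹ * blockB θ * (Aᵀ)⁻¹ = blockB (ρ θ) := by
      have e4 := e2.2.1
      rw [e1.2.1, tA, tB, tD, (bl h).1, e3, Matrix.one_mul, Matrix.mul_one,
        add_comm (X * (Aᵀ)⁻¹), add_left_inj] at e4
      rw [Matrix.mul_assoc, e4, ← Matrix.mul_assoc, Matrix.nonsing_inv_mul _ hA, Matrix.one_mul]
    rw [e6]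
    have h5 := abs_mul_apply_le hK (hs η (mem h).1).2
      (abs_inv_apply_le (hs η₀ (mem hη₀).1).2) (.inl i) (.inr j)
    have e7 : blockB (ρ θ) i j = ((ρ η).1 * ((ρ η₀)⁻¹).1) (.inl i) (.inr j) := by rw [hω]; rfl
    rw [Fintype.card_sum, Fintype.card_fin, Nat.cast_add] at h5
    rw [e7]
    exact h5
  -- With C fixed, the term containing X cancels in differences of D, and these are conjugate by A⁻ᵀ
  -- to matrices with entries at most K + K.
  have fib1 (b : Matrix (Fin n) (Fin n) ℤ) : (((s.filter (fC · = b)).card : ℕ) : ℝ) ≤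
      C₂ * |A.det| ^ (n - 1) * (C₃ * |A.det| ^ (n + 1)) := by
    refine card_le_mul_of_fiber _ fD (by positivity) (fib2 b) ?_
    set t := s.filter (fC · = b) with ht
    rcases t.eq_empty_or_nonempty with h0 | ⟨η₀, hη₀⟩
    · rw [h0]; simp only [Finset.image_empty, Finset.card_empty, Nat.cast_zero]; positivity
    have mem {η : SpR n} (h : η ∈ t) : η ∈ s ∧ fC η = b := by simpa [ht] using h
    rw [← Finset.card_image_of_injective (t.image fD) (sub_left_injective (b := fD η₀))]
    refine h₂ A hA hA0 _ fun D hD => ?_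
    obtain ⟨_, hd, rfl⟩ := Finset.mem_image.mp hD
    obtain ⟨η, h, rfl⟩ := Finset.mem_image.mp hd
    refine ⟨blockD (ρ η) - blockD (ρ η₀), fun i j => ?_, ?_⟩
    · exact (abs_sub _ _).trans (add_le_add ((hs η (mem h).1).2 (.inr i) (.inr j))
        ((hs η₀ (mem hη₀).1).2 (.inr i) (.inr j)))
    · have e1 : (fD η - fD η₀).map ((↑) : ℤ → ℝ) = blockD η - blockD η₀ := by
        rw [← eD (hs η (mem h).1).1, ← eD (hs η₀ (mem hη₀).1).1]
        ext i j; simp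
      have e2 : blockC η = blockC η₀ := by
        rw [← eC (hs η (mem h).1).1, ← eC (hs η₀ (mem hη₀).1).1, (mem h).2, (mem hη₀).2]
      rw [e1, Matrix.mul_sub, ← cD, ← cD, e2, Matrix.sub_mul]
      abel
  -- C is A⁻ᵀ C' A⁻¹ with C' bounded by K, so its entries are bounded independently of A and
  -- integrality leaves finitely many values.
  have h4 := card_le_mul_of_fiber s fC (by positivity) fib1 (y := C₁) ?_
  · refine h4.trans (le_of_eq ?_)
    have : |A.det| ^ (2 * n) = |A.det| ^ (n - 1) * |A.det| ^ (n + 1) := by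
      rw [← pow_add]; congr 1; omega
    rw [this]
    ring
  · refine h₁ _ fun M hM i j => ?_
    obtain ⟨η, h, rfl⟩ := Finset.mem_image.mp hM
    have e1 : (((fC η) i j : ℤ) : ℝ) = blockC η i j := exists_int_of_mem_SpZ (hs η h).1 _ _
    have e2 : blockC η = (Aᵀ)⁻¹ * blockC (ρ η) * A⁻¹ := by
      rw [← cC, Matrix.mul_assoc, Matrix.mul_nonsing_inv _ hA, Matrix.mul_one]
    rw [e1, e2]
    have h5 := abs_mul_apply_le hc₀ hA1 (fun i j => (hs η h).2 (.inr i) (.inl j))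
      (N := blockC (ρ η))
    have h6 := abs_mul_apply_le (by positivity) h5 hA0 i j
    simpa using h6

end SiegelMaass
end

/-! ### The mean value inequality and folding into a fundamental domain -/

noncomputable section

namespace SiegelMaass

variable {n : ℕ}

/-! ### A mean value inequality -/

section MeanValue

variable {ι : Type*} [Fintype ι]

theorem measurePreserving_circle_smul (c : Circle) :
    MeasurePreserving (fun v : ι → ℂ => fun i => (c : ℂ) * v i) volume volume :=
  volume_preserving_pi fun _ => (rotation c).measurePreserving

theorem norm_le_circle_integral {H : (ι → ℂ) → ℂ} {r : ℝ} {a v : ι → ℂ}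
    (hv : v ∈ Metric.ball 0 r)
    (hH : ∀ w ∈ Metric.ball a r, DifferentiableAt ℂ H w) :
    ENNReal.ofReal (2 * Real.pi) * ‖H a‖ₑ ≤
      ∫⁻ t in Set.Ioc 0 (2 * Real.pi), ‖H (a + fun i => (Circle.exp t : ℂ) * v i)‖ₑ := by
  set h : ℂ → ℂ := fun ζ => H (a + ζ • v) with hh
  have hmem {ζ : ℂ} (hζ : ‖ζ‖ ≤ 1) : a + ζ • v ∈ Metric.ball a r := by
    rw [mem_ball_iff_norm, add_sub_cancel_left, norm_smul]
    rw [mem_ball_zero_iff] at hv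
    exact (mul_le_of_le_one_left (norm_nonneg _) hζ).trans_lt hv
  have hd {ζ : ℂ} (hζ : ‖ζ‖ ≤ 1) : DifferentiableAt ℂ h ζ :=
    DifferentiableAt.comp ζ (hH _ (hmem hζ)) (by fun_prop)
  have h1 : Real.circleAverage h 0 1 = h 0 := by
    refine circleAverage_of_differentiable_on_off_countable Set.countable_empty ?_ ?_
    · intro ζ hζ
      exact (hd (by simpa using hζ)).continuousAt.continuousWithinAt
    · intro ζ hζ
      refine hd ?_
      have := hζ.1
      simp only [abs_one, mem_ball_zero_iff] at this
      exact this.le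
  have h2 : h 0 = H a := by simp [hh]
  rw [h2, Real.circleAverage, inv_smul_eq_iff₀ (by positivity),
    intervalIntegral.integral_of_le (by positivity)] at h1
  have h3 : ‖(2 * Real.pi) • H a‖ₑ ≤ ∫⁻ t in Set.Ioc 0 (2 * Real.pi), ‖h (circleMap 0 1 t)‖ₑ := by
    rw [← h1]; exact enorm_integral_le_lintegral_enorm _
  rw [enorm_smul, Real.enorm_of_nonneg (by positivity)] at h3
  refine h3.trans (le_of_eq (lintegral_congr fun t => ?_))
  simp only [hh, circleMap, Complex.ofReal_one, one_mul, zero_add, Circle.coe_exp]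
  rfl

/-- The ball for the sup norm is stable under multiplication of all coordinates by e^(it). Averaging
the one-variable mean value property over the discs through the centre and exchanging the integrals
removes the angle by rotation invariance. -/
theorem volume_ball_mul_norm_le {H : (ι → ℂ) → ℂ} {r : ℝ} {a : ι → ℂ}
    (hH : ∀ w ∈ Metric.ball a r, DifferentiableAt ℂ H w) :
    volume (Metric.ball a r) * ‖H a‖ₑ ≤ ∫⁻ w in Metric.ball a r, ‖H w‖ₑ := by
  classical
  -- Extension by zero makes the integrand measurable on the whole space and invariant integration
  -- available.
  set u : (ι → ℂ) → ENNReal := fun w => ‖(Metric.ball a r).piecewise H 0 w‖ₑ with hu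
  have hum : Measurable u := by
    have hc : ContinuousOn H (Metric.ball a r) := fun w hw =>
      (hH w hw).continuousAt.continuousWithinAt
    exact (hc.measurable_piecewise continuousOn_const measurableSet_ball).enorm
  set W : (ι → ℂ) → ENNReal := fun v => u (a + v) with hW
  have hWH {v : ι → ℂ} (hv : a + v ∈ Metric.ball a r) : W v = ‖H (a + v)‖ₑ := by
    simp only [hW, hu]
    rw [Set.piecewise_eq_of_mem _ _ _ hv]
  have hWm : Measurable W := hum.comp (measurable_const.add measurable_id)
  have hint : ∫⁻ v, W v = ∫⁻ w in Metric.ball a r, ‖H w‖ₑ := by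
    rw [lintegral_add_left_eq_self u a, ← lintegral_indicator measurableSet_ball]
    refine lintegral_congr fun w => ?_
    by_cases hw : w ∈ Metric.ball a r <;> simp [hu, hw]
  clear_value W
  have key : ENNReal.ofReal (2 * Real.pi) * (volume (Metric.ball a r) * ‖H a‖ₑ) ≤
      ENNReal.ofReal (2 * Real.pi) * ∫⁻ v, W v := by
    calc ENNReal.ofReal (2 * Real.pi) * (volume (Metric.ball a r) * ‖H a‖ₑ)
        = ∫⁻ v in Metric.ball (0 : ι → ℂ) r, ENNReal.ofReal (2 * Real.pi) * ‖H a‖ₑ := by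
          rw [setLIntegral_const, Measure.addHaar_ball_center, mul_assoc,
            mul_comm (volume _) ‖H a‖ₑ]
      _ ≤ ∫⁻ v in Metric.ball (0 : ι → ℂ) r, ∫⁻ t in Set.Ioc 0 (2 * Real.pi),
            W fun i => (Circle.exp t : ℂ) * v i := by
          refine setLIntegral_mono' measurableSet_ball fun v hv => ?_
          refine (norm_le_circle_integral hv hH).trans (lintegral_mono fun t => ?_)
          have hmem : (a + fun i => (Circle.exp t : ℂ) * v i) ∈ Metric.ball a r := by
            rw [mem_ball_iff_norm, add_sub_cancel_left]
            have : (fun i => (Circle.exp t : ℂ) * v i) = (Circle.exp t : ℂ) • v := rfl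
            rw [this, norm_smul, Circle.norm_coe, one_mul]
            exact mem_ball_zero_iff.mp hv
          exact (hWH hmem).ge
      _ ≤ ∫⁻ v : ι → ℂ, ∫⁻ t in Set.Ioc 0 (2 * Real.pi), W fun i => (Circle.exp t : ℂ) * v i :=
          setLIntegral_le_lintegral _ _
      _ = ∫⁻ t in Set.Ioc 0 (2 * Real.pi), ∫⁻ v : ι → ℂ, W fun i => (Circle.exp t : ℂ) * v i := by
          refine lintegral_lintegral_swap (Measurable.aemeasurable ?_)
          refine hWm.comp (Continuous.measurable ?_)
          fun_prop
      _ = ∫⁻ t in Set.Ioc 0 (2 * Real.pi), ∫⁻ v, W v :=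
          lintegral_congr fun t => (measurePreserving_circle_smul (Circle.exp t)).lintegral_comp hWm
      _ = _ := by
          rw [setLIntegral_const, Real.volume_Ioc, sub_zero, mul_comm]
  rw [← hint]
  exact (ENNReal.mul_le_mul_iff_right (by simpa using Real.pi_pos) ENNReal.ofReal_ne_top).mp key

end MeanValue

end SiegelMaass
end

noncomputable section

namespace SiegelMaass

open scoped Topology

variable {n : ℕ}

/-! ### Local bounds near the base point -/

theorem gram_basePt : gram (basePt n) = 1 := by
  rw [gram, imMat_basePt, reMat_basePt]; simp

theorem exists_ball_basePt (k : ℝ) : ∃ r K c : ℝ, 0 < r ∧ 0 ≤ K ∧ 0 < c ∧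
    Metric.ball (basePt n) r ⊆ upperHalfSpace n ∧ ∀ b ∈ Metric.ball (basePt n) r,
      (∀ i, gram b i i ≤ K) ∧ c ≤ (imMat b).det ∧
        c ≤ ((imMat b).det ^ (n + 1))⁻¹ * (imMat b).det ^ k := by
  obtain ⟨r, hr, hsub⟩ := Metric.nhds_basis_closedBall.mem_iff.mp
    ((isOpen_upperHalfSpace n).mem_nhds basePt_mem)
  have hK : IsCompact (Metric.closedBall (basePt n) r) := isCompact_closedBall _ _
  have hne : (Metric.closedBall (basePt n) r).Nonempty := ⟨_, Metric.mem_closedBall_self hr.le⟩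
  have hd : Continuous fun z : SymC n => (imMat z).det := contDiff_det_imMat.continuous
  have lower {u : SymC n → ℝ} (hu : ContinuousOn u (Metric.closedBall (basePt n) r))
      (hp : ∀ b ∈ Metric.closedBall (basePt n) r, 0 < u b) :
      ∃ c, 0 < c ∧ ∀ b ∈ Metric.closedBall (basePt n) r, c ≤ u b := by
    obtain ⟨x, hx, hmin⟩ := hK.exists_isMinOn hne hu
    exact ⟨u x, hp x hx, fun b hb => hmin hb⟩
  obtain ⟨c₁, hc₁, h₁⟩ := lower hd.continuousOn fun b hb => det_imMat_pos (hsub hb)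
  obtain ⟨c₂, hc₂, h₂⟩ := lower (u := fun b => ((imMat b).det ^ (n + 1))⁻¹ * (imMat b).det ^ k)
    (((hd.pow _).continuousOn.inv₀ fun b hb => (pow_pos (det_imMat_pos (hsub hb)) _).ne').mul
      (hd.continuousOn.rpow_const fun b hb => Or.inl (det_imMat_pos (hsub hb)).ne'))
    fun b hb => by
      have := det_imMat_pos (hsub hb)
      positivity
  have hg : ContinuousOn (fun b : SymC n => ∑ i, |gram b i i|)
      (Metric.closedBall (basePt n) r) :=
    continuousOn_finsetSum _ fun i _ b hb =>
      ((contDiffAt_gram (hsub hb) (m := 0) i i).continuousAt.abs).continuousWithinAt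
  obtain ⟨K, hKb⟩ := hK.bddAbove_image hg
  have hKb' (b : SymC n) (hb : b ∈ Metric.closedBall (basePt n) r) : ∑ i, |gram b i i| ≤ K :=
    hKb ⟨b, hb, rfl⟩
  refine ⟨r, K, min c₁ c₂, hr, ?_, lt_min hc₁ hc₂, Metric.ball_subset_closedBall.trans hsub,
    fun b hb => ?_⟩
  · exact (Finset.sum_nonneg fun i _ => abs_nonneg _).trans
      (hKb' _ (Metric.mem_closedBall_self hr.le))
  · have hb' := Metric.ball_subset_closedBall hb
    refine ⟨fun i => ?_, (min_le_left _ _).trans (h₁ b hb'), (min_le_right _ _).trans (h₂ b hb')⟩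
    exact (le_abs_self _).trans ((Finset.single_le_sum (f := fun i => |gram b i i|)
      (fun i _ => abs_nonneg _) (Finset.mem_univ i)).trans (hKb' b hb'))

/-- If σ moves i to a point, the matrix of that point is σσᵀ, whose diagonal bounds the rows of σ.
Writing ρ = (ρτ)τ⁻¹ with τi = b bounds ρ, since a symplectic inverse has the same entries up to
position and sign. -/
theorem abs_apply_le_of_act {ρ : SpR n} {b b' : SymC n} {K : ℝ} (hb : b ∈ upperHalfSpace n)
    (hK : 0 ≤ K) (h : act ρ b = b') (h1 : ∀ i, gram b i i ≤ K) (h2 : ∀ i, gram b' i i ≤ K)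
    (i j : Fin n ⊕ Fin n) : |ρ.1 i j| ≤ (n + n) * K := by
  have entry (σ : SpR n) (hσ : ∀ i, gram (act σ (basePt n)) i i ≤ K) (i j : Fin n ⊕ Fin n) :
      |σ.1 i j| ≤ √K := by
    refine Real.abs_le_sqrt (le_trans ?_ (hσ i))
    rw [gram_act σ basePt_mem, gram_basePt, Matrix.mul_one, Matrix.mul_apply]
    simp only [Matrix.transpose_apply, ← sq]
    exact Finset.single_le_sum (f := fun j => σ.1 i j ^ 2) (fun j _ => sq_nonneg _)
      (Finset.mem_univ j)
  obtain ⟨τ, hτ⟩ := exists_act_basePt hb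
  have h3 : act (ρ * τ) (basePt n) = b' := by rw [act_mul _ _ basePt_mem, hτ, h]
  have h4 := abs_mul_apply_le (Real.sqrt_nonneg K) (entry (ρ * τ) (by rwa [h3]))
    (abs_inv_apply_le (entry τ (by rwa [hτ]))) i j
  have e : (ρ * τ).1 * (τ⁻¹).1 = ρ.1 := congrArg Subtype.val (mul_inv_cancel_right ρ τ)
  rw [e, Real.mul_self_sqrt hK, Fintype.card_sum, Fintype.card_fin, Nat.cast_add] at h4
  exact h4

theorem differentiableAt_act (γ : SpR n) {z : SymC n} (hz : z ∈ upperHalfSpace n) :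
    DifferentiableAt ℂ (act γ) z := (hasFDerivAt_act γ hz).differentiableAt

theorem norm_sq_detPow_mul (L : LogBranch n) (k : ℝ) (f : SymC n → ℂ) (γ : SpR n) {z : SymC n}
    (hz : z ∈ upperHalfSpace n) : (imMat z).det ^ k * ‖L.detPow γ (-k) z * f (act γ z)‖ ^ 2 =
      (imMat (act γ z)).det ^ k * ‖f (act γ z)‖ ^ 2 := by
  have hd : 0 < ‖(denom γ z).det‖ := norm_pos_iff.mpr (det_denom_ne_zero γ hz)
  rw [norm_mul, norm_detPow L γ _ hz, mul_pow, ← det_imMat_act_rpow γ k hz, mul_comm 2 k,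
    Real.rpow_mul hd.le, Real.rpow_two, Real.rpow_neg hd.le]
  field_simp

/-- The value of `det (Y) ^ k |f| ^ 2` at `σ i` is bounded by its integral over a neighbourhood. -/
theorem density_mul_le_lintegral (L : LogBranch n) {k r c : ℝ} {f : SymC n → ℂ}
    (hf : DifferentiableOn ℂ f (upperHalfSpace n)) (hc : 0 < c)
    (hsub : Metric.ball (basePt n) r ⊆ upperHalfSpace n)
    (hcb : ∀ b ∈ Metric.ball (basePt n) r,
      c ≤ ((imMat b).det ^ (n + 1))⁻¹ * (imMat b).det ^ k) (σ : SpR n) :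
    ENNReal.ofReal c * volume (Metric.ball (basePt n) r) *
        ENNReal.ofReal (density k f (σ • ⟨basePt n, basePt_mem⟩)) ≤
      ∫⁻ w in (Subtype.val ⁻¹' Metric.ball (basePt n) r : Set (Half n)),
        ENNReal.ofReal (density k f (σ • w)) ∂halfMeasure n := by
  set B := Metric.ball (basePt n) r with hB
  -- The factor det(CZ + D)^(-k) makes det(Y)^k |F|² the invariant density at σw while F stays
  -- holomorphic. The inequality is applied to F², whose modulus is |F|².
  set F : SymC n → ℂ := fun w => L.detPow σ (-k) w * f (act σ w) with hF
  set u : SymC n → ENNReal := fun w =>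
    ENNReal.ofReal ((imMat (act σ w)).det ^ k * ‖f (act σ w)‖ ^ 2) with hu
  have hFd : ∀ w ∈ B, DifferentiableAt ℂ (fun w => F w ^ 2) w := fun w hw => by
    have hw' := hsub hw
    refine ((differentiableAt_detPow L σ (-k) hw').mul ?_).pow 2
    exact DifferentiableAt.comp w
      (hf.differentiableAt ((isOpen_upperHalfSpace n).mem_nhds (act_mem σ hw')))
      (differentiableAt_act σ hw')
  have hmv := volume_ball_mul_norm_le hFd
  have e1 : ‖F (basePt n) ^ 2‖ₑ = ENNReal.ofReal (density k f (σ • ⟨basePt n, basePt_mem⟩)) := by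
    rw [← ofReal_norm, norm_pow]
    congr 1
    have := norm_sq_detPow_mul L k f σ (basePt_mem (n := n))
    rw [imMat_basePt, Matrix.det_one, Real.one_rpow, one_mul] at this
    exact this
  rw [e1] at hmv
  have e2 : ∫⁻ w in (Subtype.val ⁻¹' B : Set (Half n)),
      ENNReal.ofReal (density k f (σ • w)) ∂halfMeasure n = ∫⁻ w in B, u w ∂siegelMeasure n :=
    lintegral_fundDomain u measurableSet_ball
  rw [e2, ← lintegral_indicator measurableSet_ball, lintegral_siegelMeasure, mul_assoc]
  calc ENNReal.ofReal c * (volume B * _) ≤ ENNReal.ofReal c * ∫⁻ w in B, ‖F w ^ 2‖ₑ := by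
        gcongr
    _ = ∫⁻ w in B, ENNReal.ofReal c * ‖F w ^ 2‖ₑ :=
        (lintegral_const_mul' _ _ ENNReal.ofReal_ne_top).symm
    _ ≤ ∫⁻ w in B, ENNReal.ofReal (((imMat w).det ^ (n + 1))⁻¹) * B.indicator u w := by
        refine setLIntegral_mono' measurableSet_ball fun w hw => ?_
        have hp := det_imMat_pos (hsub hw)
        rw [Set.indicator_of_mem hw, ← ofReal_norm, ← ENNReal.ofReal_mul hc.le,
          ← ENNReal.ofReal_mul (by positivity), ← norm_sq_detPow_mul L k f σ (hsub hw), norm_pow,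
          ← mul_assoc]
        exact ENNReal.ofReal_le_ofReal
          (mul_le_mul_of_nonneg_right (hcb w hw) (by positivity))
    _ ≤ _ := lintegral_mono_set hsub

/-! ### Unfolding with multiplicity -/

/-- Unfolding writes the integral over S as a sum of integrals over F of translates; at each point
at most N translates contribute, and only if the point lies in T. -/
theorem setLIntegral_le_of_multiplicity {G X : Type*} [Group G] [MulAction G X]
    [MeasurableSpace X] {ν : Measure X} [Countable G] [MeasurableConstSMul G X]
    [SMulInvariantMeasure G X ν] {F : Set X} (hF : IsFundamentalDomain G F ν) {u : X → ENNReal}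
    (hu : Measurable u) (hinv : ∀ (g : G) x, u (g • x) = u x) {S T : Set X}
    (hS : MeasurableSet S) (hT : MeasurableSet T) {N : ENNReal}
    (hN : ∀ x, ∀ t : Finset G, (∀ g ∈ t, g • x ∈ S) → (t.card : ENNReal) ≤ N)
    (hST : ∀ x, ∀ g : G, g • x ∈ S → x ∈ T) :
    ∫⁻ x in S, u x ∂ν ≤ N * ∫⁻ x in T, u x ∂(ν.restrict F) := by
  rw [← lintegral_indicator hS, hF.lintegral_eq_tsum'', ← lintegral_tsum]
  · rw [← lintegral_indicator hT, ← lintegral_const_mul _ (hu.indicator hT)]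
    refine lintegral_mono fun x => ?_
    rw [ENNReal.tsum_eq_iSup_sum]
    refine iSup_le fun t => ?_
    classical
    have e (g : G) : S.indicator u (g • x) = if g • x ∈ S then T.indicator u x else 0 := by
      split_ifs with h
      · rw [Set.indicator_of_mem h, Set.indicator_of_mem (hST x g h), hinv]
      · rw [Set.indicator_of_notMem h]
    simp only [e]
    rw [← Finset.sum_filter, Finset.sum_const, nsmul_eq_mul]
    exact mul_le_mul_left (hN x _ fun g hg => (Finset.mem_filter.mp hg).2) _
  · exact fun g => ((hu.indicator hS).comp (measurable_const_smul g)).aemeasurable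

end SiegelMaass
end

noncomputable section

namespace SiegelMaass

open scoped Topology

variable {n : ℕ}

/-! ### Multiplicity of translated neighbourhoods -/

/-- Only the finite index of Γ ∩ Sp_n(ℤ) in Γ matters. Inverses are taken because the quotient
consists of left cosets and representatives are wanted on the right. -/
theorem exists_finset_cosets {Γ : Subgroup (SpR n)} (hΓ : Subgroup.Commensurable Γ (SpZ n)) :
    ∃ J : Finset (SpR n), ∀ δ ∈ Γ, ∃ j ∈ J, δ * j⁻¹ ∈ SpZ n := by
  classical
  set H := (SpZ n).subgroupOf Γ
  have hi : H.index ≠ 0 := hΓ.2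
  have : H.FiniteIndex := ⟨hi⟩
  have := Fintype.ofFinite (Γ ⧸ H)
  refine ⟨Finset.univ.image fun q : Γ ⧸ H => ((Quotient.out q : Γ) : SpR n)⁻¹, fun δ hδ => ?_⟩
  set x : Γ := ⟨δ, hδ⟩⁻¹ with hx
  refine ⟨_, Finset.mem_image_of_mem _ (Finset.mem_univ (x : Γ ⧸ H)), ?_⟩
  have h1 : (Quotient.out (x : Γ ⧸ H))⁻¹ * x ∈ H := by
    rw [← QuotientGroup.eq]; exact Quotient.out_eq _
  have h2 := Subgroup.mem_subgroupOf.mp (inv_mem h1)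
  simpa [hx] using h2

/-- Up to finitely many cosets the elements of Γ involved are integral. Quotients of two of them,
conjugated by τ, move one point of B to another and so have bounded entries; `exists_card_SpZ_le`
counts them. -/
theorem exists_multiplicity_bound {Γ : Subgroup (SpR n)}
    (hΓ : Subgroup.Commensurable Γ (SpZ n)) (hn : 1 ≤ n) {c₀ K : ℝ} (hc₀ : 0 ≤ c₀) (hK : 0 ≤ K)
    {B : Set (SymC n)} (hB : B ⊆ upperHalfSpace n) (hg : ∀ b ∈ B, ∀ i, gram b i i ≤ K) :
    ∃ C : ℝ, 0 ≤ C ∧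
    ∀ (A X : Matrix (Fin n) (Fin n) ℝ) (hA : IsUnit A.det) (hX : Xᵀ = X),
      (∀ i j, |A⁻¹ i j| ≤ c₀) → ∀ γ ∈ SpZ n, ∀ (x : Half n) (t : Finset (transGroup Γ)),
      (∀ g ∈ t, (((γ * affineSp A X hA hX)⁻¹ • g • x : Half n) : SymC n) ∈ B) →
      (t.card : ℝ) ≤ C * |A.det| ^ (2 * n) := by
  classical
  obtain ⟨J, hJ⟩ := exists_finset_cosets hΓ
  obtain ⟨C, hC, hcount⟩ := exists_card_SpZ_le hn hc₀ (K := (n + n) * K) (by positivity)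
  refine ⟨J.card * C, by positivity, fun A X hA hX hA0 γ hγ x t ht => ?_⟩
  set τ := affineSp A X hA hX with hτ
  choose d hd hdx using fun g : transGroup Γ => exists_smul_eq g
  choose j hjJ hj using fun g : transGroup Γ => hJ (d g) (hd g)
  have hdinj : Function.Injective d := by
    intro g g' h
    refine Subtype.ext (Equiv.ext fun z => ?_)
    exact (hdx g z).trans ((by rw [h] : d g • z = d g' • z).trans (hdx g' z).symm)
  rw [mul_assoc, mul_comm (J.card : ℝ)]
  rw [mul_comm (C * _)]
  refine card_le_mul_of_fiber t j (by positivity) (fun a => ?_) ?_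
  · set ta := t.filter (j · = a) with hta
    rcases ta.eq_empty_or_nonempty with h0 | ⟨g₀, hg₀⟩
    · rw [h0]; simp only [Finset.card_empty, Nat.cast_zero]; positivity
    have mem {g} (h : g ∈ ta) : g ∈ t ∧ j g = a := by simpa [hta] using h
    set η : transGroup Γ → SpR n := fun g => γ⁻¹ * (d g * a⁻¹) with hη
    have hηZ {g} (h : g ∈ ta) : η g ∈ SpZ n :=
      mul_mem (inv_mem hγ) (by rw [← (mem h).2]; exact hj g)
    have hηx (g : transGroup Γ) : η g • a • x = γ⁻¹ • g • x := by
      rw [hdx]; simp only [hη, smul_smul]; congr 1; group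
    -- Dividing by a reference element removes the unknown point `x`: the conjugate of `e g` by τ
    -- maps the point of `B` obtained from `g₀` to the one obtained from `g`.
    set e : transGroup Γ → SpR n := fun g => η g * (η g₀)⁻¹ with he
    have heinj : Function.Injective e := by
      intro g g' h
      have h1 : η g = η g' := mul_right_cancel h
      exact hdinj (mul_right_cancel (mul_left_cancel h1))
    rw [← Finset.card_image_of_injective ta heinj]
    refine hcount A X hA hX hA0 _ fun θ hθ => ?_
    obtain ⟨g, h, rfl⟩ := Finset.mem_image.mp hθ
    refine ⟨mul_mem (hηZ h) (inv_mem (hηZ hg₀)), ?_⟩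
    have h1 := ht g (mem h).1
    have h2 := ht g₀ (mem hg₀).1
    refine abs_apply_le_of_act (hB h2) hK ?_ (hg _ h2) (hg _ h1)
    have h3 : ((τ⁻¹ * e g * τ) • ((γ * τ)⁻¹ • g₀ • x) : Half n) = (γ * τ)⁻¹ • g • x := by
      have h4 : ((γ * τ)⁻¹ • g₀ • x : Half n) = τ⁻¹ • η g₀ • a • x := by
        rw [hηx, _root_.mul_inv_rev, mul_smul]
      have h5 : ((γ * τ)⁻¹ • g • x : Half n) = τ⁻¹ • η g • a • x := by
        rw [hηx, _root_.mul_inv_rev, mul_smul]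
      rw [h4, h5]
      simp only [he, smul_smul]
      congr 1
      group
    exact congrArg Subtype.val h3
  · have : t.image j ⊆ J := by
      intro a ha
      obtain ⟨g, -, rfl⟩ := Finset.mem_image.mp ha
      exact hjJ g
    exact_mod_cast Finset.card_le_card this

/-! ### Heights in an orbit of `Sp_n(ℤ)` -/

/-- At the point i the matrix Ci + D has entries in the Gaussian integers, so its nonzero
determinant has norm at least 1. -/
theorem one_le_norm_det_denom {η : SpR n} (h : η ∈ SpZ n) :
    1 ≤ ‖(denom η (basePt n)).det‖ := by
  set M : Matrix (Fin n) (Fin n) GaussianInt :=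
    Matrix.of fun i j => ⟨⌊blockD η i j⌋, ⌊blockC η i j⌋⟩ with hM
  have hi (i j) := exists_int_of_mem_SpZ h (.inr i) (.inl j)
  have hj (i j) := exists_int_of_mem_SpZ h (.inr i) (.inr j)
  have e : denom η (basePt n) = GaussianInt.toComplex.mapMatrix M := by
    rw [denom_eq, toMat_basePt]
    ext i j
    simp only [Matrix.mul_smul, Matrix.mul_one, Matrix.add_apply, Matrix.smul_apply, toC_apply,
      smul_eq_mul, RingHom.mapMatrix_apply, Matrix.map_apply, hM, Matrix.of_apply]
    rw [GaussianInt.toComplex_def]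
    have h1 : (((⌊blockC η i j⌋ : ℤ) : ℝ) : ℂ) = (blockC η i j : ℂ) :=
      congrArg Complex.ofReal (hi i j)
    have h2 : (((⌊blockD η i j⌋ : ℤ) : ℝ) : ℂ) = (blockD η i j : ℂ) :=
      congrArg Complex.ofReal (hj i j)
    rw [← h1, ← h2]
    push_cast
    ring
  have hne := det_denom_ne_zero η (basePt_mem (n := n))
  rw [e, ← RingHom.map_det] at hne ⊢
  have h1 : M.det ≠ 0 := fun h0 => hne (by rw [h0, map_zero])
  have h2 : (1 : ℤ) ≤ M.det.norm :=
    (GaussianInt.norm_pos.mpr h1)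
  have h3 : (1 : ℝ) ≤ ‖GaussianInt.toComplex M.det‖ ^ 2 := by
    rw [← Complex.normSq_eq_norm_sq, ← GaussianInt.intCast_real_norm]
    exact_mod_cast h2
  nlinarith [norm_nonneg (GaussianInt.toComplex M.det)]

theorem det_imMat_act_affineSp {A X : Matrix (Fin n) (Fin n) ℝ} (hA : IsUnit A.det) (hX : Xᵀ = X)
    {z : SymC n} (hz : z ∈ upperHalfSpace n) :
    (imMat (act (affineSp A X hA hX) z)).det = |A.det| ^ 2 * (imMat z).det := by
  rw [det_imMat_act _ hz, denom_affineSp, toC_det, Complex.norm_real, Matrix.det_nonsing_inv,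
    Ring.inverse_eq_inv', Matrix.det_transpose, norm_inv, Real.norm_eq_abs]
  have := hA.ne_zero
  field_simp

/-- For the orbit of i the heights are at most 1. For another point y, translate ηi back to i by an
affine element: by invariance of the pairing ηy lands in a fixed compact set, and the affine element
multiplies heights by det Im(ηi) ≤ 1. -/
theorem exists_det_imMat_act_le {y : SymC n} (hy : y ∈ upperHalfSpace n) :
    ∃ M : ℝ, ∀ η ∈ SpZ n, (imMat (act η y)).det ≤ M := by
  obtain ⟨C, hC, hCH, hm⟩ := exists_compact_of_pairing_basePt_le (n := n) (pairing y (basePt n))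
  obtain ⟨M, hM⟩ := hC.bddAbove_image (f := fun z : SymC n => (imMat z).det)
    contDiff_det_imMat.continuous.continuousOn
  refine ⟨M, fun η hη => ?_⟩
  have hw := act_mem η (basePt_mem (n := n))
  set w := act η (basePt n) with hwdef
  obtain ⟨A, hA, e⟩ := exists_eq_mul_transpose hw
  set τ := affineSp A (reMat w) hA (reMat_transpose w) with hτ
  have hτw : act τ (basePt n) = w := act_affineSp_basePt _ _ _ _ rfl e
  have hy' := act_mem η hy
  set v := act τ⁻¹ (act η y) with hv
  have hvH : v ∈ upperHalfSpace n := act_mem _ hy'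
  have hτv : act τ v = act η y := by rw [hv, ← act_mul _ _ hy', mul_inv_cancel, act_one _ hy']
  have hp : pairing v (basePt n) = pairing y (basePt n) := by
    rw [← pairing_act τ hvH basePt_mem, hτv, hτw, hwdef, pairing_act η hy basePt_mem]
  have h1 : (imMat v).det ≤ M := hM ⟨v, hm v hvH hp.le, rfl⟩
  have h2 : |A.det| ^ 2 ≤ 1 := by
    have h3 := det_imMat_act_affineSp hA (reMat_transpose w) (basePt_mem (n := n))
    rw [← hτ, hτw, imMat_basePt, Matrix.det_one, mul_one] at h3
    rw [← h3, hwdef, det_imMat_act η basePt_mem, imMat_basePt, Matrix.det_one]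
    have := one_le_norm_det_denom hη
    exact div_le_one_of_le₀ (one_le_pow₀ this) (by positivity)
  rw [← hτv, det_imMat_act_affineSp hA _ hvH]
  exact (mul_le_of_le_one_left (det_imMat_pos hvH).le h2).trans h1

/-- The points whose `Γ`-orbit contains a point which is high in the cusp given by `γ`. -/
def highSet (Γ : Subgroup (SpR n)) (γ : SpR n) (R : ℝ) : Set (Half n) :=
  {x | ∃ δ : Γ, R ≤ (imMat (act (γ⁻¹ * (δ : SpR n)) x)).det}

theorem measurableSet_highSet (Γ : Subgroup (SpR n)) [Countable Γ] (γ : SpR n) (R : ℝ) :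
    MeasurableSet (highSet Γ γ R) := by
  have e : highSet Γ γ R = ⋃ δ : Γ, {x : Half n | R ≤ (imMat (act (γ⁻¹ * (δ : SpR n)) x)).det} := by
    ext x; simp [highSet]
  rw [e]
  refine MeasurableSet.iUnion fun δ => measurableSet_le measurable_const ?_
  exact measurable_det_imMat.comp (measurable_subtype_coe.comp
    (continuous_smul_half (γ⁻¹ * (δ : SpR n))).measurable)

/-- The Γ-orbit of x lies in finitely many orbits of Sp_n(ℤ), each of bounded height. -/
theorem exists_forall_notMem_highSet {Γ : Subgroup (SpR n)}
    (hΓ : Subgroup.Commensurable Γ (SpZ n)) {γ : SpR n} (hγ : γ ∈ SpZ n) (x : Half n) :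
    ∃ M : ℝ, ∀ R, M < R → x ∉ highSet Γ γ R := by
  obtain ⟨J, hJ⟩ := exists_finset_cosets hΓ
  choose M hM using fun j : SpR n => exists_det_imMat_act_le (act_mem j x.2)
  refine ⟨∑ j ∈ J, |M j|, fun R hR ⟨δ, hδ⟩ => ?_⟩
  obtain ⟨j, hj, hjZ⟩ := hJ δ δ.2
  have h1 := hM j (γ⁻¹ * (δ * j⁻¹)) (mul_mem (inv_mem hγ) hjZ)
  rw [← act_mul _ _ x.2] at h1
  have h2 : γ⁻¹ * (δ * j⁻¹) * j = γ⁻¹ * (δ : SpR n) := by group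
  rw [h2] at h1
  have h3 := Finset.single_le_sum (f := fun j => |M j|) (fun j _ => abs_nonneg _) hj
  linarith [le_abs_self (M j)]

/-- The high sets decrease to the empty set, so their measures with respect to the finite measure of
density u tend to 0. -/
theorem exists_lintegral_highSet_le {Γ : Subgroup (SpR n)}
    (hΓ : Subgroup.Commensurable Γ (SpZ n)) {γ : SpR n} (hγ : γ ∈ SpZ n) {ν : Measure (Half n)}
    {u : Half n → ENNReal} (hfin : ∫⁻ x, u x ∂ν < ⊤) {ε : ENNReal} (hε : 0 < ε) :
    ∃ R : ℝ, ∫⁻ x in highSet Γ γ R, u x ∂ν ≤ ε := by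
  have := countable_of_commensurable hΓ
  set κ := ν.withDensity u
  have hT (m : ℕ) : MeasurableSet (highSet Γ γ m) := measurableSet_highSet Γ γ m
  have hκ : κ Set.univ ≠ ⊤ := by
    rw [withDensity_apply _ .univ, Measure.restrict_univ]; exact hfin.ne
  have hanti : Antitone fun m : ℕ => highSet Γ γ m := by
    intro m m' h x ⟨δ, hδ⟩
    exact ⟨δ, le_trans (by exact_mod_cast h) hδ⟩
  have h1 := tendsto_measure_iInter_atTop (μ := κ) (fun m => (hT m).nullMeasurableSet) hanti
    ⟨0, measure_ne_top_of_subset (Set.subset_univ _) hκ⟩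
  have h2 : ⋂ m : ℕ, highSet Γ γ m = ∅ := by
    refine Set.eq_empty_of_forall_notMem fun x hx => ?_
    obtain ⟨M, hM⟩ := exists_forall_notMem_highSet hΓ hγ x
    obtain ⟨m, hm⟩ := exists_nat_gt M
    exact hM m hm (Set.mem_iInter.mp hx m)
  rw [h2, measure_empty] at h1
  obtain ⟨m, hm⟩ := (h1.eventually_le_const hε).exists
  have hm' : κ (highSet Γ γ m) ≤ ε := hm
  rw [withDensity_apply _ (hT m)] at hm'
  exact ⟨m, hm'⟩

/-! ### Lower bounds for the imaginary part -/

/-- Row i of A⁻¹ is x = A⁻ᵀe_i, and the form A Aᵀ takes the value 1 at x. Hence Y₀ is at most 1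
there, which bounds x. -/
theorem exists_abs_inv_apply_le {Y₀ : Matrix (Fin n) (Fin n) ℝ} (hY₀ : Y₀.PosDef) :
    ∃ c₀ : ℝ, 0 < c₀ ∧ ∀ A : Matrix (Fin n) (Fin n) ℝ, IsUnit A.det →
      (A * Aᵀ - Y₀).PosSemidef → ∀ i j, |A⁻¹ i j| ≤ c₀ := by
  set R : ℝ := Y₀⁻¹.trace + 1
  have htr : 0 ≤ Y₀⁻¹.trace := hY₀.inv.posSemidef.trace_nonneg
  have hR : 0 < R := by positivity
  have hRx (x : Fin n → ℝ) : x ⬝ᵥ x ≤ R * (x ⬝ᵥ Y₀ *ᵥ x) := by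
    have h := dotProduct_inv_ge hY₀.inv hR (fun x => ?_) x
    · rwa [Matrix.nonsing_inv_nonsing_inv _ hY₀.det_pos.ne'.isUnit] at h
    · refine (dotProduct_le_trace hY₀.inv.posSemidef x).trans ?_
      have : 0 ≤ x ⬝ᵥ x := by
        have := dotProduct_star_self_nonneg x
        simpa using this
      exact mul_le_mul_of_nonneg_right (by simp [R]) this
  refine ⟨√R, Real.sqrt_pos.mpr hR, fun A hA h i j => ?_⟩
  have hA' : IsUnit Aᵀ.det := by rwa [Matrix.det_transpose]
  have hT : ((Aᵀ)⁻¹)ᵀ = A⁻¹ := by rw [Matrix.transpose_nonsing_inv, Matrix.transpose_transpose]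
  set x : Fin n → ℝ := (Aᵀ)⁻¹ *ᵥ Pi.single i 1 with hx
  have h1 : Aᵀ *ᵥ x = Pi.single i 1 := by
    rw [hx, Matrix.mulVec_mulVec, Matrix.mul_nonsing_inv _ hA', Matrix.one_mulVec]
  have h2 : x ⬝ᵥ (A * Aᵀ) *ᵥ x = 1 := by
    rw [← Matrix.mulVec_mulVec, h1, Matrix.dotProduct_mulVec, ← Matrix.mulVec_transpose, h1]
    simp
  have h3 : x ⬝ᵥ Y₀ *ᵥ x ≤ 1 := by
    have h4 := h.dotProduct_mulVec_nonneg x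
    rw [Matrix.sub_mulVec, dotProduct_sub] at h4
    simp only [star_trivial, h2] at h4
    linarith
  have h5 : x ⬝ᵥ x ≤ R := (hRx x).trans (mul_le_of_le_one_right hR.le h3)
  have h6 : x j = A⁻¹ i j := by
    rw [hx, ← hT]
    simp
  rw [← h6]
  refine Real.abs_le_sqrt (le_trans ?_ h5)
  rw [sq]
  exact Finset.single_le_sum (f := fun j => x j * x j) (fun j _ => mul_self_nonneg _)
    (Finset.mem_univ j)

end SiegelMaass
end

/-! ### Cuspidality and the main theorem -/

noncomputable section

namespace SiegelMaass

variable {n : ℕ}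

/-! ### Bounds in the regions `Y ≥ Y₀` -/

theorem exists_le_det_imMat {Y₀ : Matrix (Fin n) (Fin n) ℝ} (hY₀ : Y₀.PosDef) :
    ∃ m : ℝ, 0 < m ∧ ∀ z ∈ upperHalfSpace n, (imMat z - Y₀).PosSemidef → m ≤ (imMat z).det := by
  obtain ⟨c₀, hc₀, h⟩ := exists_abs_inv_apply_le hY₀
  set q : ℝ := (Nat.factorial n) * c₀ ^ n with hq
  have hq0 : 0 < q := by positivity
  refine ⟨(q ^ 2)⁻¹, by positivity, fun z hz hzY => ?_⟩
  obtain ⟨A, hA, e⟩ := exists_eq_mul_transpose hz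
  have h1 : |A⁻¹.det| ≤ q := by
    have := Matrix.det_le (abv := AbsoluteValue.abs) (h A hA (by rwa [← e]))
    simpa [hq] using this
  rw [Matrix.det_nonsing_inv, Ring.inverse_eq_inv', abs_inv] at h1
  have hd : 0 < |A.det| := abs_pos.mpr hA.ne_zero
  have e2 : (imMat z).det = |A.det| ^ 2 := by
    rw [e, Matrix.det_mul, Matrix.det_transpose, sq_abs, sq]
  rw [e2]
  refine inv_le_of_inv_le₀ (by positivity) ?_
  rw [← inv_pow]
  exact pow_le_pow_left₀ (by positivity) h1 2

section CuspForm

variable {Γ : Subgroup (SpR n)} {L : LogBranch n} {k : ℝ} {f : SymC n → ℂ}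

/-- Write z = τi with τ affine. The mean value inequality at i for σ = γτ is folded into F with
multiplicity O(|det A|^(2n)) = O(det(Y)^n). Points of τB have height at least c det Y, so only
orbits in the high set for R contribute. -/
theorem exists_density_le (hn : 1 ≤ n) (hΓ : Subgroup.Commensurable Γ (SpZ n))
    (hf : IsHolomorphicAutomorphic L Γ k f) {F : Set (SymC n)} (hF : IsFundDomain Γ F)
    {Y₀ : Matrix (Fin n) (Fin n) ℝ} (hY₀ : Y₀.PosDef) {γ : SpR n} (hγ : γ ∈ SpZ n) :
    ∃ (D : ENNReal) (c : ℝ), D ≠ ⊤ ∧ 0 < c ∧ ∀ (R : ℝ) (z : Half n),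
      (imMat (z : SymC n) - Y₀).PosSemidef → R ≤ c * (imMat (z : SymC n)).det →
      ENNReal.ofReal (density k f (γ • z)) ≤ D * ENNReal.ofReal ((imMat (z : SymC n)).det ^ n) *
        ∫⁻ x in highSet Γ γ R, ENNReal.ofReal (density k f x)
          ∂(halfMeasure n).restrict (Subtype.val ⁻¹' F) := by
  have := countable_of_commensurable hΓ
  have := countable_transGroup (Γ := Γ)
  obtain ⟨c₀, hc₀, hinv⟩ := exists_abs_inv_apply_le hY₀
  obtain ⟨r, K, c, hr, hK, hc, hsub, hb⟩ := exists_ball_basePt (n := n) k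
  set B := Metric.ball (basePt n) r with hB
  obtain ⟨C, hC, hmult⟩ := exists_multiplicity_bound hΓ hn hc₀.le hK hsub fun b h => (hb b h).1
  set S : Set (Half n) := Subtype.val ⁻¹' B with hS
  have hSm : MeasurableSet S := measurableSet_ball.preimage measurable_subtype_coe
  set V := ENNReal.ofReal c * volume B with hV
  have hV0 : V ≠ 0 :=
    mul_ne_zero (ENNReal.ofReal_pos.mpr hc).ne' (Metric.measure_ball_pos _ _ hr).ne'
  have hVt : V ≠ ⊤ := ENNReal.mul_ne_top ENNReal.ofReal_ne_top measure_ball_lt_top.ne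
  have hu : Measurable fun x : Half n => ENNReal.ofReal (density k f x) :=
    (continuous_density k fun z hz => (hf.holomorphic.differentiableAt
      ((isOpen_upperHalfSpace n).mem_nhds hz)).continuousAt).measurable.ennreal_ofReal
  refine ⟨V⁻¹ * ENNReal.ofReal C, c, ENNReal.mul_ne_top (ENNReal.inv_ne_top.mpr hV0)
    ENNReal.ofReal_ne_top, hc, fun R z hz hR => ?_⟩
  obtain ⟨A, hA, e⟩ := exists_eq_mul_transpose z.2
  have hdet : (imMat (z : SymC n)).det = |A.det| ^ 2 := by
    rw [e, Matrix.det_mul, Matrix.det_transpose, sq_abs, sq]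
  set τ := affineSp A (reMat (z : SymC n)) hA (reMat_transpose _) with hτ
  have hτo : τ • (⟨basePt n, basePt_mem⟩ : Half n) = z :=
    Subtype.ext (act_affineSp_basePt _ _ _ _ rfl e)
  set σ := γ * τ with hσ
  have h1 := density_mul_le_lintegral L hf.holomorphic hc hsub (fun b h => (hb b h).2.2) σ
  rw [hσ, mul_smul, hτo, ← hσ, ← hV] at h1
  set S' : Set (Half n) := (fun w : Half n => σ⁻¹ • w) ⁻¹' S with hS'
  have hS'm : MeasurableSet S' := hSm.preimage (continuous_smul_half σ⁻¹).measurable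
  have h2 : ∫⁻ w in S, ENNReal.ofReal (density k f (σ • w)) ∂halfMeasure n =
      ∫⁻ w in S', ENNReal.ofReal (density k f w) ∂halfMeasure n := by
    rw [← (measurePreserving_smul σ).setLIntegral_comp_preimage hS'm hu]
    congr 2
    ext w
    simp [hS']
  have h3 := setLIntegral_le_of_multiplicity (T := highSet Γ γ R)
    (N := ENNReal.ofReal (C * |A.det| ^ (2 * n))) hF.isFundamentalDomain hu (fun g x => by
      obtain ⟨δ, hδ, h⟩ := exists_smul_eq g
      rw [h]
      exact congrArg ENNReal.ofReal (norm_sq_act x.2 (hf.transform δ hδ x x.2))) hS'm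
    (measurableSet_highSet Γ γ R) (fun x t ht => by
      have := hmult A _ hA (reMat_transpose (z : SymC n)) (hinv A hA (by rwa [← e])) γ hγ x t ht
      rw [← ENNReal.ofReal_natCast]
      exact ENNReal.ofReal_le_ofReal this) (fun x g hx => by
      obtain ⟨δ, hδ, h⟩ := exists_smul_eq g
      refine ⟨⟨δ, hδ⟩, ?_⟩
      set b : Half n := σ⁻¹ • g • x with hbdef
      have hbB : (b : SymC n) ∈ B := hx
      have h4 : (γ⁻¹ * δ) • x = τ • b := by
        rw [hbdef, h, hσ]
        simp only [smul_smul]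
        congr 1
        group
      have h5 : act (γ⁻¹ * δ) x = act τ b := congrArg Subtype.val h4
      change R ≤ (imMat (act (γ⁻¹ * δ) x)).det
      rw [h5, det_imMat_act_affineSp hA _ b.2, ← hdet, mul_comm]
      exact hR.trans (mul_le_mul_of_nonneg_right (hb _ hbB).2.1 (det_imMat_pos z.2).le))
  rw [← h2] at h3
  have h4 := h1.trans h3
  rw [mul_comm V] at h4
  have h5 := (ENNReal.le_div_iff_mul_le (Or.inl hV0) (Or.inl hVt)).mpr h4
  refine h5.trans (le_of_eq ?_)
  rw [ENNReal.div_eq_inv_mul, hdet, ← pow_mul, ENNReal.ofReal_mul hC]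
  ring

/-- Dividing by det(Y)^k leaves det(Y)^(n-k), which is bounded on Y ≥ Y₀ because n - k ≤ 0 and det Y
is bounded below there. -/
theorem exists_sq_norm_le (hn : 1 ≤ n) (hΓ : Subgroup.Commensurable Γ (SpZ n)) (hk : n ≤ k)
    (hf : IsHolomorphicAutomorphic L Γ k f) {F : Set (SymC n)} (hF : IsFundDomain Γ F)
    {Y₀ : Matrix (Fin n) (Fin n) ℝ} (hY₀ : Y₀.PosDef) {γ : SpR n} (hγ : γ ∈ SpZ n) :
    ∃ (D : ENNReal) (c : ℝ), D ≠ ⊤ ∧ 0 < c ∧ ∀ (R : ℝ), ∀ z ∈ upperHalfSpace n,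
      (imMat z - Y₀).PosSemidef → R ≤ c * (imMat z).det →
      ENNReal.ofReal (‖L.detPow γ (-k) z * f (act γ z)‖ ^ 2) ≤
        D * ∫⁻ x in highSet Γ γ R, ENNReal.ofReal (density k f x)
          ∂(halfMeasure n).restrict (Subtype.val ⁻¹' F) := by
  obtain ⟨D, c, hD, hc, h⟩ := exists_density_le hn hΓ hf hF hY₀ hγ
  obtain ⟨m, hm, hmle⟩ := exists_le_det_imMat hY₀
  refine ⟨ENNReal.ofReal (m ^ (n - k)) * D, c, ENNReal.mul_ne_top ENNReal.ofReal_ne_top hD, hc,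
    fun R z hz hzY hR => ?_⟩
  have hp := det_imMat_pos hz
  have h1 := h R ⟨z, hz⟩ hzY hR
  set I := ∫⁻ x in highSet Γ γ R, ENNReal.ofReal (density k f x)
          ∂(halfMeasure n).restrict (Subtype.val ⁻¹' F)
  have e : density k f (γ • ⟨z, hz⟩) =
      (imMat z).det ^ k * ‖L.detPow γ (-k) z * f (act γ z)‖ ^ 2 :=
    (norm_sq_detPow_mul L k f γ hz).symm
  rw [e] at h1
  have e2 : ‖L.detPow γ (-k) z * f (act γ z)‖ ^ 2 = (imMat z).det ^ (-k) *
      ((imMat z).det ^ k * ‖L.detPow γ (-k) z * f (act γ z)‖ ^ 2) := by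
    rw [← mul_assoc, ← Real.rpow_add hp, neg_add_cancel, Real.rpow_zero, one_mul]
  rw [e2, ENNReal.ofReal_mul (by positivity)]
  calc _ ≤ ENNReal.ofReal ((imMat z).det ^ (-k)) *
        (D * ENNReal.ofReal ((imMat z).det ^ n) * I) := by gcongr
    _ = ENNReal.ofReal ((imMat z).det ^ (-k) * (imMat z).det ^ n) * D * I := by
        rw [ENNReal.ofReal_mul (by positivity)]; ring
    _ ≤ _ := by
        gcongr
        rw [← Real.rpow_natCast, ← Real.rpow_add hp, neg_add_eq_sub]
        exact Real.rpow_le_rpow_of_nonpos hm (hmle z hz hzY) (by linarith)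

theorem isSiegelCuspForm_of_lintegral_lt_top (hn : 1 ≤ n)
    (hΓ : Subgroup.Commensurable Γ (SpZ n)) (hk : n ≤ k)
    (hf : IsHolomorphicAutomorphic L Γ k f) {F : Set (SymC n)} (hF : IsFundDomain Γ F)
    (hfin : ∫⁻ x in Subtype.val ⁻¹' F, ENNReal.ofReal (density k f x) ∂halfMeasure n < ⊤) :
    IsSiegelCuspForm L Γ k f := by
  refine ⟨⟨hf, fun Y₀ hY₀ γ hγ => ?_⟩, fun Y₀ hY₀ γ hγ ε hε => ?_⟩
  · obtain ⟨D, c, hD, hc, h⟩ := exists_sq_norm_le hn hΓ hk hf hF hY₀ hγ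
    set T := D * ∫⁻ x in Subtype.val ⁻¹' F, ENNReal.ofReal (density k f x) ∂halfMeasure n with hT
    have hTt : T ≠ ⊤ := ENNReal.mul_ne_top hD hfin.ne
    refine ⟨√T.toReal, fun z hz hzY => ?_⟩
    refine Real.le_sqrt_of_sq_le ((ENNReal.ofReal_le_iff_le_toReal hTt).mp ?_)
    -- The height R is taken as large as allowed and then ignored: the full integral bounds the one
    -- over the high set.
    exact (h _ z hz hzY le_rfl).trans (mul_le_mul_right (setLIntegral_le_lintegral _ _) _)
  · obtain ⟨D, c, hD, hc, h⟩ := exists_sq_norm_le hn hΓ hk hf hF hY₀ hγ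
    -- D + 1 avoids division by zero, and ε/2 leaves room for the strict inequality.
    set η := ENNReal.ofReal ((ε / 2) ^ 2) / (D + 1) with hη
    have hD1 : D + 1 ≠ ⊤ := ENNReal.add_ne_top.mpr ⟨hD, ENNReal.one_ne_top⟩
    have hη0 : 0 < η := ENNReal.div_pos (ENNReal.ofReal_pos.mpr (by positivity)).ne' hD1
    obtain ⟨R, hR⟩ := exists_lintegral_highSet_le hΓ hγ hfin hη0
    refine ⟨R / c, fun z hz hzY hzR => ?_⟩
    have h1 : ENNReal.ofReal (‖L.detPow γ (-k) z * f (act γ z)‖ ^ 2) ≤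
        ENNReal.ofReal ((ε / 2) ^ 2) :=
      calc _ ≤ D * η := (h R z hz hzY ((div_le_iff₀' hc).mp hzR)).trans (mul_le_mul_right hR _)
        _ ≤ (D + 1) * η := mul_le_mul_left le_self_add _
        _ = _ := ENNReal.mul_div_cancel (by simp) hD1
    have h2 := (ENNReal.ofReal_le_ofReal_iff (by positivity)).mp h1
    have h3 := abs_le_of_sq_le_sq h2 (by positivity)
    rw [abs_of_nonneg (norm_nonneg _)] at h3
    linarith

theorem isSiegelCuspForm_of_memH (hn : 1 ≤ n) (hΓ : Subgroup.Commensurable Γ (SpZ n)) {α β : ℝ}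
    (hk : n ≤ α - β) {φ : SymC n → ℂ} (hφ : MemH L Γ α β φ)
    (hf : IsHolomorphicAutomorphic L Γ (α - β) f)
    (hφf : ∀ z ∈ upperHalfSpace n, φ z = (((imMat z).det ^ (-β) : ℝ) : ℂ) * f z) :
    IsSiegelCuspForm L Γ (α - β) f := by
  obtain ⟨F, hF, hfin⟩ := hφ.norm_lt_top
  refine isSiegelCuspForm_of_lintegral_lt_top hn hΓ hk hf hF ?_
  have e (z : Half n) : density (α - β) f z =
      (imMat (z : SymC n)).det ^ (α + β) * ‖φ z‖ ^ 2 := by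
    rw [← density_lift, density, density, lift_eq_of_eq z.2 (hφf z z.2)]
  simp only [e]
  rw [lintegral_fundDomain (fun z => ENNReal.ofReal ((imMat z).det ^ (α + β) * ‖φ z‖ ^ 2))
    hF.measurableSet]
  exact hfin

theorem norm_detPow_mul_eq {α β : ℝ} {φ : SymC n → ℂ} {γ : SpR n} {z : SymC n}
    (hz : z ∈ upperHalfSpace n) (h : φ (act γ z) =
      (((imMat (act γ z)).det ^ (-β) : ℝ) : ℂ) * f (act γ z)) :
    ‖L.detPow γ (-(α - β)) z * f (act γ z)‖ = (imMat z).det ^ β *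
      ‖L.detPow γ (-α) z * L.detConjPow γ (-β) z * φ (act γ z)‖ := by
  have hd : 0 < ‖(denom γ z).det‖ := norm_pos_iff.mpr (det_denom_ne_zero γ hz)
  have hc : ‖L.detConjPow γ (-β) z‖ = ‖L.detPow γ (-β) z‖ := by
    rw [LogBranch.detConjPow, LogBranch.detPow, Complex.norm_exp, Complex.norm_exp]
    simp
  rw [h, norm_mul, norm_mul, norm_mul, norm_mul, hc, norm_detPow L γ _ hz, norm_detPow L γ _ hz,
    norm_detPow L γ _ hz, Complex.norm_real, Real.norm_of_nonneg
      (Real.rpow_nonneg (det_imMat_pos (act_mem γ hz)).le _)]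
  have h1 : (imMat (act γ z)).det ^ β * (imMat (act γ z)).det ^ (-β) = 1 := by
    rw [← Real.rpow_add (det_imMat_pos (act_mem γ hz)), add_neg_cancel, Real.rpow_zero]
  have h2 : ‖(denom γ z).det‖ ^ (-(α - β)) =
      ‖(denom γ z).det‖ ^ (-α) * ‖(denom γ z).det‖ ^ (-β) * ‖(denom γ z).det‖ ^ (2 * β) := by
    rw [← Real.rpow_add hd, ← Real.rpow_add hd]
    congr 1
    ring
  rw [h2, ← det_imMat_act_rpow γ β hz]
  linear_combination (-(‖(denom γ z).det‖ ^ (-α) * ‖(denom γ z).det‖ ^ (-β) *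
    ‖(denom γ z).det‖ ^ (2 * β) * ‖f (act γ z)‖)) * h1

/-- The growth bound with exponent 0 gives the quantity in question the bound M det(Y)^β. As β < 0
this is bounded where det Y is bounded below, and tends to 0 as det Y grows. -/
theorem isSiegelCuspForm_of_growthBound {α β : ℝ} {φ : SymC n → ℂ} (hβ : β < 0)
    (hf : IsHolomorphicAutomorphic L Γ (α - β) f)
    (hφ : ∀ z ∈ upperHalfSpace n, φ z = (((imMat z).det ^ (-β) : ℝ) : ℂ) * f z)
    (h : ∀ Y₀ : Matrix (Fin n) (Fin n) ℝ, Y₀.PosDef → ∀ γ ∈ SpZ n, GrowthBound L α β φ γ Y₀ 0) :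
    IsSiegelCuspForm L Γ (α - β) f := by
  have key {Y₀ : Matrix (Fin n) (Fin n) ℝ} (hY₀ : Y₀.PosDef) {γ : SpR n} (hγ : γ ∈ SpZ n) :
      ∃ M : ℝ, 0 < M ∧ ∀ z ∈ upperHalfSpace n, (imMat z - Y₀).PosSemidef →
        ‖L.detPow γ (-(α - β)) z * f (act γ z)‖ ≤ (imMat z).det ^ β * M := by
    obtain ⟨M, hM, hb⟩ := h Y₀ hY₀ γ hγ
    refine ⟨M, hM, fun z hz hzY => ?_⟩
    rw [norm_detPow_mul_eq hz (hφ _ (act_mem γ hz))]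
    have := hb z hz hzY
    rw [pow_zero, mul_one] at this
    exact mul_le_mul_of_nonneg_left this (Real.rpow_nonneg (det_imMat_pos hz).le _)
  refine ⟨⟨hf, fun Y₀ hY₀ γ hγ => ?_⟩, fun Y₀ hY₀ γ hγ ε hε => ?_⟩
  · obtain ⟨M, hM, hb⟩ := key hY₀ hγ
    obtain ⟨m, hm, hmle⟩ := exists_le_det_imMat hY₀
    refine ⟨m ^ β * M, fun z hz hzY => (hb z hz hzY).trans ?_⟩
    exact mul_le_mul_of_nonneg_right
      (Real.rpow_le_rpow_of_nonpos hm (hmle z hz hzY) hβ.le) hM.le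
  · obtain ⟨M, hM, hb⟩ := key hY₀ hγ
    have hlim : Filter.Tendsto (fun t : ℝ => t ^ β * M) Filter.atTop (nhds 0) := by
      have := (tendsto_rpow_neg_atTop (neg_pos.mpr hβ)).mul_const M
      simpa using this
    obtain ⟨R, hR⟩ := Filter.eventually_atTop.mp (hlim.eventually_lt_const hε)
    exact ⟨R, fun z hz hzY hzR => (hb z hz hzY).trans_lt (hR _ hzR)⟩

end CuspForm

end SiegelMaass
end

theorem mainTheorem3 (n : ℕ) (hn : 1 ≤ n) (L : SiegelMaass.LogBranch n)
    (Γ : Subgroup (SiegelMaass.SpR n)) (hΓ : Subgroup.Commensurable Γ (SiegelMaass.SpZ n))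
    (α β : ℝ) (φ : SiegelMaass.SymC n → ℂ) (hφ : SiegelMaass.MemH L Γ α β φ)
    (l : ℂ) (hl : SiegelMaass.IsEigenform α β φ l) :
    -- the eigenvalue is real and bounded from below
    (l.im = 0 ∧ n * β * (α - (n + 1) / 2) ≤ l.re) ∧
    -- equality holds iff `Λ_β φ = 0`
    (l = ((n * β * (α - (n + 1) / 2) : ℝ) : ℂ) ↔
      ∀ z ∈ SiegelMaass.upperHalfSpace n,
        SiegelMaass.opLambda β (SiegelMaass.scalarMat φ) z = 0) ∧
    -- equality holds iff `φ = det (Y) ^ (-β) f` with `f` holomorphic and automorphic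
    (l = ((n * β * (α - (n + 1) / 2) : ℝ) : ℂ) ↔
      ∃ f : SiegelMaass.SymC n → ℂ,
        SiegelMaass.IsHolomorphicAutomorphic L Γ (α - β) f ∧
        ∀ z ∈ SiegelMaass.upperHalfSpace n,
          φ z = (((SiegelMaass.imMat z).det ^ (-β) : ℝ) : ℂ) * f z) ∧
    -- such an `f` is a cusp form if `β < 0` and either `α - β ≥ n` or `φ` has growth exponent `0`
    (β < 0 →
      ((n : ℝ) ≤ α - β ∨
        ∀ Y₀ : Matrix (Fin n) (Fin n) ℝ, Y₀.PosDef → ∀ γ ∈ SiegelMaass.SpZ n,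
          SiegelMaass.GrowthBound L α β φ γ Y₀ 0) →
      ∀ f : SiegelMaass.SymC n → ℂ,
        SiegelMaass.IsHolomorphicAutomorphic L Γ (α - β) f →
        (∀ z ∈ SiegelMaass.upperHalfSpace n,
          φ z = (((SiegelMaass.imMat z).det ^ (-β) : ℝ) : ℂ) * f z) →
        SiegelMaass.IsSiegelCuspForm L Γ (α - β) f) := by
  have h1 := SiegelMaass.eigenvalue_eq_iff hΓ hφ hl
  refine ⟨SiegelMaass.eigenvalue_real_and_ge hΓ hφ hl,
    h1.trans (SiegelMaass.grad_lift_eq_zero_iff_opLambda hφ.toMemV),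
    h1.trans (SiegelMaass.grad_lift_eq_zero_iff_holomorphic hφ.toMemV), ?_⟩
  rintro hβ (hk | hN) f hf hφf
  · exact SiegelMaass.isSiegelCuspForm_of_memH hn hΓ hk hφ hf hφf
  · exact SiegelMaass.isSiegelCuspForm_of_growthBound hβ hf hφf hN
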